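/- **Setting.** Let $SO(3)$ be the group of real orthogonal $3\times 3$ matrices of determinant $1$, with its usual smooth structure, and let its *standard metric* be the Riemannian metric $g$ induced by the scalar product $\langle A,B\rangle=\tfrac12\operatorname{tr}(A^TB)$ on $\mathbb R^{3\times3}$. The Euler angles are $$R(\varphi,\theta,\psi)=R_3(\varphi)R_2(\theta)R_3(\psi),\quad R_3(\varphi)=\begin{pmatrix}\cos\varphi&-\sin\varphi&0\\ \sin\varphi&\cos\varphi&0\\0&0&1\end{pmatrix},\quad R_2(\theta)=\begin{pmatrix}\cos\theta&0&\sin\theta\\0&1&0\\-\sin\theta&0&\cos\theta\end{pmatrix}.$$ Let $D^l_{m,s}$ ($l\in\mathbb N$, $m,s\in\{-l,\dots,l\}$) be the Wigner $D$-functions, i.e. the matrix coefficients of the irreducible unitary representation of $SO(3)$ of dimension $2l+1$, with $D^l_{m,s}(R(\varphi,\theta,\psi))=e^{-im\varphi}d^l_{m,s}(\theta)e^{-is\psi}$, where $d^l_{m,s}(\theta)=D^l_{m,s}(R_2(\theta))$. Let $s\in\mathbb Z$, let $c_l\ge 0$ ($l\ge|s|$) be real numbers, and let $\gamma^l_{m,s}$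 ($l\ge|s|$, $-l\le m\le l$) be i.i.d. complex Gaussian variables on a probability space, whose real and imaginary parts are independent with law $\mathcal N(0,\tfrac12)$. Assume that the series $$k(\theta)=\sum_{l\ge|s|}c_l^2\,d^l_{s,s}(\theta)$$ converges in the $\mathcal C^\infty(\mathbb R)$ topology, that $\sum_{l\ge|s|}\frac{c_l^2}{2}=1$, and let $\xi\in\mathbb R$ satisfy $$\xi^2=\sum_{l\ge|s|}\frac{c_l^2}{2}\,\frac{l(l+1)-s^2}{2}.$$ Let $$f=\Re\sum_{l\ge|s|}c_l\sum_{m=-l}^{l}\gamma^l_{m,s}D^l_{m,s}.$$ **Theorem 1.3.** Almost surely the series that defines $f$ converges at every point of $SO(3)$ and $f$ is of class $\mathcal C^\infty$ on $SO(3)$; moreover $f$ is a centered Gaussian field of unit variance, and $\xi^2=-\tfrac12k''(0)$. The expectations in $$g^f_p(u,v)=\mathbb E\{d_pf(u)\,d_pf(v)\},\qquad p\in SO(3),\ u,v\in T_pSO(3),$$ exist, and: 1. The Gram matrix of $g^f$ with respect to $\partial_\varphi R,\partial_\theta R,\partial_\psi R$ at $p=R(\varphi,\theta,\psi)$, for all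 $(\varphi,\theta,\psi)\in\mathbb R^3$, is $$\Sigma_{(\xi,s)}(\theta)=\begin{pmatrix}\xi^2\sin^2\theta+s^2\cos^2\theta&0&s^2\cos\theta\\0&\xi^2&0\\s^2\cos\theta&0&s^2\end{pmatrix}.$$ 2. The Gram matrix of the standard metric $g$ in the same coordinates is $\Sigma_{(1,1)}(\theta)$. 3. At every $p\in SO(3)$, the eigenvalues of $g^f_p$ with respect to $g_p$ (the eigenvalues of the matrix of $g^f_p$ in any $g_p$-orthonormal basis of $T_pSO(3)$) are $\xi^2,\xi^2,s^2$, counted with multiplicity. 4. If $s\neq0$, then $g^f$ is a smooth Riemannian metric on $SO(3)$ (the Adler–Taylor metric of $f$), and its scalar curvature is constant, equal to $$\operatorname{scal}^f=\frac{2}{\xi^2}-\frac{s^2}{2\xi^4}.$$ -/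

import Mathlib

open MeasureTheory ProbabilityTheory
open scoped Manifold ContDiff Matrix Topology Nat

noncomputable section

namespace SpinField

/-! ## The rotation group as a smooth manifold -/

/-- The group `SO(3)`. -/
abbrev SO3 : Type := ↥(Matrix.specialOrthogonalGroup (Fin 3) ℝ)

/-- The Euclidean space `ℝ³`, the model space of the manifold `SO(3)`. -/
abbrev R3 : Type := EuclideanSpace ℝ (Fin 3)

theorem SO3.transpose_mul_self (p : SO3) : p.1ᵀ * p.1 = 1 :=
  (Matrix.mem_orthogonalGroup_iff' _ _).1 (Matrix.mem_specialOrthogonalGroup_iff.1 p.2).1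

theorem SO3.mul_transpose_self (p : SO3) : p.1 * p.1ᵀ = 1 :=
  (Matrix.mem_orthogonalGroup_iff _ _).1 (Matrix.mem_specialOrthogonalGroup_iff.1 p.2).1

theorem SO3.det_eq_one (p : SO3) : p.1.det = 1 :=
  (Matrix.mem_specialOrthogonalGroup_iff.1 p.2).2

/-- Membership in `SO(3)`, in terms of the transpose and the determinant. -/
theorem mem_SO3 {A : Matrix (Fin 3) (Fin 3) ℝ} (h : Aᵀ * A = 1) (hd : A.det = 1) :
    A ∈ Matrix.specialOrthogonalGroup (Fin 3) ℝ :=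
  Matrix.mem_specialOrthogonalGroup_iff.2 ⟨(Matrix.mem_orthogonalGroup_iff' _ _).2 h, hd⟩

/-- The Cayley parametrization of the rotations that are not half-turns. Here
`(cayleyMatrix v) = (1 - [v]/2)⁻¹ (1 + [v]/2)`, where `[v]` is the matrix of `w ↦ v × w`. -/
def cayleyMatrix (v : R3) : Matrix (Fin 3) (Fin 3) ℝ :=
  (4 + v 0 ^ 2 + v 1 ^ 2 + v 2 ^ 2)⁻¹ •
    !![4 + v 0 ^ 2 - v 1 ^ 2 - v 2 ^ 2, 2 * v 0 * v 1 - 4 * v 2, 2 * v 0 * v 2 + 4 * v 1;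
       2 * v 0 * v 1 + 4 * v 2, 4 - v 0 ^ 2 + v 1 ^ 2 - v 2 ^ 2, 2 * v 1 * v 2 - 4 * v 0;
       2 * v 0 * v 2 - 4 * v 1, 2 * v 1 * v 2 + 4 * v 0, 4 - v 0 ^ 2 - v 1 ^ 2 + v 2 ^ 2]

/-- The inverse of the Cayley parametrization. -/
def cayleyInv (A : Matrix (Fin 3) (Fin 3) ℝ) : R3 :=
  !₂[2 * (A 2 1 - A 1 2) / (1 + A.trace), 2 * (A 0 2 - A 2 0) / (1 + A.trace),
    2 * (A 1 0 - A 0 1) / (1 + A.trace)]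

theorem cayley_denom_pos (v : R3) : 0 < 4 + v 0 ^ 2 + v 1 ^ 2 + v 2 ^ 2 := by positivity

theorem cayleyMatrix_mem (v : R3) :
    cayleyMatrix v ∈ Matrix.specialOrthogonalGroup (Fin 3) ℝ := by
  have h := (cayley_denom_pos v).ne'
  apply mem_SO3
  · ext i j
    fin_cases i <;> fin_cases j <;>
      simp [cayleyMatrix, Matrix.mul_apply, Fin.sum_univ_three] <;> field_simp <;> ring
  · simp [cayleyMatrix, Matrix.det_fin_three]
    field_simp
    ring

theorem one_add_trace_cayleyMatrix (v : R3) :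
    1 + (cayleyMatrix v).trace = 16 / (4 + v 0 ^ 2 + v 1 ^ 2 + v 2 ^ 2) := by
  have h := (cayley_denom_pos v).ne'
  simp [cayleyMatrix, Matrix.trace, Fin.sum_univ_three]
  field_simp
  ring

theorem cayleyInv_cayleyMatrix (v : R3) : cayleyInv (cayleyMatrix v) = v := by
  have h := (cayley_denom_pos v).ne'
  ext i
  fin_cases i <;> simp only [cayleyInv, one_add_trace_cayleyMatrix] <;>
    simp [cayleyMatrix] <;> field_simp <;> ring

/-- Rotation matrices equal their own cofactor matrix. -/
theorem SO3.adjugate_eq (p : SO3) : p.1.adjugate = p.1ᵀ := by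
  have h1 : p.1.adjugate * (p.1 * p.1ᵀ) = p.1ᵀ := by
    rw [← Matrix.mul_assoc, Matrix.adjugate_mul, p.det_eq_one, one_smul, one_mul]
  rwa [p.mul_transpose_self, mul_one] at h1

theorem cayleyMatrix_cayleyInv (p : SO3) (h : 1 + p.1.trace ≠ 0) :
    cayleyMatrix (cayleyInv p.1) = p.1 := by
  have hr := p.mul_transpose_self
  have hc := p.transpose_mul_self
  have ha := p.adjugate_eq
  obtain ⟨A, hA⟩ := p
  simp only at h hr hc ha ⊢
  have R := fun i j => congrFun (congrFun hr i) j
  have K := fun i j => congrFun (congrFun hc i) j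
  have F := fun i j => congrFun (congrFun ha i) j
  simp only [Matrix.adjugate_fin_three, Matrix.transpose_apply] at F
  simp only [Matrix.mul_apply, Matrix.transpose_apply, Fin.sum_univ_three, Matrix.one_apply] at R K
  have R00 := R 0 0
  have R11 := R 1 1
  have R22 := R 2 2
  have R01 := R 0 1
  have R02 := R 0 2
  have R12 := R 1 2
  have K00 := K 0 0
  have K11 := K 1 1
  have K22 := K 2 2
  have K01 := K 0 1
  have K02 := K 0 2
  have K12 := K 1 2
  have F00 := F 0 0
  have F11 := F 1 1
  have F22 := F 2 2
  have F01 := F 0 1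
  have F02 := F 0 2
  have F12 := F 1 2
  have F10 := F 1 0
  have F20 := F 2 0
  have F21 := F 2 1
  clear R K F hr hc ha hA
  simp [Matrix.trace, Fin.sum_univ_three] at *
  have ht : A.trace = A 0 0 + A 1 1 + A 2 2 := by simp [Matrix.trace, Fin.sum_univ_three]
  have e0 : (A 0 2 - A 2 0) ^ 2 + (A 1 0 - A 0 1) ^ 2
      = 2 * (1 + (A 0 0 + A 1 1 + A 2 2)) * (1 - A 0 0) := by
    linear_combination R00 + K00 + 2 * F11 + 2 * F22
  have e1 : (A 2 1 - A 1 2) ^ 2 + (A 1 0 - A 0 1) ^ 2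
      = 2 * (1 + (A 0 0 + A 1 1 + A 2 2)) * (1 - A 1 1) := by
    linear_combination R11 + K11 + 2 * F00 + 2 * F22
  have e2 : (A 2 1 - A 1 2) ^ 2 + (A 0 2 - A 2 0) ^ 2
      = 2 * (1 + (A 0 0 + A 1 1 + A 2 2)) * (1 - A 2 2) := by
    linear_combination R22 + K22 + 2 * F00 + 2 * F11
  have f2 : (A 2 1 - A 1 2) * (A 0 2 - A 2 0)
      = (1 + (A 0 0 + A 1 1 + A 2 2)) * (A 0 1 + A 1 0) := by
    linear_combination -R01 - K01 + F01 + F10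
  have f1 : (A 2 1 - A 1 2) * (A 1 0 - A 0 1)
      = (1 + (A 0 0 + A 1 1 + A 2 2)) * (A 0 2 + A 2 0) := by
    linear_combination -R02 - K02 + F02 + F20
  have f0 : (A 0 2 - A 2 0) * (A 1 0 - A 0 1)
      = (1 + (A 0 0 + A 1 1 + A 2 2)) * (A 1 2 + A 2 1) := by
    linear_combination -R12 - K12 + F12 + F21
  set t := 1 + (A 0 0 + A 1 1 + A 2 2) with htdef
  have hd : 4 + (cayleyInv A) 0 ^ 2 + (cayleyInv A) 1 ^ 2 + (cayleyInv A) 2 ^ 2 = 16 / t := by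
    simp only [cayleyInv, ht, ← htdef]
    simp
    field_simp
    linear_combination 2 * (e0 + e1 + e2)
  ext i j
  simp only [cayleyMatrix, hd]
  fin_cases i <;> fin_cases j <;> simp only [cayleyInv, ht, ← htdef] <;> simp <;> field_simp
  · linear_combination 2 * e1 + 2 * e2 - 6 * e0 + 4 * t * htdef
  · linear_combination 8 * f2
  · linear_combination 8 * f1
  · linear_combination 8 * f2
  · linear_combination 2 * e0 + 2 * e2 - 6 * e1 + 4 * t * htdef
  · linear_combination 8 * f0
  · linear_combination 8 * f1
  · linear_combination 8 * f0
  · linear_combination 2 * e0 + 2 * e1 - 6 * e2 + 4 * t * htdef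

theorem continuous_cayleyMatrix : Continuous cayleyMatrix := by
  unfold cayleyMatrix
  refine Continuous.smul (Continuous.inv₀ (by fun_prop) fun v => (cayley_denom_pos v).ne') ?_
  refine continuous_matrix fun i j => ?_
  fin_cases i <;> fin_cases j <;> simp <;> fun_prop

/-- The chart of `SO(3)` centred at `p`: the left translate by `p` of the inverse of the Cayley
parametrization. It is defined at all `q` such that `p⁻¹ q` is not a half-turn. -/
def cayleyChart (p : SO3) : OpenPartialHomeomorph SO3 R3 where
  toFun q := cayleyInv (p.1ᵀ * q.1)
  invFun v := p * ⟨cayleyMatrix v, cayleyMatrix_mem v⟩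
  source := {q | 1 + (p.1ᵀ * q.1).trace ≠ 0}
  target := Set.univ
  map_source' _ _ := Set.mem_univ _
  map_target' v _ := by
    have h : p.1ᵀ * (p.1 * cayleyMatrix v) = cayleyMatrix v := by
      rw [← Matrix.mul_assoc, p.transpose_mul_self, one_mul]
    change 1 + (p.1ᵀ * (p.1 * cayleyMatrix v)).trace ≠ 0
    rw [h, one_add_trace_cayleyMatrix]
    exact (div_pos (by norm_num) (cayley_denom_pos v)).ne'
  left_inv' q hq := by
    have hm : p.1ᵀ * q.1 ∈ Matrix.specialOrthogonalGroup (Fin 3) ℝ := by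
      apply mem_SO3
      · rw [Matrix.transpose_mul, Matrix.transpose_transpose, Matrix.mul_assoc,
          ← Matrix.mul_assoc p.1, p.mul_transpose_self, one_mul, q.transpose_mul_self]
      · rw [Matrix.det_mul, Matrix.det_transpose, p.det_eq_one, q.det_eq_one, one_mul]
    apply Subtype.ext
    have h := cayleyMatrix_cayleyInv ⟨_, hm⟩ hq
    simp only at h
    simp only [Submonoid.coe_mul, h]
    rw [← Matrix.mul_assoc, p.mul_transpose_self, one_mul]
  right_inv' v _ := by
    have h : p.1ᵀ * (p.1 * cayleyMatrix v) = cayleyMatrix v := by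
      rw [← Matrix.mul_assoc, p.transpose_mul_self, one_mul]
    simp only [Submonoid.coe_mul, h, cayleyInv_cayleyMatrix]
  open_source := by
    refine isOpen_ne_fun ?_ continuous_const
    exact continuous_const.add
      ((continuous_const.matrix_mul continuous_subtype_val).matrix_trace)
  open_target := isOpen_univ
  continuousOn_toFun := by
    have hA : Continuous fun q : SO3 => p.1ᵀ * q.1 :=
      continuous_const.matrix_mul continuous_subtype_val
    have ht : ContinuousOn (fun q : SO3 => 1 + (p.1ᵀ * q.1).trace)
        {q | 1 + (p.1ᵀ * q.1).trace ≠ 0} := (continuous_const.add hA.matrix_trace).continuousOn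
    have hE : ∀ i j, Continuous fun q : SO3 => (p.1ᵀ * q.1) i j := fun i j => hA.matrix_elem i j
    refine (PiLp.continuous_toLp 2 _).comp_continuousOn (continuousOn_pi.2 fun i => ?_)
    fin_cases i <;>
      exact ContinuousOn.div (continuous_const.mul ((hE _ _).sub (hE _ _))).continuousOn ht
        fun q hq => hq
  continuousOn_invFun := by
    refine Continuous.continuousOn ?_
    exact continuous_const.mul (continuous_cayleyMatrix.subtype_mk _)

theorem mem_cayleyChart_source (p : SO3) : p ∈ (cayleyChart p).source := by
  change 1 + (p.1ᵀ * p.1).trace ≠ 0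
  rw [p.transpose_mul_self]
  simp
  norm_num

/-- The atlas of `SO(3)` that consists of the left-translated Cayley charts. It defines the usual
smooth structure of `SO(3)`, as a submanifold of the space of `3 × 3` matrices. -/
instance : ChartedSpace R3 SO3 where
  atlas := Set.range cayleyChart
  chartAt := cayleyChart
  mem_chart_source := mem_cayleyChart_source
  chart_mem_atlas p := ⟨p, rfl⟩

theorem contDiff_cayleyMatrix_apply (i j : Fin 3) :
    ContDiff ℝ ∞ fun v : R3 => cayleyMatrix v i j := by
  have h0 : ∀ k : Fin 3, ContDiff ℝ ∞ fun v : R3 => v k := fun k => by fun_prop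
  have h1 : ContDiff ℝ ∞ fun v : R3 => (4 + v 0 ^ 2 + v 1 ^ 2 + v 2 ^ 2)⁻¹ :=
    ContDiff.inv (by fun_prop) fun v => (cayley_denom_pos v).ne'
  simp only [cayleyMatrix, Matrix.smul_apply, smul_eq_mul]
  refine h1.mul ?_
  fin_cases i <;> fin_cases j <;> simp <;> fun_prop

instance : IsManifold (𝓡 3) ∞ SO3 := by
  refine isManifold_of_contDiffOn (𝓡 3) ∞ SO3 ?_
  rintro _ _ ⟨p, rfl⟩ ⟨q, rfl⟩
  have hE : ∀ i j, ContDiff ℝ ∞ fun v : R3 => (q.1ᵀ * (p.1 * cayleyMatrix v)) i j := by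
    intro i j
    simp only [← Matrix.mul_assoc]
    simp only [Matrix.mul_apply (M := q.1ᵀ * p.1)]
    exact ContDiff.sum fun k _ => contDiff_const.mul (contDiff_cayleyMatrix_apply k j)
  have hT : ContDiff ℝ ∞ fun v : R3 => 1 + (q.1ᵀ * (p.1 * cayleyMatrix v)).trace := by
    simp only [Matrix.trace, Matrix.diag]
    exact contDiff_const.add (ContDiff.sum fun k _ => hE k k)
  have key : ContDiffOn ℝ ∞ (fun v : R3 => cayleyInv (q.1ᵀ * (p.1 * cayleyMatrix v)))
      {v | 1 + (q.1ᵀ * (p.1 * cayleyMatrix v)).trace ≠ 0} := by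
    rw [contDiffOn_euclidean]
    intro i
    fin_cases i <;>
      exact ContDiffOn.div (contDiff_const.mul ((hE _ _).sub (hE _ _))).contDiffOn
        hT.contDiffOn fun v hv => hv
  refine key.mono ?_
  rintro v ⟨hv, -⟩
  simpa [cayleyChart, Matrix.mul_assoc] using hv

/-! ## Euler angles -/

/-- The rotation by the angle `x` about the third axis. -/
def rotZ (x : ℝ) : SO3 :=
  ⟨!![Real.cos x, -Real.sin x, 0; Real.sin x, Real.cos x, 0; 0, 0, 1], by
    have h := Real.sin_sq_add_cos_sq x
    apply mem_SO3
    · ext i j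
      fin_cases i <;> fin_cases j <;>
        simp [Matrix.mul_apply, Fin.sum_univ_three] <;> linarith
    · simp [Matrix.det_fin_three]
      linarith⟩

/-- The rotation by the angle `x` about the second axis. -/
def rotY (x : ℝ) : SO3 :=
  ⟨!![Real.cos x, 0, Real.sin x; 0, 1, 0; -Real.sin x, 0, Real.cos x], by
    have h := Real.sin_sq_add_cos_sq x
    apply mem_SO3
    · ext i j
      fin_cases i <;> fin_cases j <;>
        simp [Matrix.mul_apply, Fin.sum_univ_three] <;> linarith
    · simp [Matrix.det_fin_three]
      linarith⟩

/-- The Euler angles parametrization, where `x = (φ, θ, ψ)`. -/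
def euler (x : R3) : SO3 := rotZ (x 0) * rotY (x 1) * rotZ (x 2)

/-! ## Wigner functions -/

/-- The three Pauli matrices. -/
def pauli : Fin 3 → Matrix (Fin 2) (Fin 2) ℂ :=
  ![!![0, 1; 1, 0], !![0, -Complex.I; Complex.I, 0], !![1, 0; 0, -1]]

/-- `A ∈ SU(2)` is one of the two preimages of the rotation `p` under the double covering
`SU(2) → SO(3)`, in the form `A (v · σ) A* = (p v) · σ`. -/
def IsSpinLift (A : Matrix (Fin 2) (Fin 2) ℂ) (p : SO3) : Prop :=
  A ∈ Matrix.specialUnitaryGroup (Fin 2) ℂ ∧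
    ∀ j, A * pauli j * Aᴴ = ∑ i, (p.1 i j : ℂ) • pauli i

theorem IsSpinLift.mul {A B : Matrix (Fin 2) (Fin 2) ℂ} {p q : SO3}
    (hA : IsSpinLift A p) (hB : IsSpinLift B q) : IsSpinLift (A * B) (p * q) := by
  refine ⟨mul_mem hA.1 hB.1, fun j => ?_⟩
  have h : A * B * pauli j * (A * B)ᴴ = A * (B * pauli j * Bᴴ) * Aᴴ := by
    simp only [Matrix.conjTranspose_mul, Matrix.mul_assoc]
  rw [h, hB.2 j, Matrix.mul_sum, Matrix.sum_mul]
  simp only [Matrix.mul_smul, Matrix.smul_mul, hA.2, Submonoid.coe_mul, Matrix.mul_apply,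
    Complex.ofReal_sum, Complex.ofReal_mul, Finset.sum_smul, Finset.smul_sum, smul_smul]
  rw [Finset.sum_comm]
  simp only [mul_comm]

theorem isSpinLift_cayley (v : R3) :
    IsSpinLift (((Real.sqrt (4 + v 0 ^ 2 + v 1 ^ 2 + v 2 ^ 2))⁻¹ : ℂ) •
      !![2 - Complex.I * v 2, -Complex.I * v 0 - v 1; -Complex.I * v 0 + v 1, 2 + Complex.I * v 2])
      ⟨cayleyMatrix v, cayleyMatrix_mem v⟩ := by
  have hn := cayley_denom_pos v
  set n := 4 + v 0 ^ 2 + v 1 ^ 2 + v 2 ^ 2 with hndef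
  set r := Real.sqrt n with hr
  have hr0 : (r : ℂ) ≠ 0 := by exact_mod_cast (Real.sqrt_pos.2 hn).ne'
  have hr2 : (r : ℂ) ^ 2 = 4 + (v 0 : ℂ) ^ 2 + (v 1 : ℂ) ^ 2 + (v 2 : ℂ) ^ 2 := by
    rw [← Complex.ofReal_pow, hr, Real.sq_sqrt hn.le, hndef]
    push_cast
    ring
  have hN : 4 + (v 0 : ℂ) ^ 2 + (v 1 : ℂ) ^ 2 + (v 2 : ℂ) ^ 2 ≠ 0 := by
    rw [← hr2]
    exact pow_ne_zero 2 hr0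
  have hI := Complex.I_sq
  refine ⟨Matrix.mem_specialUnitaryGroup_iff.2 ⟨Matrix.mem_unitaryGroup_iff.2 ?_, ?_⟩, fun j => ?_⟩
  · ext i j
    fin_cases i <;> fin_cases j <;>
      simp [Matrix.mul_apply, Fin.sum_univ_two, Matrix.star_apply, map_ofNat] <;> field_simp <;>
      grind
  · simp [Matrix.det_fin_two]
    field_simp
    grind
  · simp only [cayleyMatrix, ← hndef, Fin.sum_univ_three]
    ext a b
    fin_cases j <;> fin_cases a <;> fin_cases b <;>
      simp [pauli, Matrix.mul_apply, Fin.sum_univ_two, hndef, map_ofNat] <;> field_simp <;> grind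

/-- The half-turns about the three axes. -/
def halfTurn (k : Fin 3) : SO3 :=
  ⟨Matrix.diagonal fun i => if i = k then 1 else -1, by
    apply mem_SO3
    · ext i j
      fin_cases k <;> fin_cases i <;> fin_cases j <;> simp
    · fin_cases k <;> simp [Fin.prod_univ_three]⟩

theorem isSpinLift_halfTurn (k : Fin 3) : IsSpinLift (-Complex.I • pauli k) (halfTurn k) := by
  refine ⟨Matrix.mem_specialUnitaryGroup_iff.2 ⟨Matrix.mem_unitaryGroup_iff.2 ?_, ?_⟩, fun j => ?_⟩
  · ext i j
    fin_cases k <;> fin_cases i <;> fin_cases j <;>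
      simp [pauli, Matrix.mul_apply, Fin.sum_univ_two, Matrix.star_apply]
  · fin_cases k <;> simp [pauli, Matrix.det_fin_two]
  · ext a b
    fin_cases k <;> fin_cases j <;> fin_cases a <;> fin_cases b <;>
      simp [pauli, halfTurn, Matrix.mul_apply, Fin.sum_univ_two, Fin.sum_univ_three]

theorem halfTurn_mul_self (k : Fin 3) : halfTurn k * halfTurn k = 1 := by
  apply Subtype.ext
  ext i j
  fin_cases k <;> fin_cases i <;> fin_cases j <;> simp [halfTurn]

/-- The double covering `SU(2) → SO(3)` is onto. -/
theorem exists_isSpinLift (p : SO3) : ∃ A, IsSpinLift A p := by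
  have key : ∀ q : SO3, 1 + q.1.trace ≠ 0 → ∃ A, IsSpinLift A q := fun q hq => by
    have h : (⟨cayleyMatrix (cayleyInv q.1), cayleyMatrix_mem _⟩ : SO3) = q :=
      Subtype.ext (cayleyMatrix_cayleyInv q hq)
    exact ⟨_, h ▸ isSpinLift_cayley (cayleyInv q.1)⟩
  by_cases h : 1 + p.1.trace = 0
  · have hk : ∃ k, 1 + (p * halfTurn k).1.trace ≠ 0 := by
      by_contra! hk
      have h0 := hk 0
      have h1 := hk 1
      have h2 := hk 2
      simp [Matrix.trace, Fin.sum_univ_three, halfTurn] at h h0 h1 h2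
      linarith
    obtain ⟨k, hk⟩ := hk
    obtain ⟨A, hA⟩ := key _ hk
    have h := hA.mul (isSpinLift_halfTurn k)
    rw [mul_assoc, halfTurn_mul_self, mul_one] at h
    exact ⟨_, h⟩
  · exact key p h

/-- A preimage of a rotation in `SU(2)`. It is determined up to the sign. -/
def spinLift (p : SO3) : Matrix (Fin 2) (Fin 2) ℂ := (exists_isSpinLift p).choose

/-- The matrix coefficients of the representation of `SU(2)` on the homogeneous polynomials of
degree `2l` in two variables, with respect to the orthonormal basis
`e_m = X^(l+m) Y^(l-m) / √((l+m)! (l-m)!)`, `-l ≤ m ≤ l`. The matrix `A` acts by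
`X ↦ A₀₀ X + A₁₀ Y`, `Y ↦ A₀₁ X + A₁₁ Y`, and the coefficient with indices `m, s` is that of `e_m`
in the image of `e_s`. It is extracted after setting `Y = 1`. -/
def wignerSU2 (l : ℕ) (m s : ℤ) (A : Matrix (Fin 2) (Fin 2) ℂ) : ℂ :=
  (Real.sqrt ((((l + m).toNat)! * ((l - m).toNat)! : ℝ) /
      (((l + s).toNat)! * ((l - s).toNat)! : ℝ)) : ℂ) *
    (((Polynomial.C (A 0 0) * Polynomial.X + Polynomial.C (A 1 0)) ^ (l + s).toNat *
      (Polynomial.C (A 0 1) * Polynomial.X + Polynomial.C (A 1 1)) ^ (l - s).toNat).coeff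
        (l + m).toNat)

/-- The Wigner function `D^l_{m,s}` on `SO(3)`, for `|m|, |s| ≤ l`. Since the degree `2l` is even,
it does not depend on the choice of the preimage in `SU(2)`. -/
def wignerD (l : ℕ) (m s : ℤ) (p : SO3) : ℂ := wignerSU2 l m s (spinLift p)

/-- The diagonal Wigner d-function `d^l_{s,s}(θ) = D^l_{s,s}(R₂(θ))`, which is real. -/
def wignerd (l : ℕ) (s : ℤ) (x : ℝ) : ℝ := (wignerD l s s (rotY x)).re

/-! ## The spin field -/

/-- The circular covariance `k = ∑_{l ≥ |s|} c_l² d^l_{s,s}`. -/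
def circularCov (s : ℤ) (c : ℕ → ℝ) (x : ℝ) : ℝ :=
  ∑' l : ℕ, if s.natAbs ≤ l then c l ^ 2 * wignerd l s x else 0

/-- The series that defines the circular covariance converges in `C^∞(ℝ)`: its sum is smooth, and
the derivatives of all orders of the partial sums converge to those of the sum, uniformly on
compact sets. -/
def SmoothlyConvergent (s : ℤ) (c : ℕ → ℝ) : Prop :=
  ContDiff ℝ ∞ (circularCov s c) ∧
    ∀ n : ℕ, TendstoLocallyUniformly
      (fun N : ℕ => iteratedDeriv n fun x =>
        ∑ l ∈ Finset.range N, if s.natAbs ≤ l then c l ^ 2 * wignerd l s x else 0)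
      (iteratedDeriv n (circularCov s c)) Filter.atTop

/-- The law of a standard complex Gaussian variable, whose real and imaginary parts are
independent with law `N(0, 1/2)`. -/
def complexGaussian : Measure ℂ :=
  ((gaussianReal 0 2⁻¹).prod (gaussianReal 0 2⁻¹)).map fun x => (⟨x.1, x.2⟩ : ℂ)

/-- The index set of the coefficients `γ^l_{m,s}`: the pairs `(l, m)` with `l ≥ |s|` and
`-l ≤ m ≤ l`. -/
abbrev SpinIndex (s : ℤ) : Type := {i : ℕ × ℤ // s.natAbs ≤ i.1 ∧ |i.2| ≤ i.1}

variable {Ω : Type*} [MeasurableSpace Ω]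

/-- The variables `γ^l_{m,s}` are independent standard complex Gaussians. -/
def IsComplexGaussianFamily (P : Measure Ω) (s : ℤ) (γ : ℕ → ℤ → Ω → ℂ) : Prop :=
  (∀ i : SpinIndex s, HasLaw (γ i.1.1 i.1.2) complexGaussian P) ∧
    iIndepFun (fun i : SpinIndex s => γ i.1.1 i.1.2) P

/-- The `l`-th term of the series that defines the complex spin field. -/
def spinTerm (s : ℤ) (c : ℕ → ℝ) (γ : ℕ → ℤ → Ω → ℂ) (w : Ω) (p : SO3) (l : ℕ) : ℂ :=
  if s.natAbs ≤ l then
    (c l : ℂ) * ∑ m ∈ Finset.Icc (-(l : ℤ)) l, γ l m w * wignerD l m s p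
  else 0

/-- The real spin field
`f = Re ∑_{l ≥ |s|} c_l ∑_{-l ≤ m ≤ l} γ^l_{m,s} D^l_{m,s}`. -/
def spinField (s : ℤ) (c : ℕ → ℝ) (γ : ℕ → ℤ → Ω → ℂ) (p : SO3) (w : Ω) : ℝ :=
  (∑' l : ℕ, spinTerm s c γ w p l).re

/-! ## Metrics and curvature -/

/-- The differential of a real function on `SO(3)` at `p`, as a real function of the tangent
vector. -/
def tangentDiff (h : SO3 → ℝ) (p : SO3) (u : TangentSpace (𝓡 3) p) : ℝ :=
  mfderiv (𝓡 3) 𝓘(ℝ, ℝ) h p u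

/-- The bilinear form `g^f_p(u, v) = E[d_p f(u) d_p f(v)]` of a random field `f` on `SO(3)`. -/
def adlerTaylor (P : Measure Ω) (f : SO3 → Ω → ℝ) (p : SO3) (u v : TangentSpace (𝓡 3) p) : ℝ :=
  ∫ w, tangentDiff (fun q => f q w) p u * tangentDiff (fun q => f q w) p v ∂P

/-- The image of a tangent vector of `SO(3)` under the differential of the inclusion into the
`3 × 3` matrices. -/
def inclusionDiff (p : SO3) (u : TangentSpace (𝓡 3) p) : Matrix (Fin 3) (Fin 3) ℝ :=
  Matrix.of fun i j => tangentDiff (fun q => q.1 i j) p u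

/-- The standard metric of `SO(3)`, induced by the scalar product `tr(Aᵀ B) / 2` of matrices. -/
def standardMetric (p : SO3) (u v : TangentSpace (𝓡 3) p) : ℝ :=
  ((inclusionDiff p u)ᵀ * inclusionDiff p v).trace / 2

section Curvature

variable {n : ℕ}

/-- The partial derivative of `h` in the `i`-th coordinate direction. -/
def partialDeriv (i : Fin n) (h : EuclideanSpace ℝ (Fin n) → ℝ)
    (x : EuclideanSpace ℝ (Fin n)) : ℝ :=
  fderiv ℝ h x (EuclideanSpace.single i 1)

/-- The Christoffel symbol `Γ^m_{ij}` of the metric with coefficients `G` on a domain of `ℝⁿ`. -/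
def christoffel (G : EuclideanSpace ℝ (Fin n) → Matrix (Fin n) (Fin n) ℝ) (m i j : Fin n)
    (x : EuclideanSpace ℝ (Fin n)) : ℝ :=
  2⁻¹ * ∑ k, (G x)⁻¹ k m *
    (partialDeriv i (fun y => G y j k) x + partialDeriv j (fun y => G y k i) x
      - partialDeriv k (fun y => G y i j) x)

/-- The coefficients `R_{ijk}^m` of the Riemann tensor
`R(u, v) w = ∇_u ∇_v w - ∇_v ∇_u w - ∇_{[u, v]} w`, that is, `R(∂_i, ∂_j) ∂_k = R_{ijk}^m ∂_m`. -/
def riemann (G : EuclideanSpace ℝ (Fin n) → Matrix (Fin n) (Fin n) ℝ) (i j k m : Fin n)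
    (x : EuclideanSpace ℝ (Fin n)) : ℝ :=
  partialDeriv i (christoffel G m j k) x - partialDeriv j (christoffel G m i k) x
    + ∑ h, (christoffel G m i h x * christoffel G h j k x
      - christoffel G m j h x * christoffel G h i k x)

/-- The scalar curvature, in coordinates: the contraction `g^{jk} R_{ijk}^i` of the Riemann
tensor, which is `∑ R(e_i, e_j, e_j, e_i)` over an orthonormal basis. -/
def coordScalarCurvature (G : EuclideanSpace ℝ (Fin n) → Matrix (Fin n) (Fin n) ℝ)
    (x : EuclideanSpace ℝ (Fin n)) : ℝ :=
  ∑ i, ∑ j, ∑ k, (G x)⁻¹ j k * riemann G i j k i x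

variable {M : Type*} [TopologicalSpace M] [ChartedSpace (EuclideanSpace ℝ (Fin n)) M]

/-- The Gram matrix, at the point with coordinates `x`, of a family `g` of bilinear forms on the
tangent spaces of `M`, with respect to the coordinate vectors of a parametrization `F`. -/
def gramMatrix (g : ∀ p : M, TangentSpace (𝓡 n) p → TangentSpace (𝓡 n) p → ℝ)
    (F : EuclideanSpace ℝ (Fin n) → M) (x : EuclideanSpace ℝ (Fin n)) :
    Matrix (Fin n) (Fin n) ℝ :=
  Matrix.of fun i j =>
    g (F x) (mfderiv (𝓡 n) (𝓡 n) F x (EuclideanSpace.single i (1 : ℝ)))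
      (mfderiv (𝓡 n) (𝓡 n) F x (EuclideanSpace.single j (1 : ℝ)))

/-- The scalar curvature at `p` of a smooth Riemannian metric `g` on `M`. It is computed in the
chart of `M` at `p`; its value does not depend on the chart. -/
def scalarCurvature (g : ∀ p : M, TangentSpace (𝓡 n) p → TangentSpace (𝓡 n) p → ℝ) (p : M) : ℝ :=
  coordScalarCurvature (gramMatrix g (chartAt (EuclideanSpace ℝ (Fin n)) p).symm)
    (chartAt (EuclideanSpace ℝ (Fin n)) p p)

end Curvature

/-- The real numbers `a` (with multiplicities) are the eigenvalues of the bilinear form `h` with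
respect to the scalar product `g` on the three-dimensional space `V`: there are `g`-orthonormal
bases, and `a` are the eigenvalues of the matrix of `h` in each of them. -/
def HasRelativeEigenvalues {V : Type*} (h g : V → V → ℝ) (a : Multiset ℝ) : Prop :=
  (∃ b : Fin 3 → V, ∀ i j, g (b i) (b j) = if i = j then 1 else 0) ∧
    ∀ b : Fin 3 → V, (∀ i j, g (b i) (b j) = if i = j then 1 else 0) →
      (Matrix.of fun i j => h (b i) (b j)).charpoly.roots = a

/-- The matrix `Σ_{(ξ,s)}(θ)`, as a function of the Euler angles `x = (φ, θ, ψ)`. -/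
def sigmaMatrix (ξ s : ℝ) (x : R3) : Matrix (Fin 3) (Fin 3) ℝ :=
  !![ξ ^ 2 * Real.sin (x 1) ^ 2 + s ^ 2 * Real.cos (x 1) ^ 2, 0, s ^ 2 * Real.cos (x 1);
     0, ξ ^ 2, 0;
     s ^ 2 * Real.cos (x 1), 0, s ^ 2]

end SpinField

end

/-!
The space of the representation of `SO(3)` of dimension `2l + 1` is realized on the binary forms of
degree `2l`, with an orthonormal basis of weight vectors `e_m`. Write `π_l(p)` for the action of a
rotation (`rep`) and `π_l(u)` for that of an infinitesimal rotation `u ∈ ℝ³` (`repLie`). The `l`-th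
term of the spin field is `ζ_l (π_l(p) e_s)`, where `ζ_l b = c_l ∑_m γ^l_{m,s} b_m` is a random
functional with independent Gaussian coordinates, and the field is the real part of the sum of these
terms. The differential of each term in the direction of the left-invariant vector field `u` is
`ζ_l (π_l(p) π_l(u) e_s)`. Hence the values of the field and of its differential are centred
Gaussian, with variances `∑ c_l² ‖b_l‖² / 2` for the vectors `b_l` in question
(`hasLaw_of_hasSum_randomCoeff`). Since `π_l(p)` is unitary, these do not depend on `p`: the
variance of the field is `∑ c_l² / 2 = 1`, and that of the differential follows from
`‖π_l(u) e_s‖² = (u₀² + u₁²) (l(l+1) - s²) / 2 + u₂² s²` (`norm_repLie_weightVec_sq`). By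
polarization, the Adler-Taylor form is `diag(ξ², ξ², s²)` in the left-invariant frame
(`adlerTaylor_spinField`), while the standard metric is the identity there (`standardMetric_eq`).
The Gram matrices in Euler angles, the relative eigenvalues and the smoothness are read off from
this. The scalar curvature of a left-invariant metric `diag(a, a, b)` is computed from the
second-order jet of its Gram matrix in Cayley coordinates (`coordScalarCurvature_coordGram`).

The analytic point is the decay of the coefficients `c_l`. By unitarity, the derivative of order
`2n` of `d^l_{s,s}` at `0` is `(-1)^n ‖T^n e_s‖²`, where `T` generates the rotations about the
second axis. These numbers have the same sign for all `l`, so that the convergence of the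
derivatives of `k` at `0` gives `∑ c_l² ‖T^n e_s‖² < ∞`; for `n = 1` this sum is `-k''(0) = 2ξ²`.
The moments `‖T^n e_s‖²` are log-convex in `n`, so they are at least `‖T e_s‖^(2n) ≥ (l/2)^n`
(`norm_genY_pow_ge`), and `c_l` decays faster than any power of `l` (`SmoothlyConvergent.summable`).
A first-moment estimate carries the decay over to `‖ζ_l‖`, almost surely
(`ae_summable_randomCoeff`). As the derivatives of `p ↦ π_l(p) b` grow at most polynomially in `l`
(`exists_bound_iteratedFDeriv_rep`), the series of the field is almost surely smooth and can be
differentiated termwise (`hasSum_tangentDiff_coeff`).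
-/

noncomputable section

namespace SpinField

/-! ### The action of `SL(2)` on binary forms -/

open Polynomial in
/-- The image of the monomial `X ^ k Y ^ (n - k)` under the action of `A` on the binary forms of
degree `n`, dehomogenized by `Y = 1`. -/
def binaryForm (n : ℕ) (A : Matrix (Fin 2) (Fin 2) ℂ) (k : ℕ) : ℂ[X] :=
  (C (A 0 0) * X + C (A 1 0)) ^ k * (C (A 0 1) * X + C (A 1 1)) ^ (n - k)

open Polynomial in
/-- Homogenization turns the dehomogenized powers of linear forms back into binary forms. -/
theorem homogenize_linear_pow (a b : ℂ) (m : ℕ) :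
    ((C a * X + C b) ^ m).homogenize m =
      (MvPolynomial.C a * MvPolynomial.X 0 + MvPolynomial.C b * MvPolynomial.X 1) ^ m := by
  have h1 : (C a * X + C b).homogenize 1 =
      MvPolynomial.C a * MvPolynomial.X 0 + MvPolynomial.C b * MvPolynomial.X 1 := by
    rw [homogenize_add, homogenize_C_mul, homogenize_X one_ne_zero, homogenize_C]
    simp
  have h := homogenize_finsetProd (s := Finset.range m) (p := fun _ => C a * X + C b)
    (n := fun _ => 1) fun _ _ => natDegree_linear_le
  simpa [h1] using h

open Polynomial in
/-- The action on binary forms is multiplicative: substituting the linear forms given by `A` into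
the image of a monomial under `B` gives its image under `A * B`. -/
theorem sum_coeff_binaryForm (n : ℕ) (A B : Matrix (Fin 2) (Fin 2) ℂ) {k : ℕ} (hk : k ≤ n) :
    ∑ j ∈ Finset.range (n + 1), C ((binaryForm n B k).coeff j) * binaryForm n A j =
      binaryForm n (A * B) k := by
  have h1 : (binaryForm n B k).homogenize n =
      (MvPolynomial.C (B 0 0) * MvPolynomial.X 0 + MvPolynomial.C (B 1 0) * MvPolynomial.X 1) ^ k *
      (MvPolynomial.C (B 0 1) * MvPolynomial.X 0 +
        MvPolynomial.C (B 1 1) * MvPolynomial.X 1) ^ (n - k) := by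
    have h := homogenize_mul ((C (B 0 0) * X + C (B 1 0)) ^ k)
      ((C (B 0 1) * X + C (B 1 1)) ^ (n - k)) (m := k) (n := n - k)
      (by simpa using natDegree_pow_le_of_le k (natDegree_linear_le (a := B 0 0) (b := B 1 0)))
      (by
        simpa using natDegree_pow_le_of_le (n - k)
          (natDegree_linear_le (a := B 0 1) (b := B 1 1)))
    rw [Nat.add_sub_cancel' hk, homogenize_linear_pow, homogenize_linear_pow] at h
    exact h
  have h2 := congrArg (MvPolynomial.aeval
    ![C (A 0 0) * X + C (A 1 0), C (A 0 1) * X + C (A 1 1)]) h1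
  rw [homogenize, map_sum, Finset.Nat.sum_antidiagonal_eq_sum_range_succ_mk] at h2
  convert h2 using 1
  · refine Finset.sum_congr rfl fun j hj => ?_
    simp [MvPolynomial.aeval_monomial, binaryForm, Finsupp.prod_fintype, Fin.prod_univ_two,
      Finsupp.single_apply, Finsupp.update_apply]
  · simp only [map_mul, map_pow, map_add, MvPolynomial.aeval_X]
    simp only [binaryForm, Matrix.mul_apply, Fin.sum_univ_two, MvPolynomial.algHom_C,
      Polynomial.algebraMap_eq, Matrix.cons_val_zero, Matrix.cons_val_one]
    congr 2 <;> simp only [map_add, map_mul] <;> ring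

/-- The norm `√(j! (n - j)!)` of the monomial `X ^ j Y ^ (n - j)`. -/
def monomialNorm (n j : ℕ) : ℝ := Real.sqrt (j ! * (n - j)! : ℝ)

theorem monomialNorm_pos (n j : ℕ) : 0 < monomialNorm n j :=
  Real.sqrt_pos.2 (by positivity)

theorem monomialNorm_sq (n j : ℕ) : monomialNorm n j ^ 2 = j ! * (n - j)! :=
  Real.sq_sqrt (by positivity)

/-- The matrix of the action of `A` on the binary forms of degree `n`, with respect to the
orthonormal basis of normalized monomials. -/
def symPow (n : ℕ) (A : Matrix (Fin 2) (Fin 2) ℂ) : Matrix (Fin (n + 1)) (Fin (n + 1)) ℂ :=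
  Matrix.of fun j k => (monomialNorm n j / monomialNorm n k : ℝ) * (binaryForm n A k).coeff j

theorem symPow_apply (n : ℕ) (A : Matrix (Fin 2) (Fin 2) ℂ) (j k : Fin (n + 1)) :
    symPow n A j k = (monomialNorm n j / monomialNorm n k : ℝ) * (binaryForm n A k).coeff j := rfl

theorem symPow_mul (n : ℕ) (A B : Matrix (Fin 2) (Fin 2) ℂ) :
    symPow n (A * B) = symPow n A * symPow n B := by
  ext i k
  rw [Matrix.mul_apply, symPow_apply, ← sum_coeff_binaryForm n A B (Fin.is_le k),
    Polynomial.finsetSum_coeff, Finset.sum_range, Finset.mul_sum]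
  refine Finset.sum_congr rfl fun j _ => ?_
  have hj : (monomialNorm n j : ℂ) ≠ 0 := by exact_mod_cast (monomialNorm_pos n j).ne'
  rw [symPow_apply, symPow_apply, Polynomial.coeff_C_mul]
  push_cast
  field_simp

theorem symPow_one (n : ℕ) : symPow n 1 = 1 := by
  ext j k
  have hj : (monomialNorm n j : ℂ) ≠ 0 := by exact_mod_cast (monomialNorm_pos n j).ne'
  rw [symPow_apply]
  by_cases h : j = k
  · subst h
    simp [binaryForm, hj]
  · have h' : (j : ℕ) ≠ k := fun h' => h (Fin.ext h')
    simp [binaryForm, Polynomial.coeff_X_pow, h, h']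

open Polynomial in
theorem coeff_coeff_swap (p : ℂ[X][X]) (i j : ℕ) :
    ((Bivariate.swap p).coeff i).coeff j = (p.coeff j).coeff i := by
  induction p using Polynomial.induction_on' with
  | add p q hp hq => simp only [map_add, coeff_add, hp, hq]
  | monomial n f =>
    induction f using Polynomial.induction_on' with
    | add p q hp hq => simp only [map_add, coeff_add, hp, hq]
    | monomial m r =>
      rw [Bivariate.swap_monomial_monomial]
      simp only [coeff_monomial]
      split_ifs <;> simp_all [coeff_monomial]

open Polynomial in
/-- The reason why the transpose acts by the transposed matrix: the generating polynomial
`(Y (a X + c) + (b X + d)) ^ n` is symmetric under the exchange of `X` and `Y` together with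
that of `b` and `c`. -/
theorem choose_mul_coeff_binaryForm (n : ℕ) (A : Matrix (Fin 2) (Fin 2) ℂ) (j k : ℕ) :
    (n.choose k : ℂ) * (binaryForm n A k).coeff j =
      n.choose j * (binaryForm n Aᵀ j).coeff k := by
  set G : Matrix (Fin 2) (Fin 2) ℂ → ℂ[X][X] := fun A =>
    (X * C (C (A 0 0) * X + C (A 1 0)) + C (C (A 0 1) * X + C (A 1 1))) ^ n with hG
  have hc : ∀ (A : Matrix (Fin 2) (Fin 2) ℂ) (j k : ℕ), ((G A).coeff k).coeff j =
      (n.choose k : ℂ) * (binaryForm n A k).coeff j := by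
    intro A j k
    have h : G A = ∑ i ∈ Finset.range (n + 1),
        C ((n.choose i : ℂ[X]) * binaryForm n A i) * X ^ i := by
      rw [hG]
      simp only
      rw [add_pow]
      refine Finset.sum_congr rfl fun i _ => ?_
      simp only [binaryForm, map_mul, map_pow, mul_pow, map_natCast]
      ring
    rw [h, finsetSum_coeff]
    simp only [coeff_C_mul, coeff_X_pow, mul_ite, mul_one, mul_zero, Finset.sum_ite_eq,
      Finset.mem_range]
    split_ifs with hk
    · rw [← C_eq_natCast, coeff_C_mul]
    · simp [Nat.choose_eq_zero_of_lt (by omega : n < k)]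
  have hs : G Aᵀ = Bivariate.swap (G A) := by
    simp only [hG, map_pow, map_add, map_mul, Bivariate.swap_X, Bivariate.swap_Y,
      Bivariate.swap_C_C, Matrix.transpose_apply]
    have h : ∀ x y a b c d : ℂ[X][X], y * (a * x + b) + (c * x + d) =
        x * (a * y + c) + (b * y + d) := fun x y a b c d => by ring
    rw [h]
  rw [← hc, ← hc, hs, coeff_coeff_swap]

theorem symPow_transpose (n : ℕ) (A : Matrix (Fin 2) (Fin 2) ℂ) :
    symPow n Aᵀ = (symPow n A)ᵀ := by
  ext j k
  have hw : ∀ i : Fin (n + 1), (n.choose i : ℂ) * (monomialNorm n i : ℂ) ^ 2 = n ! := fun i => by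
    rw [← Complex.ofReal_pow, monomialNorm_sq]
    have := Nat.choose_mul_factorial_mul_factorial (Fin.is_le i)
    rw [← this]
    push_cast
    ring
  have h0 : ∀ i : Fin (n + 1), (n.choose i : ℂ) ≠ 0 := fun i => by
    exact_mod_cast (Nat.choose_pos (Fin.is_le i)).ne'
  have h1 : ∀ i : Fin (n + 1), (monomialNorm n i : ℂ) ≠ 0 := fun i => by
    exact_mod_cast (monomialNorm_pos n i).ne'
  have h := choose_mul_coeff_binaryForm n A k j
  rw [Matrix.transpose_apply, symPow_apply, symPow_apply]
  push_cast
  have hj := hw j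
  have hk := hw k
  have h0j := h0 j
  have h0k := h0 k
  have h1j := h1 j
  have h1k := h1 k
  rw [div_mul_eq_mul_div, div_mul_eq_mul_div, div_eq_div_iff h1k h1j]
  apply mul_left_cancel₀ (mul_ne_zero h0j h0k)
  linear_combination (-(n.choose j : ℂ) * (monomialNorm n j : ℂ) ^ 2) * h +
    (n.choose j : ℂ) * (binaryForm n A j).coeff k * hj -
    (n.choose j : ℂ) * (binaryForm n A j).coeff k * hk

theorem symPow_map_star (n : ℕ) (A : Matrix (Fin 2) (Fin 2) ℂ) :
    symPow n (A.map star) = (symPow n A).map star := by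
  ext j k
  have h : binaryForm n (A.map star) k = (binaryForm n A k).map (starRingEnd ℂ) := by
    simp [binaryForm]
  rw [Matrix.map_apply, symPow_apply, symPow_apply, h, Polynomial.coeff_map]
  simp

theorem symPow_conjTranspose (n : ℕ) (A : Matrix (Fin 2) (Fin 2) ℂ) :
    symPow n Aᴴ = (symPow n A)ᴴ := by
  rw [Matrix.conjTranspose, symPow_map_star, symPow_transpose]
  rfl

/-- In even degree `-1` acts trivially, so that the action descends from `SU(2)` to `SO(3)`. -/
theorem symPow_neg (l : ℕ) (A : Matrix (Fin 2) (Fin 2) ℂ) :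
    symPow (2 * l) (-A) = symPow (2 * l) A := by
  ext j k
  have hj : ((j : ℕ) : ℤ) ≤ 2 * l := by exact_mod_cast Fin.is_le j
  have hk := Fin.is_le k
  have h : binaryForm (2 * l) (-A) k = binaryForm (2 * l) A k := by
    have h1 : ∀ a b : ℂ, Polynomial.C (-a) * Polynomial.X + Polynomial.C (-b) =
        -(Polynomial.C a * Polynomial.X + Polynomial.C b) := fun a b => by
      simp only [map_neg]
      ring
    simp only [binaryForm, Matrix.neg_apply, h1]
    rw [neg_pow, neg_pow (Polynomial.C (A 0 1) * Polynomial.X + _)]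
    have h2 : (-1 : Polynomial ℂ) ^ (k : ℕ) * (-1) ^ (2 * l - k) = 1 := by
      rw [← pow_add, Nat.add_sub_cancel' hk, pow_mul]
      simp
    linear_combination
      ((Polynomial.C (A 0 0) * Polynomial.X + Polynomial.C (A 1 0)) ^ (k : ℕ) *
        (Polynomial.C (A 0 1) * Polynomial.X + Polynomial.C (A 1 1)) ^ (2 * l - k)) * h2
  rw [symPow_apply, symPow_apply, h]

theorem symPow_mem_unitary (n : ℕ) {A : Matrix (Fin 2) (Fin 2) ℂ}
    (hA : A ∈ Matrix.unitaryGroup (Fin 2) ℂ) :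
    symPow n A ∈ Matrix.unitaryGroup (Fin (n + 1)) ℂ := by
  rw [Matrix.mem_unitaryGroup_iff] at hA ⊢
  rw [Matrix.star_eq_conjTranspose] at hA ⊢
  rw [← symPow_conjTranspose, ← symPow_mul, hA, symPow_one]

/-! ### The infinitesimal action on binary forms -/

section CoeffCalculus

open Polynomial

variable {E : Type*} [NormedAddCommGroup E] [NormedSpace ℝ E]

theorem contDiff_coeff_mul {p q : E → ℂ[X]} (hp : ∀ i, ContDiff ℝ ∞ fun x => (p x).coeff i)
    (hq : ∀ i, ContDiff ℝ ∞ fun x => (q x).coeff i) (i : ℕ) :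
    ContDiff ℝ ∞ fun x => (p x * q x).coeff i := by
  simp only [coeff_mul]
  exact ContDiff.sum fun y _ => (hp _).mul (hq _)

theorem contDiff_coeff_pow {p : E → ℂ[X]} (hp : ∀ i, ContDiff ℝ ∞ fun x => (p x).coeff i)
    (k i : ℕ) : ContDiff ℝ ∞ fun x => (p x ^ k).coeff i := by
  induction k generalizing i with
  | zero => simpa using contDiff_const
  | succ k ih => simpa only [pow_succ] using contDiff_coeff_mul ih hp i

theorem contDiff_coeff_linear {a b : E → ℂ} (ha : ContDiff ℝ ∞ a) (hb : ContDiff ℝ ∞ b) (i : ℕ) :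
    ContDiff ℝ ∞ fun x => (C (a x) * X + C (b x)).coeff i := by
  have h : (fun x => (C (a x) * X + C (b x)).coeff i) =
      fun x => a x * (X : ℂ[X]).coeff i + b x * (1 : ℂ[X]).coeff i := by
    ext x
    rw [coeff_add, coeff_C_mul, ← mul_one (C (b x)), coeff_C_mul]
  rw [h]
  exact (ha.mul contDiff_const).add (hb.mul contDiff_const)

theorem hasDerivAt_coeff_mul {p q : ℝ → ℂ[X]} {p' q' : ℂ[X]} {t : ℝ}
    (hp : ∀ i, HasDerivAt (fun x => (p x).coeff i) (p'.coeff i) t)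
    (hq : ∀ i, HasDerivAt (fun x => (q x).coeff i) (q'.coeff i) t) (i : ℕ) :
    HasDerivAt (fun x => (p x * q x).coeff i) ((p' * q t + p t * q').coeff i) t := by
  simp only [coeff_mul, coeff_add, ← Finset.sum_add_distrib]
  exact HasDerivAt.fun_sum fun y _ => (hp _).mul (hq _)

theorem hasDerivAt_coeff_pow {p : ℝ → ℂ[X]} {p' : ℂ[X]} {t : ℝ}
    (hp : ∀ i, HasDerivAt (fun x => (p x).coeff i) (p'.coeff i) t) (k i : ℕ) :
    HasDerivAt (fun x => (p x ^ k).coeff i) ((k * p t ^ (k - 1) * p').coeff i) t := by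
  induction k generalizing i with
  | zero => simpa using hasDerivAt_const t ((1 : ℂ[X]).coeff i)
  | succ k ih =>
    simp only [pow_succ]
    convert hasDerivAt_coeff_mul ih hp i using 2
    rcases k with _ | k
    · simp
    · simp only [Nat.add_sub_cancel, pow_succ]
      push_cast
      ring

theorem hasDerivAt_coeff_linear {a b : ℝ → ℂ} {a' b' : ℂ} {t : ℝ} (ha : HasDerivAt a a' t)
    (hb : HasDerivAt b b' t) (i : ℕ) :
    HasDerivAt (fun x => (C (a x) * X + C (b x)).coeff i) ((C a' * X + C b').coeff i) t := by
  have h : ∀ a b : ℂ, (C a * X + C b).coeff i = a * (X : ℂ[X]).coeff i + b * (1 : ℂ[X]).coeff i :=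
    fun a b => by rw [coeff_add, coeff_C_mul, ← mul_one (C b), coeff_C_mul]
  simp only [h]
  exact (ha.mul_const _).add (hb.mul_const _)

end CoeffCalculus

theorem contDiff_symPow {E : Type*} [NormedAddCommGroup E] [NormedSpace ℝ E] (n : ℕ)
    {A : E → Matrix (Fin 2) (Fin 2) ℂ} (hA : ∀ i j, ContDiff ℝ ∞ fun x => A x i j)
    (j k : Fin (n + 1)) : ContDiff ℝ ∞ fun x => symPow n (A x) j k :=
  contDiff_const.mul <| contDiff_coeff_mul
    (fun i => contDiff_coeff_pow (contDiff_coeff_linear (hA 0 0) (hA 1 0)) _ i)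
    (fun i => contDiff_coeff_pow (contDiff_coeff_linear (hA 0 1) (hA 1 1)) _ i) _

/-- The entries, in the basis of monomials, of the infinitesimal action of `B` on the binary
forms of degree `n`. It is tridiagonal. -/
def lieCoeff (n : ℕ) (B : Matrix (Fin 2) (Fin 2) ℂ) (j k : ℕ) : ℂ :=
  (if j = k then k * B 0 0 + (n - k : ℕ) * B 1 1 else 0) + (if j + 1 = k then k * B 1 0 else 0) +
    if j = k + 1 then (n - k : ℕ) * B 0 1 else 0

/-- The infinitesimal action of `B` on the binary forms of degree `n`, with respect to the
orthonormal basis of normalized monomials: the differential of `symPow n` at the identity. -/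
def symPowLie (n : ℕ) (B : Matrix (Fin 2) (Fin 2) ℂ) : Matrix (Fin (n + 1)) (Fin (n + 1)) ℂ :=
  Matrix.of fun j k => (monomialNorm n j / monomialNorm n k : ℝ) * lieCoeff n B j k

open Polynomial in
theorem hasDerivAt_symPow (n : ℕ) {A : ℝ → Matrix (Fin 2) (Fin 2) ℂ}
    {B : Matrix (Fin 2) (Fin 2) ℂ} (h0 : A 0 = 1)
    (hA : ∀ i j, HasDerivAt (fun t => A t i j) (B i j) 0) (j k : Fin (n + 1)) :
    HasDerivAt (fun t => symPow n (A t) j k) (symPowLie n B j k) 0 := by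
  have h := (hasDerivAt_coeff_mul
    (fun i => hasDerivAt_coeff_pow (hasDerivAt_coeff_linear (hA 0 0) (hA 1 0)) k i)
    (fun i => hasDerivAt_coeff_pow (hasDerivAt_coeff_linear (hA 0 1) (hA 1 1)) (n - k) i)
    (j : ℕ)).const_mul ((monomialNorm n j / monomialNorm n k : ℝ) : ℂ)
  refine h.congr_deriv ?_
  simp only [symPowLie, Matrix.of_apply, h0, lieCoeff]
  congr 1
  have e : ((k : ℕ) : ℂ[X]) * X ^ ((k : ℕ) - 1) * (C (B 0 0) * X + C (B 1 0)) +
      X ^ (k : ℕ) * (((n - k : ℕ) : ℂ[X]) * (C (B 0 1) * X + C (B 1 1))) =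
      C (k * B 0 0 + (n - k : ℕ) * B 1 1) * X ^ (k : ℕ) +
        C (k * B 1 0) * X ^ ((k : ℕ) - 1) + C ((n - k : ℕ) * B 0 1) * X ^ ((k : ℕ) + 1) := by
    simp only [map_add, map_mul, map_natCast]
    obtain hk | ⟨m, hm⟩ : (k : ℕ) = 0 ∨ ∃ m, (k : ℕ) = m + 1 :=
      (Nat.eq_zero_or_pos k).imp id fun h => ⟨k - 1, by omega⟩
    · rw [hk]
      simp
      ring
    · rw [hm]
      simp only [Nat.add_sub_cancel, pow_succ]
      push_cast
      ring
  simp only [Matrix.one_apply_eq, Matrix.one_apply_ne (zero_ne_one : (0 : Fin 2) ≠ 1),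
    Matrix.one_apply_ne (one_ne_zero : (1 : Fin 2) ≠ 0), map_zero, map_one, one_mul, zero_mul,
    add_zero, zero_add, one_pow, mul_one, e]
  simp only [coeff_add, coeff_C_mul, coeff_X_pow]
  simp only [mul_ite, mul_one, mul_zero]
  congr 2
  by_cases hk : (k : ℕ) = 0
  · simp [hk]
  · simp only [(by omega : (j : ℕ) + 1 = k ↔ (j : ℕ) = k - 1)]

theorem monomialNorm_div_pred_sq {n k : ℕ} (hk : k + 1 ≤ n) :
    (monomialNorm n k / monomialNorm n (k + 1)) ^ 2 * ((k : ℝ) + 1) = ((n - k : ℕ) : ℝ) := by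
  obtain ⟨m, rfl⟩ := Nat.exists_eq_add_of_le hk
  rw [div_pow, monomialNorm_sq, monomialNorm_sq, show k + 1 + m - k = m + 1 by omega,
    show k + 1 + m - (k + 1) = m by omega, Nat.factorial_succ, Nat.factorial_succ]
  have h1 : ((k ! : ℕ) : ℝ) ≠ 0 := by positivity
  have h2 : ((m ! : ℕ) : ℝ) ≠ 0 := by positivity
  push_cast
  field_simp

theorem monomialNorm_div_succ_sq {n k : ℕ} (hk : k + 1 ≤ n) :
    (monomialNorm n (k + 1) / monomialNorm n k) ^ 2 * ((n - k : ℕ) : ℝ) = (k : ℝ) + 1 := by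
  rw [← monomialNorm_div_pred_sq hk, ← mul_assoc, ← mul_pow, div_mul_div_comm, mul_comm,
    mul_comm (monomialNorm n k), div_self, one_pow, mul_one]
  exact (mul_pos (monomialNorm_pos _ _) (monomialNorm_pos _ _)).ne'

/-- The norm of the columns of `symPowLie n B`, that is, of the image of a weight vector under the
infinitesimal action. -/
theorem sum_norm_symPowLie_sq (n : ℕ) (B : Matrix (Fin 2) (Fin 2) ℂ) (k : Fin (n + 1)) :
    ∑ j, ‖symPowLie n B j k‖ ^ 2 = ‖(k : ℕ) * B 0 0 + (n - k : ℕ) * B 1 1‖ ^ 2 +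
      (k * (n - k + 1)) * ‖B 1 0‖ ^ 2 + ((n - k) * (k + 1)) * ‖B 0 1‖ ^ 2 := by
  have hk := Fin.is_le k
  have h : ∀ j : ℕ, ‖((monomialNorm n j / monomialNorm n k : ℝ) : ℂ) * lieCoeff n B j k‖ ^ 2 =
      (if j = k then ‖(k : ℕ) * B 0 0 + (n - k : ℕ) * B 1 1‖ ^ 2 else 0) +
      (if j + 1 = k then (k * (n - k + 1)) * ‖B 1 0‖ ^ 2 else 0) +
      (if j = k + 1 then (monomialNorm n (k + 1) / monomialNorm n k) ^ 2 *
        (((n - k : ℕ) : ℝ) ^ 2 * ‖B 0 1‖ ^ 2) else 0) := by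
    intro j
    rw [norm_mul, mul_pow, Complex.norm_real, Real.norm_eq_abs, sq_abs, lieCoeff]
    rcases lt_trichotomy j k with hj | hj | hj
    · have hj1 : ¬ j = (k : ℕ) + 1 := by omega
      simp only [hj.ne, hj1, if_false, zero_add, add_zero]
      split_ifs with hj'
      · rw [← hj']
        have := monomialNorm_div_pred_sq (hj'.trans_le hk)
        rw [norm_mul, mul_pow, Complex.norm_natCast]
        rw [Nat.cast_sub (by omega)] at this
        push_cast
        linear_combination ((j : ℝ) + 1) * ‖B 1 0‖ ^ 2 * this
      · simp
    · simp [hj, (monomialNorm_pos n k).ne']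
    · have hj1 : ¬ j + 1 = (k : ℕ) := by omega
      simp only [hj.ne', hj1, if_false, zero_add]
      split_ifs with hj'
      · rw [hj', norm_mul, mul_pow, Complex.norm_natCast]
      · simp
  simp only [symPowLie, Matrix.of_apply]
  rw [← Finset.sum_range fun j =>
    ‖((monomialNorm n j / monomialNorm n k : ℝ) : ℂ) * lieCoeff n B j k‖ ^ 2]
  simp only [h, Finset.sum_add_distrib, Finset.sum_ite_eq', Finset.mem_range]
  rw [if_pos (by omega)]
  congr 1
  · congr 1
    obtain hk0 | ⟨m, hm⟩ : (k : ℕ) = 0 ∨ ∃ m, (k : ℕ) = m + 1 :=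
      (Nat.eq_zero_or_pos k).imp id fun h => ⟨k - 1, by omega⟩
    · simp [hk0]
    · simp only [hm, Nat.add_right_cancel_iff, Finset.sum_ite_eq', Finset.mem_range]
      rw [if_pos (by omega)]
  · split_ifs with hn
    · have := monomialNorm_div_succ_sq (by omega : (k : ℕ) + 1 ≤ n)
      rw [Nat.cast_sub (by omega)] at this ⊢
      linear_combination ((n : ℝ) - k) * ‖B 0 1‖ ^ 2 * this
    · have hn' : (n : ℝ) = k := by exact_mod_cast (by omega : n = k)
      simp [hn']

/-! ### The irreducible representations of the rotation group -/

/-- The kernel of the double covering `SU(2) → SO(3)` is `{1, -1}`. -/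
theorem IsSpinLift.eq_or_eq_neg {A B : Matrix (Fin 2) (Fin 2) ℂ} {p : SO3}
    (hA : IsSpinLift A p) (hB : IsSpinLift B p) : B = A ∨ B = -A := by
  obtain ⟨hAu, hAd⟩ := Matrix.mem_specialUnitaryGroup_iff.1 hA.1
  obtain ⟨hBu, hBd⟩ := Matrix.mem_specialUnitaryGroup_iff.1 hB.1
  have hA1 : Aᴴ * A = 1 := Matrix.mem_unitaryGroup_iff'.1 hAu
  have hA2 : A * Aᴴ = 1 := Matrix.mem_unitaryGroup_iff.1 hAu
  have hB1 : Bᴴ * B = 1 := Matrix.mem_unitaryGroup_iff'.1 hBu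
  -- `AᴴB` commutes with the Pauli matrices, hence it is a scalar matrix.
  have hcomm : ∀ j, Aᴴ * B * pauli j = pauli j * (Aᴴ * B) := fun j => by
    have h : A * pauli j * Aᴴ = B * pauli j * Bᴴ := by rw [hA.2, hB.2]
    calc Aᴴ * B * pauli j = Aᴴ * (B * pauli j * Bᴴ) * B := by
          simp only [Matrix.mul_assoc, hB1, Matrix.mul_one]
      _ = (Aᴴ * A) * pauli j * (Aᴴ * B) := by rw [← h]; simp only [Matrix.mul_assoc]
      _ = pauli j * (Aᴴ * B) := by rw [hA1, Matrix.one_mul]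
  have hdet : (Aᴴ * B).det = 1 := by
    rw [Matrix.det_mul, Matrix.det_conjTranspose, hAd, hBd]
    simp
  have hB : B = A * (Aᴴ * B) := by rw [← Matrix.mul_assoc, hA2, Matrix.one_mul]
  generalize Aᴴ * B = C at hcomm hdet hB
  have hz01 := congrFun (congrFun (hcomm 2) 0) 1
  have hz10 := congrFun (congrFun (hcomm 2) 1) 0
  have hx01 := congrFun (congrFun (hcomm 0) 0) 1
  simp [pauli, Matrix.mul_apply, Fin.sum_univ_two] at hz01 hz10 hx01
  have h01 : C 0 1 = 0 := by linear_combination -hz01 / 2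
  have h10 : C 1 0 = 0 := by linear_combination hz10 / 2
  rw [Matrix.det_fin_two, h01, h10, ← hx01] at hdet
  have hsq : (C 0 0 - 1) * (C 0 0 + 1) = 0 := by linear_combination hdet
  rcases mul_eq_zero.1 hsq with h | h
  · left
    have hC : C = 1 := by
      ext i j
      fin_cases i <;> fin_cases j <;> simp [h01, h10, ← hx01, sub_eq_zero.1 h]
    rw [hB, hC, Matrix.mul_one]
  · right
    have hC : C = -1 := by
      ext i j
      fin_cases i <;> fin_cases j <;> simp [h01, h10, ← hx01, eq_neg_of_add_eq_zero_left h]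
    rw [hB, hC, Matrix.mul_neg, Matrix.mul_one]

/-- The space of the irreducible representation of `SO(3)` of dimension `2l + 1`. -/
abbrev RepSpace (l : ℕ) : Type := EuclideanSpace ℂ (Fin (2 * l + 1))

/-- The irreducible unitary representation of `SO(3)` of dimension `2l + 1`. -/
def rep (l : ℕ) (p : SO3) : RepSpace l →L[ℂ] RepSpace l :=
  Matrix.toEuclideanCLM (𝕜 := ℂ) (symPow (2 * l) (spinLift p))

theorem isSpinLift_spinLift (p : SO3) : IsSpinLift (spinLift p) p :=
  (exists_isSpinLift p).choose_spec

theorem symPow_spinLift (l : ℕ) {A : Matrix (Fin 2) (Fin 2) ℂ} {p : SO3} (hA : IsSpinLift A p) :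
    symPow (2 * l) (spinLift p) = symPow (2 * l) A := by
  rcases hA.eq_or_eq_neg (isSpinLift_spinLift p) with h | h
  · rw [h]
  · rw [h, symPow_neg]

theorem rep_mul (l : ℕ) (p q : SO3) : rep l (p * q) = rep l p * rep l q := by
  rw [rep, symPow_spinLift l ((isSpinLift_spinLift p).mul (isSpinLift_spinLift q)), symPow_mul,
    map_mul, rep, rep]

theorem norm_rep_apply (l : ℕ) (p : SO3) (b : RepSpace l) : ‖rep l p b‖ = ‖b‖ := by
  have h := Matrix.mem_unitaryGroup_iff'.1 (symPow_mem_unitary (2 * l)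
    (Matrix.mem_specialUnitaryGroup_iff.1 (isSpinLift_spinLift p).1).1)
  have h2 := congrArg (Matrix.toEuclideanCLM (𝕜 := ℂ)) h
  rw [map_mul, map_one, map_star] at h2
  exact ContinuousLinearMap.norm_map_of_mem_unitary
    (u := rep l p) (Unitary.mem_iff.2 ⟨h2, by
      have h := Matrix.mem_unitaryGroup_iff.1 (symPow_mem_unitary (2 * l)
        (Matrix.mem_specialUnitaryGroup_iff.1 (isSpinLift_spinLift p).1).1)
      have h2 := congrArg (Matrix.toEuclideanCLM (𝕜 := ℂ)) h
      rwa [map_mul, map_one, map_star] at h2⟩) b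

theorem rep_apply_apply (l : ℕ) (p : SO3) (b : RepSpace l) (j : Fin (2 * l + 1)) :
    rep l p b j = ∑ k, symPow (2 * l) (spinLift p) j k * b k := rfl

/-- The position of the weight `m`, where `|m| ≤ l`, in the basis of `RepSpace l`. -/
def weightIndex (l : ℕ) (m : ℤ) : Fin (2 * l + 1) := Fin.ofNat _ (l + m).toNat

theorem weightIndex_val {l : ℕ} {m : ℤ} (hm : |m| ≤ l) :
    ((weightIndex l m : ℕ) : ℤ) = l + m := by
  have := abs_le.1 hm
  rw [weightIndex, Fin.val_ofNat, Nat.mod_eq_of_lt (by omega)]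
  omega

/-- The unit vector of weight `s`. -/
def weightVec (l : ℕ) (s : ℤ) : RepSpace l := EuclideanSpace.single (weightIndex l s) 1

theorem norm_weightVec (l : ℕ) (s : ℤ) : ‖weightVec l s‖ = 1 := by simp [weightVec]

/-- The Wigner functions are the matrix coefficients of `rep` in the basis of weight vectors. -/
theorem wignerD_eq {l : ℕ} {m s : ℤ} (hm : |m| ≤ l) (hs : |s| ≤ l) (p : SO3) :
    wignerD l m s p = rep l p (weightVec l s) (weightIndex l m) := by
  have hm' := weightIndex_val hm
  have hs' := weightIndex_val hs
  rw [rep_apply_apply, Finset.sum_eq_single (weightIndex l s)]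
  · have e1 : (l + m).toNat = weightIndex l m := by omega
    have e2 : (l - m).toNat = 2 * l - weightIndex l m := by omega
    have e3 : (l + s).toNat = weightIndex l s := by omega
    have e4 : (l - s).toNat = 2 * l - weightIndex l s := by omega
    rw [wignerD, wignerSU2, e1, e2, e3, e4, symPow_apply, monomialNorm, monomialNorm,
      ← Real.sqrt_div (by positivity)]
    simp [weightVec, binaryForm]
  · intro k _ hk
    simp [weightVec, hk]
  · simp

theorem sum_weights (l : ℕ) {M : Type*} [AddCommMonoid M] (f : Fin (2 * l + 1) → M) :
    ∑ m ∈ Finset.Icc (-(l : ℤ)) l, f (weightIndex l m) = ∑ j, f j := by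
  refine Finset.sum_bij' (fun m _ => weightIndex l m) (fun j _ => (j : ℤ) - l) ?_ ?_ ?_ ?_ ?_
  · simp
  · intro j _
    have := j.2
    simp only [Finset.mem_Icc]
    omega
  · intro m hm
    have := weightIndex_val (abs_le.2 (Finset.mem_Icc.1 hm))
    omega
  · intro j _
    have hj := j.2
    have := weightIndex_val (l := l) (m := (j : ℤ) - l) (abs_le.2 (by omega))
    ext
    omega
  · simp

/-- The element of the Lie algebra `𝔰𝔲(2)` that corresponds to the vector `u`. -/
def spinLie (u : R3) : Matrix (Fin 2) (Fin 2) ℂ :=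
  (2⁻¹ : ℂ) • !![-Complex.I * u 2, -Complex.I * u 0 - u 1; -Complex.I * u 0 + u 1, Complex.I * u 2]

/-- The infinitesimal action of the vector `u`, seen as an infinitesimal rotation, on the
irreducible representation of dimension `2l + 1`. -/
def repLie (l : ℕ) (u : R3) : RepSpace l →L[ℂ] RepSpace l :=
  Matrix.toEuclideanCLM (𝕜 := ℂ) (symPowLie (2 * l) (spinLie u))

theorem repLie_apply_apply (l : ℕ) (u : R3) (b : RepSpace l) (j : Fin (2 * l + 1)) :
    repLie l u b j = ∑ k, symPowLie (2 * l) (spinLie u) j k * b k := rfl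

theorem norm_repLie_single_sq (l : ℕ) (u : R3) (k : Fin (2 * l + 1)) :
    ‖repLie l u (EuclideanSpace.single k 1)‖ ^ 2 =
      (u 0 ^ 2 + u 1 ^ 2) * (((l : ℝ) * (l + 1) - ((k : ℝ) - l) ^ 2) / 2) +
        u 2 ^ 2 * ((k : ℝ) - l) ^ 2 := by
  have hk : ((2 * l - k : ℕ) : ℝ) = 2 * l - k := by
    rw [Nat.cast_sub (Fin.is_le k)]
    push_cast
    ring
  have hkc : ((2 * l - k : ℕ) : ℂ) = 2 * l - k := by exact_mod_cast congrArg Complex.ofReal hk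
  have h : ∀ j, repLie l u (EuclideanSpace.single k 1) j = symPowLie (2 * l) (spinLie u) j k := by
    intro j
    rw [repLie_apply_apply, Finset.sum_eq_single k]
    · simp
    · intro i _ hi
      simp [hi]
    · simp
  rw [EuclideanSpace.norm_sq_eq]
  simp only [h]
  rw [sum_norm_symPowLie_sq, hkc]
  have e1 : (k : ℕ) * spinLie u 0 0 + (2 * l - k) * spinLie u 1 1 =
      Complex.I * ((u 2 * (l - k) : ℝ) : ℂ) := by
    simp [spinLie]
    ring
  have e2 : spinLie u 1 0 = (((u 1 / 2 : ℝ) : ℂ) + ((-u 0 / 2 : ℝ) : ℂ) * Complex.I) := by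
    simp [spinLie]
    ring
  have e3 : spinLie u 0 1 = (((-u 1 / 2 : ℝ) : ℂ) + ((-u 0 / 2 : ℝ) : ℂ) * Complex.I) := by
    simp [spinLie]
    ring
  rw [e1, e2, e3, norm_mul, Complex.norm_I, one_mul, Complex.norm_real, Real.norm_eq_abs, sq_abs,
    ← Complex.normSq_eq_norm_sq, ← Complex.normSq_eq_norm_sq, Complex.normSq_add_mul_I,
    Complex.normSq_add_mul_I]
  push_cast
  ring

/-- The identity behind the entries `ξ²`, `ξ²`, `s²` of the Adler-Taylor metric: the third axis
multiplies the weight vector by a number of modulus `|s|`, the other two move it to the neighbouring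
weights. -/
theorem norm_repLie_weightVec_sq {l : ℕ} {s : ℤ} (hs : |s| ≤ l) (u : R3) :
    ‖repLie l u (weightVec l s)‖ ^ 2 =
      (u 0 ^ 2 + u 1 ^ 2) * (((l : ℝ) * (l + 1) - (s : ℝ) ^ 2) / 2) + u 2 ^ 2 * (s : ℝ) ^ 2 := by
  have h : ((weightIndex l s : ℕ) : ℝ) = l + s := by exact_mod_cast weightIndex_val hs
  rw [weightVec, norm_repLie_single_sq, h, add_sub_cancel_left]

/-- The infinitesimal action grows at most polynomially with the dimension. -/
theorem norm_repLie_apply_le (l : ℕ) (u : R3) (b : RepSpace l) :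
    ‖repLie l u b‖ ≤ (2 * l + 1 : ℝ) ^ 2 * ‖u‖ * ‖b‖ := by
  have hb : b = ∑ k, b k • EuclideanSpace.single k (1 : ℂ) := by
    ext j
    simp [Finset.sum_apply, Pi.single_apply]
  have hcol : ∀ k, ‖repLie l u (EuclideanSpace.single k 1)‖ ≤ (2 * l + 1 : ℝ) * ‖u‖ := by
    intro k
    rw [← sq_le_sq₀ (norm_nonneg _) (by positivity), norm_repLie_single_sq, mul_pow,
      EuclideanSpace.norm_sq_eq, Fin.sum_univ_three]
    simp only [Real.norm_eq_abs, sq_abs]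
    have hk : (k : ℝ) ≤ 2 * l := by exact_mod_cast Fin.is_le k
    have hk0 : (0 : ℝ) ≤ k := by positivity
    have hl0 : (0 : ℝ) ≤ l := by positivity
    have h1 : ((k : ℝ) - l) ^ 2 ≤ (2 * l + 1) ^ 2 := by
      apply sq_le_sq'
      · linarith
      · linarith
    have h2 : ((l : ℝ) * (l + 1) - ((k : ℝ) - l) ^ 2) / 2 ≤ (2 * l + 1) ^ 2 := by
      nlinarith [sq_nonneg ((k : ℝ) - l)]
    nlinarith [mul_le_mul_of_nonneg_left h1 (sq_nonneg (u 2)),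
      mul_le_mul_of_nonneg_left h2 (add_nonneg (sq_nonneg (u 0)) (sq_nonneg (u 1)))]
  calc ‖repLie l u b‖ = ‖∑ k, b k • repLie l u (EuclideanSpace.single k (1 : ℂ))‖ := by
        conv_lhs => rw [hb, map_sum]
        simp only [map_smul]
    _ ≤ ∑ k : Fin (2 * l + 1), ‖b‖ * ((2 * l + 1 : ℝ) * ‖u‖) := by
        refine (norm_sum_le _ _).trans (Finset.sum_le_sum fun k _ => ?_)
        rw [norm_smul]
        exact mul_le_mul (PiLp.norm_apply_le b k) (hcol k) (norm_nonneg _) (norm_nonneg _)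
    _ = (2 * l + 1 : ℝ) ^ 2 * ‖u‖ * ‖b‖ := by
        rw [Finset.sum_const, Finset.card_univ, Fintype.card_fin, nsmul_eq_mul]
        push_cast
        ring

/-! ### Calculus on the rotation group in Cayley coordinates -/

/-- The rotation with Cayley coordinates `v`. -/
def cayley (v : R3) : SO3 := ⟨cayleyMatrix v, cayleyMatrix_mem v⟩

theorem cayleyChart_symm_apply (p : SO3) (v : R3) : (cayleyChart p).symm v = p * cayley v := rfl

theorem cayleyChart_mul_cayley (p : SO3) (v : R3) : cayleyChart p (p * cayley v) = v :=
  (cayleyChart p).right_inv (Set.mem_univ v)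

theorem cayley_zero : cayley 0 = 1 := by
  apply Subtype.ext
  ext i j
  fin_cases i <;> fin_cases j <;> simp [cayley, cayleyMatrix]

theorem cayleyChart_self (p : SO3) : cayleyChart p p = 0 := by
  have h := cayleyChart_mul_cayley p 0
  rwa [cayley_zero, mul_one] at h

/-- The cross product of `ℝ³`. -/
def cross (x y : R3) : R3 :=
  !₂[x 1 * y 2 - x 2 * y 1, x 2 * y 0 - x 0 * y 2, x 0 * y 1 - x 1 * y 0]

/-- The composition law of rotations in Cayley coordinates. -/
theorem cayleyChart_mul_cayley_mul_cayley (p : SO3) (x v : R3) :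
    cayleyChart (p * cayley x) (p * cayley v) =
      (4 / (4 + (x 0 * v 0 + x 1 * v 1 + x 2 * v 2))) • (v - x - (2⁻¹ : ℝ) • cross x v) := by
  have h1 : cayleyChart (p * cayley x) (p * cayley v) =
      cayleyInv ((cayleyMatrix x)ᵀ * cayleyMatrix v) := by
    change cayleyInv ((p.1 * cayleyMatrix x)ᵀ * (p.1 * cayleyMatrix v)) = _
    rw [Matrix.transpose_mul, Matrix.mul_assoc, ← Matrix.mul_assoc p.1ᵀ, p.transpose_mul_self,
      Matrix.one_mul]
  rw [h1]
  have hx := (cayley_denom_pos x).ne'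
  have hv := (cayley_denom_pos v).ne'
  have ht : 1 + ((cayleyMatrix x)ᵀ * cayleyMatrix v).trace =
      4 * (4 + (x 0 * v 0 + x 1 * v 1 + x 2 * v 2)) ^ 2 /
        ((4 + x 0 ^ 2 + x 1 ^ 2 + x 2 ^ 2) * (4 + v 0 ^ 2 + v 1 ^ 2 + v 2 ^ 2)) := by
    simp [cayleyMatrix, Matrix.trace, Fin.sum_univ_three, Matrix.mul_apply]
    field_simp
    ring
  by_cases hd : 4 + (x 0 * v 0 + x 1 * v 1 + x 2 * v 2) = 0
  · ext i
    fin_cases i <;> simp only [cayleyInv, ht, hd] <;> simp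
  · ext i
    fin_cases i <;> simp only [cayleyInv, ht] <;>
      simp [cayleyMatrix, Matrix.mul_apply, Fin.sum_univ_three, cross] <;> field_simp <;> ring

/-- The left Maurer-Cartan form of `SO(3)` in Cayley coordinates: the derivative in the direction
`u`, at the point with coordinates `x`, is the left-invariant vector field `maurerCartan x u`. -/
def maurerCartan (x : R3) : R3 →L[ℝ] R3 :=
  LinearMap.toContinuousLinearMap
    { toFun := fun u => (4 / (4 + x 0 ^ 2 + x 1 ^ 2 + x 2 ^ 2)) • (u - (2⁻¹ : ℝ) • cross x u)
      map_add' := fun u v => by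
        ext i
        fin_cases i <;> simp [cross] <;> ring
      map_smul' := fun a u => by
        ext i
        fin_cases i <;> simp [cross] <;> ring }

theorem maurerCartan_apply (x u : R3) : maurerCartan x u =
    (4 / (4 + x 0 ^ 2 + x 1 ^ 2 + x 2 ^ 2)) • (u - (2⁻¹ : ℝ) • cross x u) := rfl

theorem maurerCartan_zero : maurerCartan 0 = ContinuousLinearMap.id ℝ R3 := by
  ext u i
  fin_cases i <;> simp [maurerCartan_apply, cross]

theorem contDiff_maurerCartan_apply (u : R3) : ContDiff ℝ ∞ fun x => maurerCartan x u := by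
  have h1 : ContDiff ℝ ∞ fun x : R3 => 4 / (4 + x 0 ^ 2 + x 1 ^ 2 + x 2 ^ 2) :=
    ContDiff.div contDiff_const (by fun_prop) fun v => (cayley_denom_pos v).ne'
  simp only [maurerCartan_apply]
  refine h1.smul (contDiff_const.sub (ContDiff.const_smul _ ?_))
  rw [contDiff_euclidean]
  intro i
  fin_cases i <;> simp [cross] <;> fun_prop

theorem contDiff_maurerCartan : ContDiff ℝ ∞ maurerCartan := by
  rw [contDiff_clm_apply_iff]
  exact contDiff_maurerCartan_apply

/-- The derivative, at the centre of the target chart, of the change of charts from the chart at `p`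
to the chart at `p * cayley x`. -/
theorem hasFDerivAt_chart_change (p : SO3) (x : R3) :
    HasFDerivAt (fun v => cayleyChart (p * cayley x) (p * cayley v)) (maurerCartan x) x := by
  simp only [cayleyChart_mul_cayley_mul_cayley]
  have h1 : DifferentiableAt ℝ
      (fun v : R3 => 4 / (4 + (x 0 * v 0 + x 1 * v 1 + x 2 * v 2))) x := by
    have h : 4 + (x 0 * x 0 + x 1 * x 1 + x 2 * x 2) ≠ 0 := by
      have := (cayley_denom_pos x).ne'
      simpa only [sq, add_assoc] using this
    have hd : DifferentiableAt ℝ (fun v : R3 => 4 + (x 0 * v 0 + x 1 * v 1 + x 2 * v 2)) x := by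
      fun_prop
    simp only [div_eq_mul_inv]
    exact (hd.fun_inv h).const_mul 4
  let L : R3 →ₗ[ℝ] R3 :=
    { toFun := fun u => u - (2⁻¹ : ℝ) • cross x u
      map_add' := fun u v => by
        ext i
        fin_cases i <;> simp [cross] <;> ring
      map_smul' := fun a u => by
        ext i
        fin_cases i <;> simp [cross] <;> ring }
  have h2 : HasFDerivAt (fun v : R3 => v - x - (2⁻¹ : ℝ) • cross x v)
      L.toContinuousLinearMap x := by
    have h := L.toContinuousLinearMap.hasFDerivAt (x := x) |>.sub_const x
    refine h.congr_of_eventuallyEq (Filter.Eventually.of_forall fun v => ?_)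
    simp only [LinearMap.coe_toContinuousLinearMap', L, LinearMap.coe_mk, AddHom.coe_mk]
    abel
  have h3 : x - x - (2⁻¹ : ℝ) • cross x x = 0 := by
    ext i
    fin_cases i <;> simp [cross] <;> ring
  refine (h1.hasFDerivAt.smul h2).congr_fderiv ?_
  ext1 u
  simp only [h3, _root_.add_apply, _root_.smul_apply,
    ContinuousLinearMap.smulRight_apply, smul_zero, add_zero, maurerCartan_apply]
  simp only [LinearMap.coe_toContinuousLinearMap', L, LinearMap.coe_mk, AddHom.coe_mk]
  congr 2
  ring

theorem continuous_mul_cayley (p : SO3) : Continuous fun v => p * cayley v :=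
  continuous_const.mul (continuous_cayleyMatrix.subtype_mk _)

/-- Every chart expression near a point can be recentred at this point. -/
theorem eventually_mul_cayley_eq (p : SO3) (x : R3) :
    ∀ᶠ v in 𝓝 x, p * cayley v =
      p * cayley x * cayley (cayleyChart (p * cayley x) (p * cayley v)) := by
  filter_upwards [(continuous_mul_cayley p).continuousAt.preimage_mem_nhds
    ((cayleyChart (p * cayley x)).open_source.mem_nhds (mem_cayleyChart_source _))] with v hv
  exact ((cayleyChart (p * cayley x)).left_inv hv).symm

/-- The derivative in the chart at `p` of a function on `SO(3)`, in terms of its derivative along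
the left-invariant frame. -/
theorem hasFDerivAt_comp_mul_cayley {F : Type*} [NormedAddCommGroup F] [NormedSpace ℝ F]
    {h : SO3 → F} {p : SO3} {x : R3} {L : R3 →L[ℝ] F}
    (hh : HasFDerivAt (fun v => h (p * cayley x * cayley v)) L 0) :
    HasFDerivAt (fun v => h (p * cayley v)) (L ∘L maurerCartan x) x := by
  have h0 : cayleyChart (p * cayley x) (p * cayley x) = 0 := cayleyChart_self _
  have h1 := HasFDerivAt.comp (g := fun v => h (p * cayley x * cayley v)) x
    (h0.symm ▸ hh) (hasFDerivAt_chart_change p x)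
  refine h1.congr_of_eventuallyEq ?_
  filter_upwards [eventually_mul_cayley_eq p x] with v hv
  rw [Function.comp_apply, ← hv]

theorem mfderiv_eq_fderiv {F : Type*} [NormedAddCommGroup F] [NormedSpace ℝ F] {h : SO3 → F}
    {p : SO3} (hh : MDifferentiableAt (𝓡 3) 𝓘(ℝ, F) h p) (u : R3) :
    mfderiv (𝓡 3) 𝓘(ℝ, F) h p u = fderiv ℝ (fun v => h (p * cayley v)) 0 u := by
  rw [hh.mfderiv]
  have h0 : extChartAt (𝓡 3) p p = (0 : R3) := cayleyChart_self p
  rw [h0]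
  simp only [modelWithCornersSelf_coe, Set.range_id, fderivWithin_univ]
  rfl

theorem mdifferentiableAt_of_differentiableAt {F : Type*} [NormedAddCommGroup F] [NormedSpace ℝ F]
    {h : SO3 → F} {p : SO3} (hh : DifferentiableAt ℝ (fun v => h (p * cayley v)) 0) :
    MDifferentiableAt (𝓡 3) 𝓘(ℝ, F) h p := by
  have h0 : cayleyChart p p = 0 := cayleyChart_self p
  rw [mdifferentiableAt_iff]
  constructor
  · have h1 : ContinuousAt (fun q => h (p * cayley (cayleyChart p q))) p :=
      ContinuousAt.comp (g := fun v => h (p * cayley v)) (h0.symm ▸ hh.continuousAt)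
        ((cayleyChart p).continuousAt (mem_cayleyChart_source p))
    refine h1.congr ?_
    filter_upwards [(cayleyChart p).open_source.mem_nhds (mem_cayleyChart_source p)] with q hq
    have := (cayleyChart p).left_inv hq
    rw [cayleyChart_symm_apply] at this
    rw [this]
  · have h0 : extChartAt (𝓡 3) p p = (0 : R3) := cayleyChart_self p
    rw [h0]
    simp only [modelWithCornersSelf_coe, Set.range_id, differentiableWithinAt_univ]
    exact hh

theorem contMDiffAt_of_contDiffAt {F : Type*} [NormedAddCommGroup F] [NormedSpace ℝ F]
    {h : SO3 → F} {p : SO3} (hh : ContDiffAt ℝ ∞ (fun v => h (p * cayley v)) 0) :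
    ContMDiffAt (𝓡 3) 𝓘(ℝ, F) ∞ h p := by
  have hd := mdifferentiableAt_of_differentiableAt (hh.differentiableAt (by simp))
  rw [contMDiffAt_iff]
  refine ⟨hd.continuousAt, ?_⟩
  have h0 : extChartAt (𝓡 3) p p = (0 : R3) := cayleyChart_self p
  rw [h0]
  simp only [modelWithCornersSelf_coe, Set.range_id, contDiffWithinAt_univ]
  exact hh

theorem tangentDiff_eq {h : SO3 → ℝ} {p : SO3} {L : R3 →L[ℝ] ℝ}
    (hh : HasFDerivAt (fun v => h (p * cayley v)) L 0) (u : R3) : tangentDiff h p u = L u := by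
  have h := mfderiv_eq_fderiv (mdifferentiableAt_of_differentiableAt hh.differentiableAt) u
  rw [hh.fderiv] at h
  exact h

/-- The lift of `cayley v` to `SU(2)`. -/
def spinCayley (v : R3) : Matrix (Fin 2) (Fin 2) ℂ :=
  ((Real.sqrt (4 + v 0 ^ 2 + v 1 ^ 2 + v 2 ^ 2))⁻¹ : ℂ) •
    !![2 - Complex.I * v 2, -Complex.I * v 0 - v 1; -Complex.I * v 0 + v 1, 2 + Complex.I * v 2]

theorem contDiff_spinCayley (i j : Fin 2) : ContDiff ℝ ∞ fun v => spinCayley v i j := by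
  have h1 : ContDiff ℝ ∞ fun v : R3 =>
      (((Real.sqrt (4 + v 0 ^ 2 + v 1 ^ 2 + v 2 ^ 2))⁻¹ : ℝ) : ℂ) :=
    Complex.ofRealCLM.contDiff.comp <| ContDiff.inv
      (ContDiff.sqrt (by fun_prop) fun v => (cayley_denom_pos v).ne')
      fun v => (Real.sqrt_pos.2 (cayley_denom_pos v)).ne'
  have h2 : ∀ k, ContDiff ℝ ∞ fun v : R3 => (v k : ℂ) := fun k =>
    Complex.ofRealCLM.contDiff.comp (by fun_prop)
  simp only [Complex.ofReal_inv] at h1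
  simp only [spinCayley, Matrix.smul_apply, smul_eq_mul]
  refine h1.mul ?_
  have h0 := h2 0
  have h1 := h2 1
  have h2 := h2 2
  fin_cases i <;> fin_cases j <;> simp <;> fun_prop

theorem spinCayley_zero : spinCayley 0 = 1 := by
  have h : Real.sqrt 4 = 2 := by
    rw [show (4 : ℝ) = 2 ^ 2 by norm_num]
    exact Real.sqrt_sq (by norm_num)
  ext i j
  fin_cases i <;> fin_cases j <;> simp [spinCayley, h]

theorem hasDerivAt_spinCayley (u : R3) (i j : Fin 2) :
    HasDerivAt (fun t : ℝ => spinCayley (t • u) i j) (spinLie u i j) 0 := by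
  have h1 : HasDerivAt (fun t : ℝ =>
      (Real.sqrt (4 + (t • u) 0 ^ 2 + (t • u) 1 ^ 2 + (t • u) 2 ^ 2))⁻¹) 0 0 := by
    have h2 : HasDerivAt (fun t : ℝ => 4 + (t • u) 0 ^ 2 + (t • u) 1 ^ 2 + (t • u) 2 ^ 2) 0 0 := by
      have h3 : (fun t : ℝ => 4 + (t • u) 0 ^ 2 + (t • u) 1 ^ 2 + (t • u) 2 ^ 2) =
          fun t : ℝ => 4 + t ^ 2 * (u 0 ^ 2 + u 1 ^ 2 + u 2 ^ 2) := by
        ext t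
        simp
        ring
      rw [h3]
      have h4 := ((hasDerivAt_pow 2 (0 : ℝ)).mul_const
        (u 0 ^ 2 + u 1 ^ 2 + u 2 ^ 2)).const_add 4
      simpa using h4
    have h5 := (h2.sqrt (cayley_denom_pos _).ne').inv
      (Real.sqrt_pos.2 (cayley_denom_pos ((0 : ℝ) • u))).ne'
    refine h5.congr_deriv ?_
    simp
  have h6 := h1.ofReal_comp
  have h7 : HasDerivAt (fun t : ℝ => (t : ℂ)) 1 0 := Complex.ofRealCLM.hasDerivAt
  have h8 : Real.sqrt 4 = 2 := by
    rw [show (4 : ℝ) = 2 ^ 2 by norm_num]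
    exact Real.sqrt_sq (by norm_num)
  have key : ∀ a b : ℂ, HasDerivAt (fun t : ℝ =>
      (((Real.sqrt (4 + (t • u) 0 ^ 2 + (t • u) 1 ^ 2 + (t • u) 2 ^ 2))⁻¹ : ℝ) : ℂ) * (a + t * b))
        (2⁻¹ * b) 0 := fun a b => by
    refine (h6.mul ((h7.mul_const b).const_add a)).congr_deriv ?_
    simp [h8]
  fin_cases i <;> fin_cases j
  · refine ((key 2 (-Complex.I * u 2)).congr_of_eventuallyEq
      (.of_forall fun t => ?_)).congr_deriv ?_
    · simp [spinCayley]
      left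
      ring
    · simp [spinLie]
  · refine ((key 0 (-Complex.I * u 0 - u 1)).congr_of_eventuallyEq
      (.of_forall fun t => ?_)).congr_deriv ?_
    · simp [spinCayley]
      left
      ring
    · simp [spinLie]
  · refine ((key 0 (-Complex.I * u 0 + u 1)).congr_of_eventuallyEq
      (.of_forall fun t => ?_)).congr_deriv ?_
    · simp [spinCayley]
      left
      ring
    · simp [spinLie]
  · refine ((key 2 (Complex.I * u 2)).congr_of_eventuallyEq
      (.of_forall fun t => ?_)).congr_deriv ?_
    · simp [spinCayley]
      left
      ring
    · simp [spinLie]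

theorem rep_cayley_apply_apply (l : ℕ) (v : R3) (b : RepSpace l) (j : Fin (2 * l + 1)) :
    rep l (cayley v) b j = ∑ k, symPow (2 * l) (spinCayley v) j k * b k := by
  have h : IsSpinLift (spinCayley v) (cayley v) := isSpinLift_cayley v
  rw [rep_apply_apply, symPow_spinLift l h]

theorem contDiff_rep_cayley (l : ℕ) (b : RepSpace l) :
    ContDiff ℝ ∞ fun v => rep l (cayley v) b := by
  rw [contDiff_piLp]
  intro j
  simp only [rep_cayley_apply_apply]
  exact ContDiff.sum fun k _ => (contDiff_symPow _ contDiff_spinCayley j k).mul contDiff_const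

theorem contDiff_rep_mul_cayley (l : ℕ) (p : SO3) (b : RepSpace l) :
    ContDiff ℝ ∞ fun v => rep l (p * cayley v) b := by
  simp only [rep_mul]
  exact ((rep l p).restrictScalars ℝ).contDiff.comp (contDiff_rep_cayley l b)

theorem hasDerivAt_piLp {ι : Type*} [Fintype ι] {f : ℝ → EuclideanSpace ℂ ι}
    {f' : EuclideanSpace ℂ ι} {t : ℝ} (h : ∀ i, HasDerivAt (fun x => f x i) (f' i) t) :
    HasDerivAt f f' t := by
  have h1 : HasDerivAt (fun x => (f x).ofLp) f'.ofLp t := hasDerivAt_pi.2 h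
  exact (PiLp.continuousLinearEquiv 2 ℝ fun _ : ι => ℂ).symm.hasFDerivAt.comp_hasDerivAt t h1

theorem fderiv_rep_cayley_zero (l : ℕ) (b : RepSpace l) (u : R3) :
    fderiv ℝ (fun v => rep l (cayley v) b) 0 u = repLie l u b := by
  have h1 : HasDerivAt (fun t : ℝ => rep l (cayley (t • u)) b) (repLie l u b) 0 := by
    refine hasDerivAt_piLp fun j => ?_
    simp only [rep_cayley_apply_apply, repLie_apply_apply]
    refine HasDerivAt.fun_sum fun k _ => HasDerivAt.mul_const ?_ _
    exact hasDerivAt_symPow _ (by rw [zero_smul, spinCayley_zero]) (hasDerivAt_spinCayley u) j k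
  have h2 : HasFDerivAt (fun v => rep l (cayley v) b)
      (fderiv ℝ (fun v => rep l (cayley v) b) 0) ((0 : ℝ) • u) := by
    rw [zero_smul]
    exact ((contDiff_rep_cayley l b).differentiable (by simp) 0).hasFDerivAt
  have h3 := h2.comp_hasDerivAt (0 : ℝ) ((hasDerivAt_id (0 : ℝ)).smul_const u)
  rw [one_smul] at h3
  exact h3.unique h1

/-- Along the left-invariant vector fields, the derivative of the representation is given by the
infinitesimal representation. -/
theorem fderiv_rep_mul_cayley (l : ℕ) (p : SO3) (b : RepSpace l) (x u : R3) :
    fderiv ℝ (fun v => rep l (p * cayley v) b) x u =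
      rep l (p * cayley x) (repLie l (maurerCartan x u) b) := by
  have h1 : ∀ q : SO3, HasFDerivAt (fun v => rep l (q * cayley v) b)
      (((rep l q).restrictScalars ℝ) ∘L fderiv ℝ (fun v => rep l (cayley v) b) 0) 0 := by
    intro q
    simp only [rep_mul]
    exact ((rep l q).restrictScalars ℝ).hasFDerivAt.comp 0
      ((contDiff_rep_cayley l b).differentiable (by simp) 0).hasFDerivAt
  have h2 := hasFDerivAt_comp_mul_cayley (h := fun q => rep l q b) (h1 (p * cayley x))
  rw [h2.fderiv]
  simp [fderiv_rep_cayley_zero]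

/-! ### Left-invariant forms -/

/-- The differential at `x` of a map into `SO(3)` is computed in the chart centred at `F x`. -/
theorem mfderiv_eq_of_hasFDerivAt {F : R3 → SO3} {x : R3} {L : R3 →L[ℝ] R3}
    (hc : ContinuousAt F x) (h : HasFDerivAt (fun y => cayleyChart (F x) (F y)) L x) (u : R3) :
    mfderiv (𝓡 3) (𝓡 3) F x u = L u := by
  have h1 : HasMFDerivAt (𝓡 3) (𝓡 3) F x L := ⟨hc, h.hasFDerivWithinAt⟩
  rw [h1.mfderiv]
  rfl

theorem mfderiv_cayleyChart_symm (p : SO3) (x u : R3) :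
    mfderiv (𝓡 3) (𝓡 3) (cayleyChart p).symm x u = maurerCartan x u :=
  mfderiv_eq_of_hasFDerivAt (continuous_mul_cayley p).continuousAt (hasFDerivAt_chart_change p x) u

/-- The left-invariant form on `SO(3)` with matrix `diag(a, a, b)` in the left-invariant frame,
which the tangent space at each point is identified with through the chart centred there. -/
def frameForm (a b : ℝ) : R3 →L[ℝ] R3 →L[ℝ] ℝ :=
  a • ((EuclideanSpace.proj 0).smulRight (EuclideanSpace.proj 0) +
    (EuclideanSpace.proj 1).smulRight (EuclideanSpace.proj 1)) +
  b • (EuclideanSpace.proj 2).smulRight (EuclideanSpace.proj 2)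

theorem frameForm_apply (a b : ℝ) (u v : R3) :
    frameForm a b u v = a * (u 0 * v 0 + u 1 * v 1) + b * (u 2 * v 2) := rfl

/-! ### The standard metric -/

/-- The skew-symmetric matrix of the cross product with `u`. -/
def crossMatrix (u : R3) : Matrix (Fin 3) (Fin 3) ℝ :=
  !![0, -u 2, u 1; u 2, 0, -u 0; -u 1, u 0, 0]

theorem hasDerivAt_cayleyMatrix (u : R3) (i j : Fin 3) :
    HasDerivAt (fun t : ℝ => cayleyMatrix (t • u) i j) (crossMatrix u i j) 0 := by
  have h1 : HasDerivAt (fun t : ℝ =>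
      (4 + (t • u) 0 ^ 2 + (t • u) 1 ^ 2 + (t • u) 2 ^ 2)⁻¹) 0 0 := by
    have h2 : HasDerivAt (fun t : ℝ => 4 + (t • u) 0 ^ 2 + (t • u) 1 ^ 2 + (t • u) 2 ^ 2) 0 0 := by
      have h3 : (fun t : ℝ => 4 + (t • u) 0 ^ 2 + (t • u) 1 ^ 2 + (t • u) 2 ^ 2) =
          fun t : ℝ => 4 + t ^ 2 * (u 0 ^ 2 + u 1 ^ 2 + u 2 ^ 2) := by
        ext t
        simp
        ring
      rw [h3]
      simpa using ((hasDerivAt_pow 2 (0 : ℝ)).mul_const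
        (u 0 ^ 2 + u 1 ^ 2 + u 2 ^ 2)).const_add 4
    exact (h2.inv (cayley_denom_pos _).ne').congr_deriv (by simp)
  -- The entries of the numerator are polynomials `d + e t + f t²`.
  have key : ∀ d e f : ℝ, HasDerivAt (fun t : ℝ =>
      (4 + (t • u) 0 ^ 2 + (t • u) 1 ^ 2 + (t • u) 2 ^ 2)⁻¹ * (d + t * (4 * e) + t ^ 2 * f)) e 0 :=
    fun d e f => by
      have h4 := (((hasDerivAt_id (0 : ℝ)).mul_const (4 * e)).const_add d).add
        ((hasDerivAt_pow 2 (0 : ℝ)).mul_const f)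
      refine (h1.mul h4).congr_deriv ?_
      simp
  fin_cases i <;> fin_cases j
  · exact (key 4 0 (u 0 ^ 2 - u 1 ^ 2 - u 2 ^ 2)).congr_of_eventuallyEq
      (.of_forall fun t => by simp [cayleyMatrix]; left; ring)
  · exact (key 0 (-u 2) (2 * u 0 * u 1)).congr_of_eventuallyEq
      (.of_forall fun t => by simp [cayleyMatrix]; left; ring)
  · exact (key 0 (u 1) (2 * u 0 * u 2)).congr_of_eventuallyEq
      (.of_forall fun t => by simp [cayleyMatrix]; left; ring)
  · exact (key 0 (u 2) (2 * u 0 * u 1)).congr_of_eventuallyEq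
      (.of_forall fun t => by simp [cayleyMatrix]; left; ring)
  · exact (key 4 0 (-u 0 ^ 2 + u 1 ^ 2 - u 2 ^ 2)).congr_of_eventuallyEq
      (.of_forall fun t => by simp [cayleyMatrix]; left; ring)
  · exact (key 0 (-u 0) (2 * u 1 * u 2)).congr_of_eventuallyEq
      (.of_forall fun t => by simp [cayleyMatrix]; left; ring)
  · exact (key 0 (-u 1) (2 * u 0 * u 2)).congr_of_eventuallyEq
      (.of_forall fun t => by simp [cayleyMatrix]; left; ring)
  · exact (key 0 (u 0) (2 * u 1 * u 2)).congr_of_eventuallyEq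
      (.of_forall fun t => by simp [cayleyMatrix]; left; ring)
  · exact (key 4 0 (-u 0 ^ 2 - u 1 ^ 2 + u 2 ^ 2)).congr_of_eventuallyEq
      (.of_forall fun t => by simp [cayleyMatrix]; left; ring)

/-- The tangent vector with coordinates `u` in the chart centred at `p` is the matrix `p [u]`. -/
theorem inclusionDiff_eq (p : SO3) (u : R3) : inclusionDiff p u = p.1 * crossMatrix u := by
  ext i j
  have hs : ContDiff ℝ ∞ fun v : R3 => (p * cayley v).1 i j := by
    change ContDiff ℝ ∞ fun v : R3 => (p.1 * cayleyMatrix v) i j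
    simp only [Matrix.mul_apply]
    exact ContDiff.sum fun k _ => contDiff_const.mul (contDiff_cayleyMatrix_apply k j)
  have h1 : HasDerivAt (fun t : ℝ => (p * cayley (t • u)).1 i j) ((p.1 * crossMatrix u) i j) 0 := by
    change HasDerivAt (fun t : ℝ => (p.1 * cayleyMatrix (t • u)) i j) _ 0
    simp only [Matrix.mul_apply]
    exact HasDerivAt.fun_sum fun k _ => (hasDerivAt_cayleyMatrix u k j).const_mul _
  have h2 := (hs.differentiable (by simp) 0).hasFDerivAt
  have h3 : HasFDerivAt (fun v : R3 => (p * cayley v).1 i j)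
      (fderiv ℝ (fun v : R3 => (p * cayley v).1 i j) 0) ((0 : ℝ) • u) := by rwa [zero_smul]
  have h4 := h3.comp_hasDerivAt (0 : ℝ) ((hasDerivAt_id (0 : ℝ)).smul_const u)
  rw [one_smul] at h4
  exact (tangentDiff_eq (h := fun q : SO3 => q.1 i j) h2 u).trans (h4.unique h1)

theorem standardMetric_eq (p : SO3) (u v : R3) : standardMetric p u v = frameForm 1 1 u v := by
  change ((inclusionDiff p u)ᵀ * inclusionDiff p v).trace / 2 = _
  rw [inclusionDiff_eq, inclusionDiff_eq, Matrix.transpose_mul, Matrix.mul_assoc,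
    ← Matrix.mul_assoc p.1ᵀ, p.transpose_mul_self, Matrix.one_mul, frameForm_apply]
  simp [crossMatrix, Matrix.trace, Matrix.mul_apply, Fin.sum_univ_three]
  ring

/-! ### Euler angles -/

/-- The differential of `cayleyInv` at the identity sends `B` to the axial vector of its
skew-symmetric part. It is stated for a family of matrices `A` with directional derivatives
`A'`. -/
theorem differentiableAt_and_fderiv_cayleyInv {A : R3 → Matrix (Fin 3) (Fin 3) ℝ} {x : R3}
    {A' : R3 → Matrix (Fin 3) (Fin 3) ℝ} (h0 : A x = 1)
    (hA : ∀ i j, DifferentiableAt ℝ (fun y => A y i j) x)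
    (hA' : ∀ u i j, HasDerivAt (fun t : ℝ => A (x + t • u) i j) (A' u i j) 0) :
    DifferentiableAt ℝ (fun y => cayleyInv (A y)) x ∧ ∀ u,
      fderiv ℝ (fun y => cayleyInv (A y)) x u = !₂[(A' u 2 1 - A' u 1 2) / 2,
        (A' u 0 2 - A' u 2 0) / 2, (A' u 1 0 - A' u 0 1) / 2] := by
  have ht : DifferentiableAt ℝ (fun y => 1 + (A y).trace) x := by
    simp only [Matrix.trace, Matrix.diag, Fin.sum_univ_three]
    exact (differentiableAt_const _).fun_add (((hA 0 0).fun_add (hA 1 1)).fun_add (hA 2 2))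
  have ht0 : 1 + (A x).trace = 4 := by
    rw [h0]
    simp
    norm_num
  have hd : ∀ i j, DifferentiableAt ℝ (fun y => 2 * (A y i j - A y j i) / (1 + (A y).trace)) x :=
    fun i j => by
      simp only [div_eq_mul_inv]
      exact (((hA i j).fun_sub (hA j i)).const_mul 2).fun_mul
        (ht.fun_inv (by rw [ht0]; norm_num))
  have hd' : DifferentiableAt ℝ (fun y => cayleyInv (A y)) x := by
    rw [differentiableAt_euclidean]
    intro k
    fin_cases k
    · exact hd 2 1
    · exact hd 0 2
    · exact hd 1 0
  refine ⟨hd', fun u => ?_⟩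
  have h1 : HasFDerivAt (fun y => cayleyInv (A y)) (fderiv ℝ (fun y => cayleyInv (A y)) x)
      (x + (0 : ℝ) • u) := by
    rw [zero_smul, add_zero]
    exact hd'.hasFDerivAt
  have h2 := h1.comp_hasDerivAt (0 : ℝ) (((hasDerivAt_id (0 : ℝ)).smul_const u).const_add x)
  rw [one_smul] at h2
  have htl : HasDerivAt (fun t : ℝ => 1 + (A (x + t • u)).trace) ((A' u).trace) 0 := by
    simp only [Matrix.trace, Matrix.diag, Fin.sum_univ_three]
    exact (((hA' u 0 0).add (hA' u 1 1)).add (hA' u 2 2)).const_add 1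
  have hl : ∀ i j, HasDerivAt
      (fun t : ℝ => 2 * (A (x + t • u) i j - A (x + t • u) j i) / (1 + (A (x + t • u)).trace))
      ((A' u i j - A' u j i) / 2) 0 := fun i j => by
    have hne : 1 + (A (x + (0 : ℝ) • u)).trace ≠ 0 := by
      rw [zero_smul, add_zero, ht0]
      norm_num
    have h := (((hA' u i j).sub (hA' u j i)).const_mul 2).fun_div htl hne
    refine h.congr_deriv ?_
    have hs : A x i j - A x j i = 0 := by
      rw [h0, Matrix.one_apply, Matrix.one_apply]
      simp [eq_comm]
    simp only [zero_smul, add_zero, ht0, Pi.sub_apply, hs]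
    ring
  have hc : ∀ k, HasDerivAt (fun t : ℝ => cayleyInv (A (x + t • u)) k)
      (fderiv ℝ (fun y => cayleyInv (A y)) x u k) 0 := fun k =>
    (EuclideanSpace.proj k : R3 →L[ℝ] ℝ).hasFDerivAt.comp_hasDerivAt 0 h2
  ext k
  fin_cases k
  · exact (hc 0).unique (hl 2 1)
  · exact (hc 1).unique (hl 0 2)
  · exact (hc 2).unique (hl 1 0)

/-- The angular velocity, in the body frame, in terms of the velocities of the Euler angles. -/
def eulerVelocity (x u : R3) : R3 :=
  !₂[-Real.sin (x 1) * Real.cos (x 2) * u 0 + Real.sin (x 2) * u 1,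
    Real.sin (x 1) * Real.sin (x 2) * u 0 + Real.cos (x 2) * u 1,
    Real.cos (x 1) * u 0 + u 2]

theorem euler_val (x : R3) : (euler x).1 =
    !![Real.cos (x 0) * Real.cos (x 1) * Real.cos (x 2) - Real.sin (x 0) * Real.sin (x 2),
        -(Real.cos (x 0) * Real.cos (x 1) * Real.sin (x 2)) - Real.sin (x 0) * Real.cos (x 2),
        Real.cos (x 0) * Real.sin (x 1);
      Real.sin (x 0) * Real.cos (x 1) * Real.cos (x 2) + Real.cos (x 0) * Real.sin (x 2),
        -(Real.sin (x 0) * Real.cos (x 1) * Real.sin (x 2)) + Real.cos (x 0) * Real.cos (x 2),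
        Real.sin (x 0) * Real.sin (x 1);
      -(Real.sin (x 1) * Real.cos (x 2)), Real.sin (x 1) * Real.sin (x 2), Real.cos (x 1)] := by
  change (rotZ (x 0)).1 * (rotY (x 1)).1 * (rotZ (x 2)).1 = _
  ext i j
  fin_cases i <;> fin_cases j <;>
    simp [rotZ, rotY, Matrix.mul_apply, Fin.sum_univ_three] <;> ring

theorem contDiff_euler_apply (i j : Fin 3) : ContDiff ℝ ∞ fun x : R3 => (euler x).1 i j := by
  simp only [euler_val]
  fin_cases i <;> fin_cases j <;> simp <;> fun_prop

theorem hasDerivAt_euler_apply (x u : R3) (i j : Fin 3) :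
    HasDerivAt (fun t : ℝ => (euler (x + t • u)).1 i j)
      (((euler x).1 * crossMatrix (eulerVelocity x u)) i j) 0 := by
  have hl : ∀ k, HasDerivAt (fun t : ℝ => (x + t • u) k) (u k) 0 := fun k => by
    have h := ((hasDerivAt_id (0 : ℝ)).mul_const (u k)).const_add (x k)
    simpa using h
  have hx : ∀ k, (x + (0 : ℝ) • u) k = x k := fun k => by simp
  have hc : ∀ k, HasDerivAt (fun t : ℝ => Real.cos ((x + t • u) k)) (-Real.sin (x k) * u k) 0 :=
    fun k => by simpa only [hx] using (hl k).cos
  have hs : ∀ k, HasDerivAt (fun t : ℝ => Real.sin ((x + t • u) k)) (Real.cos (x k) * u k) 0 :=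
    fun k => by simpa only [hx] using (hl k).sin
  have e1 := Real.sin_sq_add_cos_sq (x 1)
  have e2 := Real.sin_sq_add_cos_sq (x 2)
  simp only [euler_val]
  fin_cases i <;> fin_cases j
  · refine ((((hc 0).mul (hc 1)).mul (hc 2)).sub ((hs 0).mul (hs 2))).congr_deriv ?_
    simp [Matrix.mul_apply, Fin.sum_univ_three, crossMatrix, eulerVelocity]
    grind
  · refine ((((hc 0).mul (hc 1)).mul (hs 2)).neg.sub ((hs 0).mul (hc 2))).congr_deriv ?_
    simp [Matrix.mul_apply, Fin.sum_univ_three, crossMatrix, eulerVelocity]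
    grind
  · refine ((hc 0).mul (hs 1)).congr_deriv ?_
    simp [Matrix.mul_apply, Fin.sum_univ_three, crossMatrix, eulerVelocity]
    grind
  · refine ((((hs 0).mul (hc 1)).mul (hc 2)).add ((hc 0).mul (hs 2))).congr_deriv ?_
    simp [Matrix.mul_apply, Fin.sum_univ_three, crossMatrix, eulerVelocity]
    grind
  · refine ((((hs 0).mul (hc 1)).mul (hs 2)).neg.add ((hc 0).mul (hc 2))).congr_deriv ?_
    simp [Matrix.mul_apply, Fin.sum_univ_three, crossMatrix, eulerVelocity]
    grind
  · refine ((hs 0).mul (hs 1)).congr_deriv ?_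
    simp [Matrix.mul_apply, Fin.sum_univ_three, crossMatrix, eulerVelocity]
    grind
  · refine ((hs 1).mul (hc 2)).neg.congr_deriv ?_
    simp [Matrix.mul_apply, Fin.sum_univ_three, crossMatrix, eulerVelocity]
    grind
  · refine ((hs 1).mul (hs 2)).congr_deriv ?_
    simp [Matrix.mul_apply, Fin.sum_univ_three, crossMatrix, eulerVelocity]
    grind
  · refine (hc 1).congr_deriv ?_
    simp [Matrix.mul_apply, Fin.sum_univ_three, crossMatrix, eulerVelocity]
    grind

theorem mfderiv_euler (x u : R3) :
    mfderiv (𝓡 3) (𝓡 3) euler x u = eulerVelocity x u := by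
  have hcont : Continuous euler :=
    Continuous.subtype_mk (continuous_matrix fun i j => (contDiff_euler_apply i j).continuous) _
  have h := differentiableAt_and_fderiv_cayleyInv (x := x)
    (A := fun y => (euler x).1ᵀ * (euler y).1)
    (A' := fun u => crossMatrix (eulerVelocity x u)) (euler x).transpose_mul_self
    (fun i j => by
      simp only [Matrix.mul_apply]
      exact DifferentiableAt.fun_sum fun k _ =>
        ((contDiff_euler_apply k j).differentiable (by simp) x).const_mul _)
    (fun u i j => by
      have h : crossMatrix (eulerVelocity x u) =
          (euler x).1ᵀ * ((euler x).1 * crossMatrix (eulerVelocity x u)) := by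
        rw [← Matrix.mul_assoc, (euler x).transpose_mul_self, Matrix.one_mul]
      rw [h]
      simp only [Matrix.mul_apply (M := (euler x).1ᵀ)]
      exact HasDerivAt.fun_sum fun k _ => (hasDerivAt_euler_apply x u k j).const_mul _)
  refine (mfderiv_eq_of_hasFDerivAt hcont.continuousAt h.1.hasFDerivAt u).trans ((h.2 u).trans ?_)
  ext k
  fin_cases k <;> simp [crossMatrix]

/-- The frame `eulerVelocity` depends on `ψ`, but the form `diag(a², a², b²)` is invariant under
rotations about the third axis, so that its Gram matrix depends on `θ` alone. -/
theorem gramMatrix_euler {g : ∀ p : SO3, TangentSpace (𝓡 3) p → TangentSpace (𝓡 3) p → ℝ}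
    {a b : ℝ} (hg : ∀ (p : SO3) (u v : R3), g p u v = frameForm (a ^ 2) (b ^ 2) u v) (x : R3) :
    gramMatrix g euler x = sigmaMatrix a b x := by
  have h : ∀ i j, gramMatrix g euler x i j = frameForm (a ^ 2) (b ^ 2)
      (eulerVelocity x (EuclideanSpace.single i 1)) (eulerVelocity x (EuclideanSpace.single j 1)) :=
    fun i j => by
      rw [← mfderiv_euler, ← mfderiv_euler]
      exact hg _ _ _
  have e1 := Real.sin_sq_add_cos_sq (x 1)
  have e2 := Real.sin_sq_add_cos_sq (x 2)
  ext i j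
  rw [h, frameForm_apply]
  fin_cases i <;> fin_cases j <;> simp [eulerVelocity, sigmaMatrix] <;> grind

/-! ### Eigenvalues -/

/-- The matrices of the form in two orthonormal bases are conjugate by an orthogonal matrix. -/
theorem hasRelativeEigenvalues_frameForm (a b : ℝ) :
    HasRelativeEigenvalues (fun u v : R3 => frameForm a b u v) (fun u v => frameForm 1 1 u v)
      {a, a, b} := by
  refine ⟨⟨fun i => EuclideanSpace.single i 1, fun i j => ?_⟩, fun e he => ?_⟩
  · fin_cases i <;> fin_cases j <;> simp [frameForm_apply]
  · set Q : Matrix (Fin 3) (Fin 3) ℝ := Matrix.of fun k i => e i k with hQ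
    have hQ1 : Qᵀ * Q = 1 := by
      ext i j
      have := he i j
      simp only [frameForm_apply] at this
      rw [Matrix.one_apply, ← this]
      simp [Matrix.mul_apply, Fin.sum_univ_three, hQ]
    have hQ2 : Q * Qᵀ = 1 := mul_eq_one_comm.1 hQ1
    have hH : (Matrix.of fun i j => frameForm a b (e i) (e j)) =
        Qᵀ * Matrix.diagonal ![a, a, b] * Q := by
      ext i j
      simp [Matrix.mul_apply, Fin.sum_univ_three, hQ, frameForm_apply, Matrix.diagonal]
      ring
    have hc := Matrix.charpoly_units_conj (⟨Qᵀ, Q, hQ1, hQ2⟩ : (Matrix (Fin 3) (Fin 3) ℝ)ˣ)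
      (Matrix.diagonal ![a, a, b])
    simp only [Matrix.inv_eq_right_inv hQ1] at hc
    rw [hH, hc, Matrix.charpoly_diagonal, Fin.prod_univ_three]
    have h := Polynomial.roots_multiset_prod_X_sub_C ({a, a, b} : Multiset ℝ)
    rw [← h]
    congr 1
    simp [mul_assoc]

/-! ### Left-invariant Riemannian metrics -/

theorem frameForm_comm (a b : ℝ) (u v : R3) : frameForm a b u v = frameForm a b v u := by
  rw [frameForm_apply, frameForm_apply]
  ring

theorem frameForm_self_pos {a b : ℝ} (ha : 0 < a) (hb : 0 < b) {v : R3} (hv : v ≠ 0) :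
    0 < frameForm a b v v := by
  rw [frameForm_apply]
  by_contra! h
  refine hv ?_
  have h0 := mul_nonneg ha.le (mul_self_nonneg (v 0))
  have h1 := mul_nonneg ha.le (mul_self_nonneg (v 1))
  have h2 := mul_nonneg hb.le (mul_self_nonneg (v 2))
  have e0 : a * (v 0 * v 0) = 0 := by linarith
  have e1 : a * (v 1 * v 1) = 0 := by linarith
  have e2 : b * (v 2 * v 2) = 0 := by linarith
  ext i
  fin_cases i
  · simpa [ha.ne'] using e0
  · simpa [ha.ne'] using e1
  · simpa [hb.ne'] using e2

theorem isVonNBounded_frameForm {a b : ℝ} (ha : 0 < a) (hb : 0 < b) :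
    Bornology.IsVonNBounded ℝ {v : R3 | frameForm a b v v < 1} := by
  have hm : 0 < min a b := lt_min ha hb
  rw [NormedSpace.isVonNBounded_iff, isBounded_iff_forall_norm_le]
  refine ⟨Real.sqrt (1 / min a b), fun v hv => Real.le_sqrt_of_sq_le ?_⟩
  rw [Set.mem_ofPred_eq, frameForm_apply] at hv
  rw [EuclideanSpace.norm_sq_eq, Fin.sum_univ_three, le_div_iff₀ hm]
  simp only [Real.norm_eq_abs, sq_abs]
  nlinarith [mul_le_mul_of_nonneg_right (min_le_left a b) (sq_nonneg (v 0)),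
    mul_le_mul_of_nonneg_right (min_le_left a b) (sq_nonneg (v 1)),
    mul_le_mul_of_nonneg_right (min_le_right a b) (sq_nonneg (v 2))]

/-- The expression of a left-invariant form in Cayley coordinates. -/
def frameFormCoord (a b : ℝ) (x : R3) : R3 →L[ℝ] R3 →L[ℝ] ℝ :=
  (frameForm a b).bilinearComp (maurerCartan x) (maurerCartan x)

theorem frameFormCoord_apply (a b : ℝ) (x u v : R3) :
    frameFormCoord a b x u v = frameForm a b (maurerCartan x u) (maurerCartan x v) := rfl

theorem contDiff_frameFormCoord (a b : ℝ) : ContDiff ℝ ∞ (frameFormCoord a b) := by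
  rw [contDiff_clm_apply_iff]
  intro u
  rw [contDiff_clm_apply_iff]
  intro v
  simp only [frameFormCoord_apply]
  exact ((frameForm a b).contDiff.comp (contDiff_maurerCartan_apply u)).clm_apply
    (contDiff_maurerCartan_apply v)

/-- A left-invariant form is smooth, since its expression in each chart is `frameFormCoord`. -/
theorem contMDiff_frameForm (a b : ℝ) :
    ContMDiff (𝓡 3) ((𝓡 3).prod 𝓘(ℝ, R3 →L[ℝ] R3 →L[ℝ] ℝ)) ∞
      (fun p : SO3 => Bundle.TotalSpace.mk' (R3 →L[ℝ] R3 →L[ℝ] ℝ)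
        (E := fun p : SO3 => TangentSpace (𝓡 3) p →L[ℝ] TangentSpace (𝓡 3) p →L[ℝ] ℝ)
        p (frameForm a b)) := by
  intro p
  rw [contMDiffAt_hom_bundle]
  refine ⟨contMDiffAt_id, ?_⟩
  have h1 : ContMDiffAt (𝓡 3) 𝓘(ℝ, R3 →L[ℝ] R3 →L[ℝ] ℝ) ∞
      (fun q : SO3 => frameFormCoord a b (extChartAt (𝓡 3) p q)) p :=
    (contDiff_frameFormCoord a b).contMDiff.contMDiffAt.comp p contMDiffAt_extChartAt
  refine h1.congr_of_eventuallyEq ?_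
  filter_upwards [(chartAt R3 p).open_source.mem_nhds (mem_chart_source R3 p)] with q hq
  have hq' : q ∈ (trivializationAt R3 (TangentSpace (𝓡 3)) p).baseSet := hq
  have hs : ∀ u : R3, (trivializationAt R3 (TangentSpace (𝓡 3)) p).symm q u =
      maurerCartan (extChartAt (𝓡 3) p q) u := by
    intro u
    have h2 := congrArg (fun L : R3 →L[ℝ] TangentSpace (𝓡 3) q => L u)
      (TangentBundle.symmL_trivializationAt (I := 𝓡 3) hq)
    have h3 := mfderiv_cayleyChart_symm p (cayleyChart p q) u
    simp only [modelWithCornersSelf_coe, Set.range_id, mfderivWithin_univ] at h2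
    exact ((Bundle.Trivialization.symmL_apply _ hq' u).symm.trans h2).trans h3
  ext u v
  refine (inCoordinates_apply_eq₂ (E₃ := Bundle.Trivial SO3 ℝ) (F₃ := ℝ) hq' hq'
    (Set.mem_univ _)).trans ?_
  rw [hs, hs]
  have ht : ∀ y : ℝ, (trivializationAt ℝ (Bundle.Trivial SO3 ℝ) p).linearMapAt ℝ q y = y :=
    fun y => by simp
  exact ht _

/-- The left-invariant Riemannian metric on `SO(3)` with matrix `diag(a, a, b)` in the
left-invariant frame. -/
def frameMetric {a b : ℝ} (ha : 0 < a) (hb : 0 < b) :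
    Bundle.ContMDiffRiemannianMetric (𝓡 3) ∞ R3 (fun p : SO3 => TangentSpace (𝓡 3) p) where
  inner _ := frameForm a b
  symm _ u v := frameForm_comm a b u v
  pos _ _ hv := frameForm_self_pos ha hb hv
  isVonNBounded _ := isVonNBounded_frameForm ha hb
  contMDiff := contMDiff_frameForm a b

/-! ### Second-order jets at the origin -/

/-- `f` is smooth, with value `c`, gradient `l` and Hessian matrix `q` at the origin. -/
structure HasJet (f : R3 → ℝ) (c : ℝ) (l : Fin 3 → ℝ) (q : Fin 3 → Fin 3 → ℝ) : Prop where
  smooth : ContDiff ℝ ∞ f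
  value : f 0 = c
  grad : ∀ i, partialDeriv i f 0 = l i
  hess : ∀ i j, partialDeriv i (partialDeriv j f) 0 = q i j

theorem contDiff_partialDeriv {f : R3 → ℝ} (hf : ContDiff ℝ ∞ f) (i : Fin 3) :
    ContDiff ℝ ∞ (partialDeriv i f) :=
  (hf.fderiv_right (m := ∞) (by simp)).clm_apply contDiff_const

theorem partialDeriv_add {f g : R3 → ℝ} (hf : ContDiff ℝ ∞ f) (hg : ContDiff ℝ ∞ g) (i : Fin 3) :
    partialDeriv i (fun x => f x + g x) = fun x => partialDeriv i f x + partialDeriv i g x := by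
  ext x
  have := ((hf.differentiable (by simp) x).hasFDerivAt.add
    (hg.differentiable (by simp) x).hasFDerivAt).fderiv
  simp only [partialDeriv]
  erw [this]
  rfl

theorem partialDeriv_mul {f g : R3 → ℝ} (hf : ContDiff ℝ ∞ f) (hg : ContDiff ℝ ∞ g) (i : Fin 3) :
    partialDeriv i (fun x => f x * g x) =
      fun x => partialDeriv i f x * g x + f x * partialDeriv i g x := by
  ext x
  have := ((hf.differentiable (by simp) x).hasFDerivAt.mul
    (hg.differentiable (by simp) x).hasFDerivAt).fderiv
  simp only [partialDeriv]
  erw [this]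
  simp
  ring

theorem partialDeriv_const (c : ℝ) (i : Fin 3) : partialDeriv i (fun _ : R3 => c) = fun _ => 0 := by
  ext x
  simp [partialDeriv]

theorem HasJet.const (c : ℝ) : HasJet (fun _ => c) c (fun _ => 0) fun _ _ => 0 where
  smooth := contDiff_const
  value := rfl
  grad i := by rw [partialDeriv_const]
  hess i j := by rw [partialDeriv_const, partialDeriv_const]

theorem HasJet.coord (k : Fin 3) :
    HasJet (fun x => x k) 0 (fun i => if i = k then 1 else 0) fun _ _ => 0 := by
  have h : ∀ i, partialDeriv i (fun x : R3 => x k) = fun _ => if i = k then 1 else 0 := by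
    intro i
    ext x
    have h := (EuclideanSpace.proj k : R3 →L[ℝ] ℝ).fderiv (x := x)
    simp only [partialDeriv]
    erw [h]
    simp [eq_comm]
  exact
    { smooth := by fun_prop
      value := rfl
      grad := fun i => by rw [h]
      hess := fun i j => by rw [h, partialDeriv_const] }

theorem HasJet.add {f g : R3 → ℝ} {c c' : ℝ} {l l' : Fin 3 → ℝ} {q q' : Fin 3 → Fin 3 → ℝ}
    (hf : HasJet f c l q) (hg : HasJet g c' l' q') :
    HasJet (fun x => f x + g x) (c + c') (fun i => l i + l' i) fun i j => q i j + q' i j where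
  smooth := hf.smooth.add hg.smooth
  value := by rw [hf.value, hg.value]
  grad i := by simp only [partialDeriv_add hf.smooth hg.smooth, hf.grad, hg.grad]
  hess i j := by
    simp only [partialDeriv_add hf.smooth hg.smooth, partialDeriv_add
      (contDiff_partialDeriv hf.smooth j) (contDiff_partialDeriv hg.smooth j), hf.hess, hg.hess]

theorem HasJet.mul {f g : R3 → ℝ} {c c' : ℝ} {l l' : Fin 3 → ℝ} {q q' : Fin 3 → Fin 3 → ℝ}
    (hf : HasJet f c l q) (hg : HasJet g c' l' q') :
    HasJet (fun x => f x * g x) (c * c') (fun i => l i * c' + c * l' i)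
      fun i j => q i j * c' + l j * l' i + (l i * l' j + c * q' i j) where
  smooth := hf.smooth.mul hg.smooth
  value := by rw [hf.value, hg.value]
  grad i := by
    simp only [partialDeriv_mul hf.smooth hg.smooth, hf.grad, hg.grad, hf.value, hg.value]
  hess i j := by
    have hf' := contDiff_partialDeriv hf.smooth j
    have hg' := contDiff_partialDeriv hg.smooth j
    rw [partialDeriv_mul hf.smooth hg.smooth, partialDeriv_add (hf'.mul hg.smooth)
      (hf.smooth.mul hg'), partialDeriv_mul hf' hg.smooth, partialDeriv_mul hf.smooth hg']
    simp only [hf.hess, hg.hess, hf.grad, hg.grad, hf.value, hg.value]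

theorem HasJet.sum {f : Fin 3 → R3 → ℝ} {c : Fin 3 → ℝ} {l : Fin 3 → Fin 3 → ℝ}
    {q : Fin 3 → Fin 3 → Fin 3 → ℝ} (hf : ∀ k, HasJet (f k) (c k) (l k) (q k)) :
    HasJet (fun x => ∑ k, f k x) (∑ k, c k) (fun i => ∑ k, l k i) fun i j => ∑ k, q k i j := by
  simp only [Fin.sum_univ_three]
  exact ((hf 0).add (hf 1)).add (hf 2)

theorem HasJet.congr {f : R3 → ℝ} {c c' : ℝ} {l l' : Fin 3 → ℝ} {q q' : Fin 3 → Fin 3 → ℝ}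
    (hf : HasJet f c l q) (hc : c = c') (hl : ∀ i, l i = l' i) (hq : ∀ i j, q i j = q' i j) :
    HasJet f c' l' q' where
  smooth := hf.smooth
  value := hf.value.trans hc
  grad i := (hf.grad i).trans (hl i)
  hess i j := (hf.hess i j).trans (hq i j)

/-- The conformal factor in `maurerCartan`. -/
theorem hasJet_conformal : HasJet (fun x => 4 / (4 + x 0 ^ 2 + x 1 ^ 2 + x 2 ^ 2)) 1 (fun _ => 0)
    fun i j => if i = j then -2⁻¹ else 0 := by
  set r : R3 → ℝ := fun x => 4 / (4 + x 0 ^ 2 + x 1 ^ 2 + x 2 ^ 2) with hr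
  have hs : ContDiff ℝ ∞ r :=
    ContDiff.div contDiff_const (by fun_prop) fun v => (cayley_denom_pos v).ne'
  have hr' : HasJet r (r 0) (fun i => partialDeriv i r 0)
      fun i j => partialDeriv i (partialDeriv j r) 0 := ⟨hs, rfl, fun _ => rfl, fun _ _ => rfl⟩
  have hsq : ∀ k, HasJet (fun x => x k * x k) 0 (fun _ => 0)
      fun i j => if i = k ∧ j = k then 2 else 0 := fun k =>
    ((HasJet.coord k).mul (HasJet.coord k)).congr (by simp) (by simp) fun i j => by
      by_cases hi : i = k <;> by_cases hj : j = k <;> simp [hi, hj]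
      norm_num
  have hd : HasJet (fun x => 4 + (x 0 * x 0 + x 1 * x 1 + x 2 * x 2)) 4 (fun _ => 0)
      fun i j => if i = j then 2 else 0 :=
    ((HasJet.const 4).add (((hsq 0).add (hsq 1)).add (hsq 2))).congr (by simp) (by simp)
      fun i j => by fin_cases i <;> fin_cases j <;> simp
  -- The jet of `r` is determined by the relation `r d = 4`.
  have h1 := hr'.mul hd
  have h2 : (fun x => r x * (4 + (x 0 * x 0 + x 1 * x 1 + x 2 * x 2))) = fun _ : R3 => 4 := by
    ext x
    have := (cayley_denom_pos x).ne'
    simp only [hr]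
    rw [div_mul_eq_mul_div, div_eq_iff this]
    ring
  rw [h2] at h1
  have hv := h1.value
  have hg := fun i => h1.grad i
  have hh := fun i j => h1.hess i j
  have h4 := HasJet.const 4
  have hr0 : r 0 = 1 := by linarith
  refine ⟨hs, hr0, fun i => ?_, fun i j => ?_⟩
  · have := hg i
    rw [h4.grad] at this
    linarith
  · have := hh i j
    rw [h4.hess, hr0] at this
    split_ifs at this ⊢ <;> linarith

/-- The Levi-Civita symbol: `(u × v)_m = ∑ k i, leviCivita m k i * u k * v i`. -/
def leviCivita : Fin 3 → Fin 3 → Fin 3 → ℝ :=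
  ![![![0, 0, 0], ![0, 0, 1], ![0, -1, 0]], ![![0, 0, -1], ![0, 0, 0], ![1, 0, 0]],
    ![![0, 1, 0], ![-1, 0, 0], ![0, 0, 0]]]

theorem hasJet_maurerCartan (m i : Fin 3) :
    HasJet (fun x => maurerCartan x (EuclideanSpace.single i 1) m) (if m = i then 1 else 0)
      (fun k => -2⁻¹ * leviCivita m k i)
      fun k n => if k = n then (if m = i then -2⁻¹ else 0) else 0 := by
  have h1 : HasJet (fun x => (if m = i then 1 else 0) + ∑ k, -2⁻¹ * leviCivita m k i * x k)
      (if m = i then 1 else 0) (fun k => -2⁻¹ * leviCivita m k i) fun _ _ => 0 :=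
    ((HasJet.const _).add (HasJet.sum fun k =>
      (HasJet.const (-2⁻¹ * leviCivita m k i)).mul (HasJet.coord k))).congr (by simp)
      (by simp) (by simp)
  have h2 : (fun x => maurerCartan x (EuclideanSpace.single i 1) m) = fun x =>
      4 / (4 + x 0 ^ 2 + x 1 ^ 2 + x 2 ^ 2) *
        ((if m = i then 1 else 0) + ∑ k, -2⁻¹ * leviCivita m k i * x k) := by
    ext x
    fin_cases m <;> fin_cases i <;>
      simp [maurerCartan_apply, cross, leviCivita, Fin.sum_univ_three]
  rw [h2]
  refine (hasJet_conformal.mul h1).congr (by simp) (by simp) fun k n => ?_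
  by_cases hk : k = n <;> by_cases hm : m = i <;> simp [hk, hm]

/-- The matrix of a left-invariant metric in Cayley coordinates. -/
def coordGram (a b : ℝ) (x : R3) : Matrix (Fin 3) (Fin 3) ℝ :=
  Matrix.of fun i j => ∑ m, ![a, a, b] m * (maurerCartan x (EuclideanSpace.single i 1) m *
    maurerCartan x (EuclideanSpace.single j 1) m)

theorem gramMatrix_cayleyChart_symm (a b : ℝ) (p : SO3) :
    gramMatrix (fun (_ : SO3) (u v : R3) => frameForm a b u v) (cayleyChart p).symm =
      coordGram a b := by
  ext x i j
  change frameForm a b (mfderiv (𝓡 3) (𝓡 3) (cayleyChart p).symm x _)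
    (mfderiv (𝓡 3) (𝓡 3) (cayleyChart p).symm x _) = _
  rw [mfderiv_cayleyChart_symm, mfderiv_cayleyChart_symm, frameForm_apply, coordGram]
  simp only [Matrix.of_apply, Fin.sum_univ_three]
  simp
  ring

/-- The inverse of `maurerCartan x`, as a matrix. -/
def maurerCartanInv (x : R3) (m i : Fin 3) : ℝ :=
  (if m = i then 1 else 0) + ∑ k, 2⁻¹ * leviCivita m k i * x k + 4⁻¹ * (x m * x i)

theorem hasJet_maurerCartanInv (m i : Fin 3) :
    ∃ q, HasJet (fun x => maurerCartanInv x m i) (if m = i then 1 else 0)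
      (fun k => 2⁻¹ * leviCivita m k i) q := by
  refine ⟨_, (((HasJet.const _).add (HasJet.sum fun k =>
      (HasJet.const (2⁻¹ * leviCivita m k i)).mul (HasJet.coord k))).add
      ((HasJet.const _).mul ((HasJet.coord m).mul (HasJet.coord i)))).congr ?_ ?_ fun _ _ => rfl⟩
  · simp
  · simp

theorem coordGram_inv {a b : ℝ} (ha : a ≠ 0) (hb : b ≠ 0) (x : R3) :
    (coordGram a b x)⁻¹ = Matrix.of fun i j =>
      ∑ m, ![a⁻¹, a⁻¹, b⁻¹] m * (maurerCartanInv x i m * maurerCartanInv x j m) := by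
  set M : Matrix (Fin 3) (Fin 3) ℝ :=
    Matrix.of fun m i => maurerCartan x (EuclideanSpace.single i 1) m with hM
  set N : Matrix (Fin 3) (Fin 3) ℝ := Matrix.of fun m i => maurerCartanInv x m i with hN
  have hMN : M * N = 1 := by
    have := (cayley_denom_pos x).ne'
    ext i j
    fin_cases i <;> fin_cases j <;>
      simp [hM, hN, Matrix.mul_apply, Fin.sum_univ_three, maurerCartan_apply, cross,
        maurerCartanInv, leviCivita] <;> field_simp <;> ring
  have hG : coordGram a b x = Mᵀ * Matrix.diagonal ![a, a, b] * M := by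
    ext i j
    simp [hM, coordGram, Matrix.mul_apply, Fin.sum_univ_three, Matrix.diagonal]
    ring
  have hH : (Matrix.of fun i j =>
      ∑ m, ![a⁻¹, a⁻¹, b⁻¹] m * (maurerCartanInv x i m * maurerCartanInv x j m)) =
      N * Matrix.diagonal ![a⁻¹, a⁻¹, b⁻¹] * Nᵀ := by
    ext i j
    simp [hN, Matrix.mul_apply, Fin.sum_univ_three, Matrix.diagonal]
    ring
  have hD : Matrix.diagonal ![a, a, b] * Matrix.diagonal ![a⁻¹, a⁻¹, b⁻¹] = 1 := by
    rw [Matrix.diagonal_mul_diagonal, ← Matrix.diagonal_one]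
    congr 1
    ext i
    fin_cases i <;> simp [ha, hb]
  rw [hG, hH]
  apply Matrix.inv_eq_right_inv
  calc Mᵀ * Matrix.diagonal ![a, a, b] * M * (N * Matrix.diagonal ![a⁻¹, a⁻¹, b⁻¹] * Nᵀ)
      = Mᵀ * (Matrix.diagonal ![a, a, b] * (M * N) * Matrix.diagonal ![a⁻¹, a⁻¹, b⁻¹]) * Nᵀ := by
        simp only [Matrix.mul_assoc]
    _ = 1 := by
        rw [hMN, Matrix.mul_one, hD, Matrix.mul_one, ← Matrix.transpose_mul,
          mul_eq_one_comm.1 hMN, Matrix.transpose_one]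

/-! ### Scalar curvature of the left-invariant metrics -/

/-- The second-order jet at the origin of the Gram matrix of a left-invariant metric. -/
theorem hasJet_coordGram (a b : ℝ) (i j : Fin 3) :
    HasJet (fun x => coordGram a b x i j) (if i = j then ![a, a, b] i else 0)
      (fun k => -2⁻¹ * ((![a, a, b] j - ![a, a, b] i) * leviCivita j k i))
      (fun k n => ∑ m, ![a, a, b] m * (4⁻¹ * (leviCivita m k i * leviCivita m n j +
        leviCivita m n i * leviCivita m k j)) -
          if k = n then (if i = j then ![a, a, b] i else 0) else 0) := by
  have hε : ∀ k, leviCivita i k j = -leviCivita j k i := fun k => by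
    fin_cases i <;> fin_cases j <;> fin_cases k <;> simp [leviCivita]
  refine (HasJet.sum fun m => (HasJet.const (![a, a, b] m)).mul
    ((hasJet_maurerCartan m i).mul (hasJet_maurerCartan m j))).congr ?_ (fun k => ?_) fun k n => ?_
  · by_cases h : i = j
    · simp [h]
    · simp only [h, if_false]
      refine Finset.sum_eq_zero fun x _ => ?_
      by_cases hx : x = i
      · simp [hx, h]
      · simp [hx]
  · simp [Finset.sum_add_distrib, mul_add, hε]
    ring
  · by_cases hk : k = n <;> by_cases hij : i = j
    · subst hk hij
      simp [Finset.sum_add_distrib, mul_add]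
      ring_nf
    · subst hk
      simp [Finset.sum_add_distrib, mul_add, hij, Ne.symm hij]
      ring_nf
    · subst hij
      simp [Finset.sum_add_distrib, mul_add, hk]
      ring_nf
    · simp [Finset.sum_add_distrib, mul_add, hk]
      ring_nf

theorem exists_hasJet_coordGram_inv {a b : ℝ} (ha : a ≠ 0) (hb : b ≠ 0) (i j : Fin 3) :
    ∃ q, HasJet (fun x => (coordGram a b x)⁻¹ i j) (if i = j then ![a⁻¹, a⁻¹, b⁻¹] i else 0)
      (fun k => 2⁻¹ * ((![a⁻¹, a⁻¹, b⁻¹] j - ![a⁻¹, a⁻¹, b⁻¹] i) * leviCivita i k j)) q := by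
  have hε : ∀ k, leviCivita j k i = -leviCivita i k j := fun k => by
    fin_cases i <;> fin_cases j <;> fin_cases k <;> simp [leviCivita]
  choose q hq using hasJet_maurerCartanInv
  simp only [coordGram_inv ha hb, Matrix.of_apply]
  refine ⟨_, (HasJet.sum fun m => (HasJet.const (![a⁻¹, a⁻¹, b⁻¹] m)).mul
    ((hq i m).mul (hq j m))).congr ?_ (fun k => ?_) fun _ _ => rfl⟩
  · by_cases h : i = j
    · simp [h]
    · simp only [h, if_false]
      refine Finset.sum_eq_zero fun x _ => ?_
      by_cases hx : i = x
      · simp [← hx, Ne.symm h]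
      · simp [hx]
  · simp [Finset.sum_add_distrib, mul_add, hε]
    ring

/-- The value at the origin of the Christoffel symbols of a metric with diagonal Gram matrix there,
in terms of the first derivatives `g₁ i j k = ∂_k G_{ij}`. -/
theorem christoffel_zero {G : R3 → Matrix (Fin 3) (Fin 3) ℝ} {h₀ : Fin 3 → ℝ}
    {g₁ : Fin 3 → Fin 3 → Fin 3 → ℝ} (hG : ∀ i j k, partialDeriv k (fun x => G x i j) 0 = g₁ i j k)
    (hH : ∀ i j, (G 0)⁻¹ i j = if i = j then h₀ i else 0) (m i j : Fin 3) :
    christoffel G m i j 0 = 2⁻¹ * (h₀ m * (g₁ j m i + g₁ m i j - g₁ i j m)) := by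
  simp [christoffel, hG, hH]

/-- The first derivatives of the Christoffel symbols at the origin, in terms of the jets of the
Gram matrix and of its inverse. -/
theorem partialDeriv_christoffel_zero {G : R3 → Matrix (Fin 3) (Fin 3) ℝ}
    {g₀ : Fin 3 → Fin 3 → ℝ} {g₁ : Fin 3 → Fin 3 → Fin 3 → ℝ}
    {g₂ : Fin 3 → Fin 3 → Fin 3 → Fin 3 → ℝ} {h₀ : Fin 3 → ℝ} {h₁ : Fin 3 → Fin 3 → Fin 3 → ℝ}
    (hG : ∀ i j, HasJet (fun x => G x i j) (g₀ i j) (g₁ i j) (g₂ i j))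
    (hH : ∀ i j, ∃ q, HasJet (fun x => (G x)⁻¹ i j) (if i = j then h₀ i else 0) (h₁ i j) q)
    (n m i j : Fin 3) :
    partialDeriv n (christoffel G m i j) 0 = 2⁻¹ * (∑ k, h₁ k m n *
      (g₁ j k i + g₁ k i j - g₁ i j k) + h₀ m * (g₂ j m n i + g₂ m i n j - g₂ i j n m)) := by
  choose q hq using hH
  have hd : ∀ i j k, ContDiff ℝ ∞ (partialDeriv k fun x => G x i j) := fun i j k =>
    contDiff_partialDeriv (hG i j).smooth k
  have hjet : ∀ i j k, ∃ r, HasJet (partialDeriv k fun x => G x i j) (g₁ i j k)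
      (fun n => g₂ i j n k) r := fun i j k =>
    ⟨_, hd i j k, (hG i j).grad k, fun n => (hG i j).hess n k, fun _ _ => rfl⟩
  choose r hr using hjet
  have hT : ∀ k, HasJet (fun x => partialDeriv i (fun y => G y j k) x +
      partialDeriv j (fun y => G y k i) x + -1 * partialDeriv k (fun y => G y i j) x) _ _ _ :=
    fun k => ((hr j k i).add (hr k i j)).add ((HasJet.const (-1)).mul (hr i j k))
  have hS := (HasJet.const 2⁻¹).mul (HasJet.sum fun k => (hq k m).mul (hT k))
  have h := hS.grad n
  have e : christoffel G m i j = fun x => 2⁻¹ * ∑ k, (G x)⁻¹ k m *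
      (partialDeriv i (fun y => G y j k) x + partialDeriv j (fun y => G y k i) x +
        -1 * partialDeriv k (fun y => G y i j) x) := by
    ext x
    simp only [christoffel]
    congr 1
    refine Finset.sum_congr rfl fun k _ => ?_
    ring
  rw [e, h]
  simp [Finset.sum_add_distrib]
  ring_nf

/-- The scalar curvature of the left-invariant metric `diag(a, a, b)` on `SO(3)`
(a Berger metric). -/
theorem coordScalarCurvature_coordGram {a b : ℝ} (ha : a ≠ 0) (hb : b ≠ 0) :
    coordScalarCurvature (coordGram a b) 0 = 2 / a - b / (2 * a ^ 2) := by
  have hH := exists_hasJet_coordGram_inv ha hb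
  have hG := hasJet_coordGram a b
  have hH0 : ∀ i j, (coordGram a b 0)⁻¹ i j = if i = j then ![a⁻¹, a⁻¹, b⁻¹] i else 0 :=
    fun i j => (hH i j).choose_spec.value
  have hΓ := christoffel_zero (fun i j k => (hG i j).grad k) hH0
  have hΓ' := partialDeriv_christoffel_zero hG hH
  have hR : ∀ i j, riemann (coordGram a b) i j j i 0 = _ := fun i j => by
    simp only [riemann, hΓ, hΓ']
    rfl
  have hsum : coordScalarCurvature (coordGram a b) 0 =
      ∑ i, ∑ j, ![a⁻¹, a⁻¹, b⁻¹] j * riemann (coordGram a b) i j j i 0 := by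
    simp [coordScalarCurvature, hH0]
  rw [hsum]
  simp only [hR]
  simp [Fin.sum_univ_three, leviCivita]
  field_simp
  ring

/-! ### Rotations about the second axis -/

/-- The infinitesimal generator of the rotations about the second axis. -/
def genY (l : ℕ) : RepSpace l →L[ℂ] RepSpace l := repLie l (EuclideanSpace.single 1 1)

theorem rotY_zero : rotY 0 = 1 := by
  apply Subtype.ext
  ext i j
  fin_cases i <;> fin_cases j <;> simp [rotY]

theorem rotY_add (x y : ℝ) : rotY (x + y) = rotY x * rotY y := by
  apply Subtype.ext
  ext i j
  fin_cases i <;> fin_cases j <;>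
    simp [rotY, Real.cos_add, Real.sin_add] <;> ring

/-- The lift to `SU(2)` of a rotation about the second axis. -/
def spinY (x : ℝ) : Matrix (Fin 2) (Fin 2) ℂ :=
  !![(Real.cos (x / 2) : ℂ), -(Real.sin (x / 2) : ℂ);
    (Real.sin (x / 2) : ℂ), (Real.cos (x / 2) : ℂ)]

theorem isSpinLift_spinY (x : ℝ) : IsSpinLift (spinY x) (rotY x) := by
  have hx : x = 2 * (x / 2) := by ring
  have hc : Real.cos x = 2 * Real.cos (x / 2) ^ 2 - 1 := by
    rw [← Real.cos_two_mul, ← hx]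
  have hs : Real.sin x = 2 * Real.sin (x / 2) * Real.cos (x / 2) := by
    rw [← Real.sin_two_mul, ← hx]
  have h := Real.sin_sq_add_cos_sq (x / 2)
  have h' : (Real.sin (x / 2) : ℂ) ^ 2 + (Real.cos (x / 2) : ℂ) ^ 2 = 1 := by exact_mod_cast h
  have hc' : (Real.cos x : ℂ) = 2 * (Real.cos (x / 2) : ℂ) ^ 2 - 1 := by rw [hc]; push_cast; ring
  have hs' : (Real.sin x : ℂ) = 2 * (Real.sin (x / 2) : ℂ) * (Real.cos (x / 2) : ℂ) := by
    rw [hs]; push_cast; ring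
  have hval : (rotY x).1 =
      !![Real.cos x, 0, Real.sin x; 0, 1, 0; -Real.sin x, 0, Real.cos x] := rfl
  rw [IsSpinLift, hval]
  simp only [spinY]
  have hcs : starRingEnd ℂ (Real.cos (x / 2) : ℂ) = Real.cos (x / 2) := Complex.conj_ofReal _
  have hss : starRingEnd ℂ (Real.sin (x / 2) : ℂ) = Real.sin (x / 2) := Complex.conj_ofReal _
  have hI := Complex.I_sq
  clear hx hc hs h hval
  generalize (Real.cos (x / 2) : ℂ) = C at *
  generalize (Real.sin (x / 2) : ℂ) = S at *
  refine ⟨Matrix.mem_specialUnitaryGroup_iff.2 ⟨Matrix.mem_unitaryGroup_iff.2 ?_, ?_⟩, fun j => ?_⟩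
  · ext i j
    fin_cases i <;> fin_cases j <;>
      simp [Matrix.mul_apply, Fin.sum_univ_two, Matrix.star_apply, hcs, hss] <;>
      grind
  · simp [Matrix.det_fin_two]
    grind
  · ext a b
    fin_cases j <;> fin_cases a <;> fin_cases b <;>
      simp [pauli, Matrix.mul_apply, Fin.sum_univ_two, Fin.sum_univ_three, -Complex.ofReal_cos,
        -Complex.ofReal_sin, hcs, hss, hc', hs'] <;> grind

theorem hasDerivAt_spinY (i j : Fin 2) :
    HasDerivAt (fun x => spinY x i j) (spinLie (EuclideanSpace.single 1 1) i j) 0 := by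
  have h : HasDerivAt (fun x : ℝ => x / 2) 2⁻¹ 0 := by
    simpa using (hasDerivAt_id (0 : ℝ)).div_const 2
  have hc : HasDerivAt (fun x : ℝ => (Real.cos (x / 2) : ℂ)) 0 0 := by
    simpa using h.cos.ofReal_comp
  have hs : HasDerivAt (fun x : ℝ => (Real.sin (x / 2) : ℂ)) 2⁻¹ 0 := by
    simpa using h.sin.ofReal_comp
  fin_cases i <;> fin_cases j
  · exact hc.congr_deriv (by simp [spinLie])
  · exact hs.neg.congr_deriv (by simp [spinLie])
  · exact hs.congr_deriv (by simp [spinLie])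
  · exact hc.congr_deriv (by simp [spinLie])

theorem hasDerivAt_rep_rotY (l : ℕ) (b : RepSpace l) (x : ℝ) :
    HasDerivAt (fun x => rep l (rotY x) b) (rep l (rotY x) (genY l b)) x := by
  have h0 : HasDerivAt (fun t => rep l (rotY t) b) (genY l b) 0 := by
    refine hasDerivAt_piLp fun j => ?_
    have h1 : spinY 0 = 1 := by
      ext i j
      fin_cases i <;> fin_cases j <;> simp [spinY]
    simp only [rep_apply_apply, symPow_spinLift l (isSpinLift_spinY _), genY, repLie_apply_apply]
    exact HasDerivAt.fun_sum fun k _ => (hasDerivAt_symPow _ h1 hasDerivAt_spinY j k).mul_const _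
  have h1 : HasDerivAt (fun y => rep l (rotY (y - x)) b) (genY l b) x := by
    have h2 : HasDerivAt (fun t => rep l (rotY t) b) (genY l b) (x - x) := by rwa [sub_self]
    exact h2.comp_sub_const x x
  have h2 := ((rep l (rotY x)).restrictScalars ℝ).hasFDerivAt.comp_hasDerivAt x h1
  refine h2.congr_of_eventuallyEq (.of_forall fun y => ?_)
  have h3 : rotY y = rotY x * rotY (y - x) := by rw [← rotY_add, add_sub_cancel]
  simp only [h3, rep_mul]
  rfl

theorem rep_one (l : ℕ) : rep l 1 = 1 := by
  have h : IsSpinLift 1 1 := by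
    refine ⟨one_mem _, fun j => ?_⟩
    simp [Matrix.one_apply]
  rw [rep, symPow_spinLift l h, symPow_one, map_one]

theorem inner_rep_rep (l : ℕ) (p : SO3) (a b : RepSpace l) :
    inner ℂ (rep l p a) (rep l p b) = inner ℂ a b := by
  have h := LinearMap.norm_map_iff_inner_map_map (𝕜 := ℂ) (rep l p)
  exact h.1 (norm_rep_apply l p) a b

/-- The generator is skew-Hermitian, because rotations act unitarily. -/
theorem inner_genY_left (l : ℕ) (a b : RepSpace l) :
    inner ℂ (genY l a) b = -inner ℂ a (genY l b) := by
  have h1 := (hasDerivAt_rep_rotY l a 0).inner ℂ (hasDerivAt_rep_rotY l b 0)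
  simp only [inner_rep_rep, rotY_zero, rep_one] at h1
  have h2 := h1.unique (hasDerivAt_const 0 _)
  exact eq_neg_of_add_eq_zero_right h2

theorem inner_genY_pow (l n m : ℕ) (a b : RepSpace l) :
    inner ℂ a ((genY l ^ (n + m)) b) = (-1) ^ n * inner ℂ ((genY l ^ n) a) ((genY l ^ m) b) := by
  induction n generalizing a with
  | zero => simp
  | succ n ih =>
    have h : (genY l ^ (n + 1 + m)) b = genY l ((genY l ^ (n + m)) b) := by
      rw [show n + 1 + m = n + m + 1 by ring, pow_succ']
      rfl
    have h2 : (genY l ^ (n + 1)) a = (genY l ^ n) (genY l a) := by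
      rw [pow_succ]
      rfl
    rw [h, h2, pow_succ, mul_assoc, mul_comm (-1 : ℂ), ← mul_assoc, ← ih, inner_genY_left]
    ring

/-- The moments of the generator at a unit vector dominate the powers of the second moment. This
is the log-convexity of the sequence of moments. -/
theorem norm_genY_pow_ge (l n : ℕ) {b : RepSpace l} (hb : ‖b‖ = 1) :
    ‖genY l b‖ ^ n ≤ ‖(genY l ^ n) b‖ := by
  have hlc : ∀ n, ‖(genY l ^ (n + 1)) b‖ ^ 2 ≤ ‖(genY l ^ n) b‖ * ‖(genY l ^ (n + 2)) b‖ := by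
    intro n
    have h1 : (genY l ^ (n + 1)) b = genY l ((genY l ^ n) b) := by
      rw [pow_succ']
      rfl
    have h2 : genY l ((genY l ^ (n + 1)) b) = (genY l ^ (n + 2)) b := by
      rw [pow_succ' _ (n + 1)]
      rfl
    have h3 := inner_genY_left l ((genY l ^ n) b) ((genY l ^ (n + 1)) b)
    rw [← h1, h2, inner_self_eq_norm_sq_to_K] at h3
    have h4 := congrArg norm h3
    rw [norm_neg, norm_pow, RCLike.norm_ofReal, abs_norm] at h4
    rw [h4]
    exact norm_inner_le_norm _ _
  have hstep : ∀ n, ‖genY l b‖ * ‖(genY l ^ n) b‖ ≤ ‖(genY l ^ (n + 1)) b‖ := by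
    intro n
    induction n with
    | zero => simp [hb]
    | succ n ih =>
      rcases (norm_nonneg ((genY l ^ n) b)).eq_or_lt with h0 | h0
      · have h1 : (genY l ^ (n + 1)) b = 0 := by
          rw [pow_succ']
          change genY l ((genY l ^ n) b) = 0
          rw [norm_eq_zero.1 h0.symm, map_zero]
        rw [h1, norm_zero, mul_zero]
        exact norm_nonneg _
      · refine le_of_mul_le_mul_left ?_ h0
        have h2 := hlc n
        nlinarith [mul_le_mul_of_nonneg_right ih (norm_nonneg ((genY l ^ (n + 1)) b))]
  induction n with
  | zero => simp [hb]
  | succ n ih =>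
    rw [pow_succ']
    exact (mul_le_mul_of_nonneg_left ih (norm_nonneg _)).trans (hstep n)

/-! ### The circular covariance -/

/-- The second moment of the generator of the rotations about the second axis, at the unit vector
of weight `s`. -/
def secondMoment (s : ℤ) (l : ℕ) : ℝ := ((l : ℝ) * (l + 1) - (s : ℝ) ^ 2) / 2

theorem abs_le_of_natAbs_le {s : ℤ} {l : ℕ} (h : s.natAbs ≤ l) : |s| ≤ (l : ℤ) := by
  rw [Int.abs_eq_natAbs]
  exact_mod_cast h

/-- The bound that converts moments of the generator into powers of `l`. -/
theorem half_le_secondMoment {s : ℤ} {l : ℕ} (h : s.natAbs ≤ l) :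
    (l : ℝ) / 2 ≤ secondMoment s l := by
  have h1 : |(s : ℝ)| ≤ l := by exact_mod_cast abs_le_of_natAbs_le h
  have h2 : (s : ℝ) ^ 2 ≤ (l : ℝ) ^ 2 := sq_le_sq.2 (by rwa [Nat.abs_cast])
  rw [secondMoment]
  linarith

theorem norm_genY_weightVec_sq {s : ℤ} {l : ℕ} (h : s.natAbs ≤ l) :
    ‖genY l (weightVec l s)‖ ^ 2 = secondMoment s l := by
  rw [genY, norm_repLie_weightVec_sq (abs_le_of_natAbs_le h), secondMoment]
  simp

theorem hasDerivAt_rep_rotY_coord (l : ℕ) (b : RepSpace l) (j : Fin (2 * l + 1)) (x : ℝ) :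
    HasDerivAt (fun x => (rep l (rotY x) b j).re) (rep l (rotY x) (genY l b) j).re x := by
  have h := (EuclideanSpace.proj (𝕜 := ℂ) j : RepSpace l →L[ℂ] ℂ)
    |>.restrictScalars ℝ |>.hasFDerivAt.comp_hasDerivAt x (hasDerivAt_rep_rotY l b x)
  exact Complex.reCLM.hasFDerivAt.comp_hasDerivAt x h

theorem iteratedDeriv_rep_rotY (l n : ℕ) (b : RepSpace l) (j : Fin (2 * l + 1)) :
    iteratedDeriv n (fun x => (rep l (rotY x) b j).re) =
      fun x => (rep l (rotY x) ((genY l ^ n) b) j).re := by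
  induction n with
  | zero => simp
  | succ n ih =>
    rw [iteratedDeriv_succ, ih]
    ext x
    rw [(hasDerivAt_rep_rotY_coord l _ j x).deriv, pow_succ']
    rfl

theorem contDiff_rep_rotY (l : ℕ) (b : RepSpace l) (j : Fin (2 * l + 1)) :
    ContDiff ℝ ∞ fun x => (rep l (rotY x) b j).re :=
  contDiff_of_differentiable_iteratedDeriv fun n _ => by
    rw [iteratedDeriv_rep_rotY]
    exact fun x => (hasDerivAt_rep_rotY_coord l _ j x).differentiableAt

theorem wignerd_eq {s : ℤ} {l : ℕ} (h : s.natAbs ≤ l) :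
    wignerd l s = fun x => (rep l (rotY x) (weightVec l s) (weightIndex l s)).re := by
  ext x
  rw [wignerd, wignerD_eq (abs_le_of_natAbs_le h) (abs_le_of_natAbs_le h)]

/-- The derivatives of even order of `d^l_{s,s}` at `0` are, up to sign, the moments
`‖T^n e_s‖²` of the generator `T`; in particular they have the same sign for all `l`. -/
theorem iteratedDeriv_wignerd_zero {s : ℤ} {l : ℕ} (h : s.natAbs ≤ l) (n : ℕ) :
    iteratedDeriv (2 * n) (wignerd l s) 0 =
      (-1) ^ n * ‖(genY l ^ n) (weightVec l s)‖ ^ 2 := by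
  rw [wignerd_eq h, iteratedDeriv_rep_rotY]
  simp only [rotY_zero, rep_one]
  have h1 : ((genY l ^ (2 * n)) (weightVec l s)) (weightIndex l s) =
      inner ℂ (weightVec l s) ((genY l ^ (n + n)) (weightVec l s)) := by
    rw [two_mul n, weightVec, EuclideanSpace.inner_single_left]
    simp
  change (((genY l ^ (2 * n)) (weightVec l s)) (weightIndex l s)).re = _
  rw [h1, inner_genY_pow, inner_self_eq_norm_sq_to_K]
  have h2 : ((-1 : ℂ) ^ n * (((‖(genY l ^ n) (weightVec l s)‖ : ℝ) : ℂ)) ^ 2) =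
      (((-1) ^ n * ‖(genY l ^ n) (weightVec l s)‖ ^ 2 : ℝ) : ℂ) := by
    push_cast
    ring
  exact (congrArg Complex.re h2).trans (Complex.ofReal_re _)

/-- The derivatives of even order of the circular covariance at `0` can be computed termwise. -/
theorem SmoothlyConvergent.hasSum {s : ℤ} {c : ℕ → ℝ} (hk : SmoothlyConvergent s c) (n : ℕ) :
    HasSum (fun l => if s.natAbs ≤ l then c l ^ 2 * ‖(genY l ^ n) (weightVec l s)‖ ^ 2 else 0)
      ((-1) ^ n * iteratedDeriv (2 * n) (circularCov s c) 0) := by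
  rw [hasSum_iff_tendsto_nat_of_nonneg]
  · have h1 := ((tendstoLocallyUniformlyOn_univ.2 (hk.2 (2 * n))).tendsto_at
      (Set.mem_univ 0)).const_mul ((-1 : ℝ) ^ n)
    refine h1.congr fun N => ?_
    have hs : ∀ l ∈ Finset.range N, ContDiffAt ℝ (2 * n : ℕ)
        (fun x => if s.natAbs ≤ l then c l ^ 2 * wignerd l s x else 0) 0 := by
      intro l _
      split_ifs with h
      · rw [wignerd_eq h]
        exact (contDiff_infty.1 (contDiff_const.mul (contDiff_rep_rotY l _ _)) _).contDiffAt
      · exact contDiffAt_const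
    rw [iteratedDeriv_fun_sum hs, Finset.mul_sum]
    refine Finset.sum_congr rfl fun l _ => ?_
    split_ifs with h
    · have h2 : iteratedDeriv (2 * n) (fun x => c l ^ 2 * wignerd l s x) 0 =
          c l ^ 2 * iteratedDeriv (2 * n) (wignerd l s) 0 := by
        rw [iteratedDeriv_const_mul_field]
      rw [h2, iteratedDeriv_wignerd_zero h]
      have h3 : ((-1 : ℝ) ^ n) * (-1) ^ n = 1 := by rw [← mul_pow]; simp
      linear_combination (c l ^ 2 * ‖(genY l ^ n) (weightVec l s)‖ ^ 2) * h3
    · simp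
  · intro l
    split_ifs <;> positivity

/-- The smooth convergence of the circular covariance forces the coefficients to decay faster than
any power. -/
theorem SmoothlyConvergent.summable {s : ℤ} {c : ℕ → ℝ} (hk : SmoothlyConvergent s c) (n : ℕ) :
    Summable fun l : ℕ => if s.natAbs ≤ l then c l ^ 2 * (l : ℝ) ^ n else 0 := by
  refine Summable.of_nonneg_of_le (fun l => ?_) (fun l => ?_)
    ((hk.hasSum n).summable.mul_left (2 ^ n))
  · split_ifs <;> positivity
  · split_ifs with h
    · have h1 := norm_genY_pow_ge l n (norm_weightVec l s)
      have h2 : (l : ℝ) ^ n ≤ 2 ^ n * ‖(genY l ^ n) (weightVec l s)‖ ^ 2 := by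
        calc (l : ℝ) ^ n = 2 ^ n * ((l : ℝ) / 2) ^ n := by rw [← mul_pow]; congr 1; ring
          _ ≤ 2 ^ n * (secondMoment s l) ^ n := by
              gcongr
              exact half_le_secondMoment h
          _ = 2 ^ n * (‖genY l (weightVec l s)‖ ^ n) ^ 2 := by
              rw [← norm_genY_weightVec_sq h, ← pow_mul, ← pow_mul, mul_comm 2 n]
          _ ≤ _ := by gcongr
      calc c l ^ 2 * (l : ℝ) ^ n ≤ c l ^ 2 * (2 ^ n * ‖(genY l ^ n) (weightVec l s)‖ ^ 2) := by
            gcongr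
        _ = _ := by ring
    · simp

/-- The second derivative of the circular covariance at `0` gives the variance `ξ²`. -/
theorem SmoothlyConvergent.hasSum_secondMoment {s : ℤ} {c : ℕ → ℝ} (hk : SmoothlyConvergent s c) :
    HasSum (fun l => if s.natAbs ≤ l then c l ^ 2 / 2 * secondMoment s l else 0)
      (-iteratedDeriv 2 (circularCov s c) 0 / 2) := by
  have h := (hk.hasSum 1).div_const 2
  have e : (fun l => if s.natAbs ≤ l then c l ^ 2 / 2 * secondMoment s l else 0) = fun l =>
      (if s.natAbs ≤ l then c l ^ 2 * ‖(genY l ^ 1) (weightVec l s)‖ ^ 2 else 0) / 2 := by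
    ext l
    split_ifs with hl
    · rw [pow_one, norm_genY_weightVec_sq hl]
      ring
    · simp
  rw [e]
  simpa using h

/-! ### Smooth series of matrix coefficients -/

/-- A cutoff of the identity of `ℝ³` near the origin. -/
def cutoff (v : R3) : R3 := (default : ContDiffBump (0 : R3)) v • v

theorem contDiff_cutoff : ContDiff ℝ ∞ cutoff :=
  (default : ContDiffBump (0 : R3)).contDiff.smul contDiff_id

theorem hasCompactSupport_cutoff : HasCompactSupport cutoff :=
  (default : ContDiffBump (0 : R3)).hasCompactSupport.smul_right

theorem cutoff_eventuallyEq : ∀ᶠ v in 𝓝 0, cutoff v = v := by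
  filter_upwards [(default : ContDiffBump (0 : R3)).eventuallyEq_one] with v hv
  rw [cutoff, hv]
  simp

/-- The pull-back of the Maurer-Cartan form by the cutoff. -/
def cutoffForm (v : R3) : R3 →L[ℝ] R3 := maurerCartan (cutoff v) ∘L fderiv ℝ cutoff v

theorem contDiff_cutoffForm_coord (k : Fin 3) :
    ContDiff ℝ ∞ fun v => (EuclideanSpace.proj k : R3 →L[ℝ] ℝ) ∘L cutoffForm v :=
  contDiff_const.clm_comp ((contDiff_maurerCartan.comp contDiff_cutoff).clm_comp
    (contDiff_cutoff.fderiv_right (by simp)))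

theorem exists_bound_cutoffForm (n : ℕ) : ∃ C, 0 ≤ C ∧ ∀ k v,
    ‖iteratedFDeriv ℝ n (fun v => (EuclideanSpace.proj k : R3 →L[ℝ] ℝ) ∘L cutoffForm v) v‖ ≤ C := by
  have h : ∀ k, ∃ C, ∀ v, ‖iteratedFDeriv ℝ n
      (fun v => (EuclideanSpace.proj k : R3 →L[ℝ] ℝ) ∘L cutoffForm v) v‖ ≤ C := by
    intro k
    have hc : HasCompactSupport
        fun v => (EuclideanSpace.proj k : R3 →L[ℝ] ℝ) ∘L cutoffForm v := by
      refine (hasCompactSupport_cutoff.fderiv ℝ).mono' fun v hv => ?_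
      refine subset_closure fun h0 => hv ?_
      simp [cutoffForm, h0]
    exact (hc.iteratedFDeriv n).exists_bound_of_continuous
      ((contDiff_cutoffForm_coord k).continuous_iteratedFDeriv (by exact_mod_cast le_top))
  choose C hC using h
  refine ⟨∑ k, |C k|, by positivity, fun k v => (hC k v).trans ((le_abs_self _).trans ?_)⟩
  exact Finset.single_le_sum (f := fun k => |C k|) (fun _ _ => abs_nonneg _) (Finset.mem_univ k)

theorem contDiff_rep_cutoff (l : ℕ) (p : SO3) (b : RepSpace l) :
    ContDiff ℝ ∞ fun v => rep l (p * cayley (cutoff v)) b :=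
  (contDiff_rep_mul_cayley l p b).comp contDiff_cutoff

theorem repLie_eq_sum (l : ℕ) (u : R3) (b : RepSpace l) :
    repLie l u b = ∑ k, u k • repLie l (EuclideanSpace.single k 1) b := by
  have hu : u = ∑ k, u k • EuclideanSpace.single k (1 : ℝ) := by
    ext j
    simp [Finset.sum_apply, Pi.single_apply]
  simp only [← fderiv_rep_cayley_zero]
  conv_lhs => rw [hu, map_sum]
  simp only [map_smul]

theorem fderiv_rep_cutoff (l : ℕ) (p : SO3) (b : RepSpace l) :
    fderiv ℝ (fun v => rep l (p * cayley (cutoff v)) b) = fun v =>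
      ∑ k, ContinuousLinearMap.smulRightL ℝ R3 (RepSpace l)
        ((EuclideanSpace.proj k : R3 →L[ℝ] ℝ) ∘L cutoffForm v)
        (rep l (p * cayley (cutoff v)) (repLie l (EuclideanSpace.single k 1) b)) := by
  ext1 v
  have h1 := ((contDiff_rep_mul_cayley l p b).differentiable (by simp)
    (cutoff v)).hasFDerivAt.comp v (contDiff_cutoff.differentiable (by simp) v).hasFDerivAt
  refine h1.fderiv.trans ?_
  ext1 u
  rw [ContinuousLinearMap.comp_apply, fderiv_rep_mul_cayley, repLie_eq_sum, map_sum, sum_apply]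
  refine Finset.sum_congr rfl fun k _ => ?_
  exact ((rep l (p * cayley (cutoff v))).restrictScalars ℝ).map_smul _ _

/-- The derivatives of all orders of the matrix coefficients grow at most polynomially with the
dimension of the representation, uniformly near every point. -/
theorem exists_bound_iteratedFDeriv_rep (n : ℕ) : ∃ K : ℝ, 0 ≤ K ∧
    ∀ (l : ℕ) (p : SO3) (b : RepSpace l) (v : R3),
      ‖iteratedFDeriv ℝ n (fun v => rep l (p * cayley (cutoff v)) b) v‖ ≤
        K * (2 * l + 1 : ℝ) ^ (2 * n) * ‖b‖ := by
  induction n using Nat.strong_induction_on with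
  | _ n ih =>
    rcases n with _ | n
    · refine ⟨1, zero_le_one, fun l p b v => ?_⟩
      rw [norm_iteratedFDeriv_zero, norm_rep_apply]
      simp
    choose! K hK0 hK using ih
    choose W hW0 hW using exists_bound_cutoffForm
    refine ⟨∑ k : Fin 3, ∑ i ∈ Finset.range (n + 1), (n.choose i : ℝ) * W i * K (n - i),
      Finset.sum_nonneg fun k _ => Finset.sum_nonneg fun i hi =>
        mul_nonneg (mul_nonneg (Nat.cast_nonneg _) (hW0 i))
          (hK0 _ (by have := Finset.mem_range.1 hi; omega)), fun l p b v => ?_⟩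
    have hsm : ∀ k, ContDiff ℝ ∞ fun v => ContinuousLinearMap.smulRightL ℝ R3 (RepSpace l)
        ((EuclideanSpace.proj k : R3 →L[ℝ] ℝ) ∘L cutoffForm v)
        (rep l (p * cayley (cutoff v)) (repLie l (EuclideanSpace.single k 1) b)) := fun k =>
      ((ContinuousLinearMap.contDiff _).comp (contDiff_cutoffForm_coord k)).clm_apply
        (contDiff_rep_cutoff l p _)
    rw [← norm_iteratedFDeriv_fderiv, fderiv_rep_cutoff,
      iteratedFDeriv_fun_sum_apply fun k _ => (contDiff_infty.1 (hsm k) n).contDiffAt]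
    refine (norm_sum_le _ _).trans ?_
    rw [Finset.sum_mul, Finset.sum_mul]
    refine Finset.sum_le_sum fun k _ => ?_
    refine (ContinuousLinearMap.norm_iteratedFDeriv_le_of_bilinear_of_le_one
      (ContinuousLinearMap.smulRightL ℝ R3 (RepSpace l)) (contDiff_cutoffForm_coord k)
      (contDiff_rep_cutoff l p _) v (n := n) (by exact_mod_cast le_top)
      ContinuousLinearMap.norm_smulRightL_le).trans ?_
    rw [Finset.sum_mul, Finset.sum_mul]
    refine Finset.sum_le_sum fun i hi => ?_
    have hi' := Finset.mem_range.1 hi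
    have h1 : (1 : ℝ) ≤ 2 * l + 1 := by
      have : (0 : ℝ) ≤ l := Nat.cast_nonneg l
      linarith
    have hKn := hK0 (n - i) (by omega)
    have h2 := norm_repLie_apply_le l (EuclideanSpace.single k 1) b
    have h3 : ‖(EuclideanSpace.single k 1 : R3)‖ = 1 := by simp
    rw [h3, mul_one] at h2
    calc (n.choose i : ℝ) * ‖iteratedFDeriv ℝ i
            (fun v => (EuclideanSpace.proj k : R3 →L[ℝ] ℝ) ∘L cutoffForm v) v‖ *
          ‖iteratedFDeriv ℝ (n - i) (fun v => rep l (p * cayley (cutoff v))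
            (repLie l (EuclideanSpace.single k 1) b)) v‖
        ≤ (n.choose i : ℝ) * W i * (K (n - i) * (2 * l + 1 : ℝ) ^ (2 * n) *
            ((2 * l + 1 : ℝ) ^ 2 * ‖b‖)) := by
          refine mul_le_mul (mul_le_mul_of_nonneg_left (hW i k v) (Nat.cast_nonneg _)) ?_
            (norm_nonneg _) (mul_nonneg (Nat.cast_nonneg _) (hW0 i))
          refine (hK (n - i) (by omega) l p _ v).trans ?_
          refine mul_le_mul (mul_le_mul_of_nonneg_left (pow_le_pow_right₀ h1 (by omega)) hKn) h2
            (norm_nonneg _) (mul_nonneg hKn (by positivity))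
      _ = (n.choose i : ℝ) * W i * K (n - i) * (2 * l + 1 : ℝ) ^ (2 * (n + 1)) * ‖b‖ := by
          rw [show 2 * (n + 1) = 2 * n + 2 by ring, pow_add]
          ring

section Series

variable {ζ : ∀ l, RepSpace l →L[ℂ] ℂ} {b : ∀ l, RepSpace l}

theorem summable_coeff (hb : ∀ l, ‖b l‖ ≤ 1) (hζ : Summable fun l => ‖ζ l‖) (p : SO3) :
    Summable fun l => ζ l (rep l p (b l)) := by
  refine Summable.of_norm_bounded hζ fun l => ((ζ l).le_opNorm _).trans ?_
  rw [norm_rep_apply]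
  exact mul_le_of_le_one_right (norm_nonneg _) (hb l)

theorem norm_iteratedFDeriv_coeff_le (n l : ℕ) (p : SO3) {K : ℝ} (hb : ‖b l‖ ≤ 1) (hK0 : 0 ≤ K)
    (hK : ∀ v, ‖iteratedFDeriv ℝ n (fun v => rep l (p * cayley (cutoff v)) (b l)) v‖ ≤
      K * (2 * l + 1 : ℝ) ^ (2 * n) * ‖b l‖) (v : R3) :
    ‖iteratedFDeriv ℝ n (fun v => ζ l (rep l (p * cayley (cutoff v)) (b l))) v‖ ≤
      K * ((2 * l + 1 : ℝ) ^ (2 * n) * ‖ζ l‖) := by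
  have h := ((ζ l).restrictScalars ℝ).norm_iteratedFDeriv_comp_left
    (x := v) (contDiff_rep_cutoff l p (b l)).contDiffAt (n := n) (by exact_mod_cast le_top)
  refine h.trans ?_
  rw [ContinuousLinearMap.norm_restrictScalars]
  calc ‖ζ l‖ * ‖iteratedFDeriv ℝ n (fun v => rep l (p * cayley (cutoff v)) (b l)) v‖
      ≤ ‖ζ l‖ * (K * (2 * l + 1 : ℝ) ^ (2 * n) * 1) := by
        refine mul_le_mul_of_nonneg_left ((hK v).trans ?_) (norm_nonneg _)
        exact mul_le_mul_of_nonneg_left hb (by positivity)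
    _ = _ := by ring

theorem contDiff_tsum_coeff (hb : ∀ l, ‖b l‖ ≤ 1)
    (hζ : ∀ n : ℕ, Summable fun l : ℕ => (2 * l + 1 : ℝ) ^ n * ‖ζ l‖) (p : SO3) :
    ContDiff ℝ ∞ fun v => ∑' l, ζ l (rep l (p * cayley (cutoff v)) (b l)) := by
  choose K hK0 hK using exists_bound_iteratedFDeriv_rep
  refine contDiff_tsum (v := fun (n l : ℕ) => K n * ((2 * l + 1 : ℝ) ^ (2 * n) * ‖ζ l‖))
    (fun l => ((ζ l).restrictScalars ℝ).contDiff.comp (contDiff_rep_cutoff l p (b l)))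
    (fun n _ => (hζ (2 * n)).mul_left _) fun n l v _ =>
      norm_iteratedFDeriv_coeff_le n l p (hb l) (hK0 n) (hK n l p (b l)) v

/-- A series of matrix coefficients with rapidly decaying coefficients can be differentiated
termwise. -/
theorem hasSum_fderiv_coeff (hb : ∀ l, ‖b l‖ ≤ 1)
    (hζ : ∀ n : ℕ, Summable fun l : ℕ => (2 * l + 1 : ℝ) ^ n * ‖ζ l‖) (p : SO3) (u : R3) :
    HasSum (fun l => ζ l (rep l p (repLie l u (b l))))
      (fderiv ℝ (fun v => ∑' l, ζ l (rep l (p * cayley (cutoff v)) (b l))) 0 u) := by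
  choose K hK0 hK using exists_bound_iteratedFDeriv_rep
  have hsum := (hζ (2 * 1)).mul_left (K 1)
  have hζ0 : Summable fun l => ‖ζ l‖ := by simpa using hζ 0
  have hd : ∀ l, ContDiff ℝ ∞ fun v => ζ l (rep l (p * cayley (cutoff v)) (b l)) := fun l =>
    ((ζ l).restrictScalars ℝ).contDiff.comp (contDiff_rep_cutoff l p (b l))
  have hbound : ∀ l v, ‖fderiv ℝ (fun v => ζ l (rep l (p * cayley (cutoff v)) (b l))) v‖ ≤
      K 1 * ((2 * l + 1 : ℝ) ^ (2 * 1) * ‖ζ l‖) := fun l v => by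
    have h := norm_iteratedFDeriv_coeff_le (ζ := ζ) 1 l p (hb l) (hK0 1) (hK 1 l p (b l)) v
    rwa [norm_iteratedFDeriv_one] at h
  have h1 : HasFDerivAt (fun v => ∑' l, ζ l (rep l (p * cayley (cutoff v)) (b l)))
      (∑' l, fderiv ℝ (fun v => ζ l (rep l (p * cayley (cutoff v)) (b l))) 0) 0 :=
    hasFDerivAt_tsum hsum (fun l v => ((hd l).differentiable (by simp) v).hasFDerivAt) hbound
      (x₀ := 0) (summable_coeff hb hζ0 _) 0
  have h2 : Summable fun l => fderiv ℝ (fun v => ζ l (rep l (p * cayley (cutoff v)) (b l))) 0 :=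
    Summable.of_norm_bounded hsum fun l => hbound l 0
  rw [h1.fderiv]
  have h3 := h2.hasSum.mapL (ContinuousLinearMap.apply ℝ ℂ u)
  have e : (fun l => ζ l (rep l p (repLie l u (b l)))) = fun l => ContinuousLinearMap.apply ℝ ℂ u
      (fderiv ℝ (fun v => ζ l (rep l (p * cayley (cutoff v)) (b l))) 0) := by
    ext1 l
    have h4 : fderiv ℝ (fun v => ζ l (rep l (p * cayley (cutoff v)) (b l))) 0 =
        fderiv ℝ (fun v => ζ l (rep l (p * cayley v) (b l))) 0 := by
      refine Filter.EventuallyEq.fderiv_eq ?_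
      filter_upwards [cutoff_eventuallyEq] with v hv
      rw [hv]
    have h5 := ((ζ l).restrictScalars ℝ).hasFDerivAt.comp (0 : R3)
      ((contDiff_rep_mul_cayley l p (b l)).differentiable (by simp) 0).hasFDerivAt
    have h6 : fderiv ℝ (fun v => ζ l (rep l (p * cayley v) (b l))) 0 u =
        ζ l (fderiv ℝ (fun v => rep l (p * cayley v) (b l)) 0 u) :=
      congrArg (fun L : R3 →L[ℝ] ℂ => L u) h5.fderiv
    rw [fderiv_rep_mul_cayley, cayley_zero, mul_one, maurerCartan_zero] at h6
    rw [ContinuousLinearMap.apply_apply, h4, h6]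
    rfl
  rw [e]
  exact h3

theorem contMDiff_tsum_coeff (hb : ∀ l, ‖b l‖ ≤ 1)
    (hζ : ∀ n : ℕ, Summable fun l : ℕ => (2 * l + 1 : ℝ) ^ n * ‖ζ l‖) :
    ContMDiff (𝓡 3) 𝓘(ℝ, ℝ) ∞ fun p : SO3 => (∑' l, ζ l (rep l p (b l))).re := by
  intro p
  refine contMDiffAt_of_contDiffAt ?_
  have h := Complex.reCLM.contDiff.comp (contDiff_tsum_coeff hb hζ p)
  refine h.contDiffAt.congr_of_eventuallyEq ?_
  filter_upwards [cutoff_eventuallyEq] with v hv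
  simp [hv]

theorem hasSum_tangentDiff_coeff (hb : ∀ l, ‖b l‖ ≤ 1)
    (hζ : ∀ n : ℕ, Summable fun l : ℕ => (2 * l + 1 : ℝ) ^ n * ‖ζ l‖) (p : SO3) (u : R3) :
    HasSum (fun l => (ζ l (rep l p (repLie l u (b l)))).re)
      (tangentDiff (fun p => (∑' l, ζ l (rep l p (b l))).re) p u) := by
  have h1 := ((contDiff_tsum_coeff hb hζ p).differentiable (by simp) 0).hasFDerivAt
  have h2 := Complex.reCLM.hasFDerivAt.comp (0 : R3) h1
  have h3 := tangentDiff_eq (h := fun p => (∑' l, ζ l (rep l p (b l))).re) (p := p)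
    (h2.congr_of_eventuallyEq (by
      filter_upwards [cutoff_eventuallyEq] with v hv
      simp [hv])) u
  rw [h3]
  exact (hasSum_fderiv_coeff hb hζ p u).mapL Complex.reCLM

end Series

/-! ### Series of independent complex Gaussian variables -/

section GaussianSeries

variable {Ω : Type*} [MeasurableSpace Ω] {P : Measure Ω}

/-- The real part of a multiple of a standard complex Gaussian variable is Gaussian. -/
theorem hasLaw_re_mul {g : Ω → ℂ} (hg : HasLaw g complexGaussian P) (z : ℂ) :
    HasLaw (fun w => (g w * z).re) (gaussianReal 0 (‖z‖ ^ 2 / 2).toNNReal) P := by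
  have hm : Measurable fun x : ℝ × ℝ => (⟨x.1, x.2⟩ : ℂ) :=
    Complex.measurableEquivRealProd.symm.measurable
  refine HasLaw.comp_of_hasLaw_comp (f := fun g : ℂ => (g * z).re) (by fun_prop)
    (⟨hm.aemeasurable, rfl⟩ : HasLaw (fun x : ℝ × ℝ => (⟨x.1, x.2⟩ : ℂ)) complexGaussian
      ((gaussianReal 0 2⁻¹).prod (gaussianReal 0 2⁻¹))) hg ?_
  have h1 : HasLaw (fun x : ℝ × ℝ => x.1) (gaussianReal 0 2⁻¹)
      ((gaussianReal 0 2⁻¹).prod (gaussianReal 0 2⁻¹)) := measurePreserving_fst.hasLaw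
  have h2 : HasLaw (fun x : ℝ × ℝ => x.2) (gaussianReal 0 2⁻¹)
      ((gaussianReal 0 2⁻¹).prod (gaussianReal 0 2⁻¹)) := measurePreserving_snd.hasLaw
  have hi := indepFun_prod (X := fun x : ℝ => x * z.re) (Y := fun x : ℝ => x * -z.im)
    (μ := gaussianReal 0 2⁻¹) (ν := gaussianReal 0 2⁻¹) (by fun_prop) (by fun_prop)
  have h3 := gaussianReal_add_gaussianReal_of_indepFun hi
    (gaussianReal_mul_const h1 z.re).map_eq (gaussianReal_mul_const h2 (-z.im)).map_eq
  refine ⟨by fun_prop, ?_⟩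
  have e : (fun x : ℝ × ℝ => ((⟨x.1, x.2⟩ : ℂ) * z).re) =
      (fun x : ℝ × ℝ => x.1 * z.re) + fun x : ℝ × ℝ => x.2 * -z.im := by
    ext x
    simp [Complex.mul_re, sub_eq_add_neg]
  rw [e, h3]
  congr 1
  · simp
  · ext
    rw [Real.coe_toNNReal _ (by positivity), Complex.sq_norm, Complex.normSq_apply]
    simp only [NNReal.coe_add, NNReal.coe_mul, NNReal.coe_mk, NNReal.coe_inv, NNReal.coe_ofNat]
    ring

theorem integrable_norm_of_hasLaw_complexGaussian {g : Ω → ℂ} (hg : HasLaw g complexGaussian P) :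
    Integrable (fun w => ‖g w‖) P := by
  have h1 := (hasLaw_re_mul hg 1).hasGaussianLaw.integrable
  have h2 := (hasLaw_re_mul hg Complex.I).hasGaussianLaw.integrable
  refine (h1.norm.add h2.norm).mono' hg.aemeasurable.norm.aestronglyMeasurable
    (Filter.Eventually.of_forall fun w => ?_)
  have h := Complex.norm_le_abs_re_add_abs_im (g w)
  simpa using h

/-- The mean absolute value of a standard complex Gaussian variable. -/
def complexGaussianMean : ℝ := ∫ z, ‖z‖ ∂complexGaussian

theorem integral_norm_of_hasLaw_complexGaussian {g : Ω → ℂ} (hg : HasLaw g complexGaussian P) :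
    ∫ w, ‖g w‖ ∂P = complexGaussianMean := by
  rw [complexGaussianMean, ← hg.map_eq, integral_map hg.aemeasurable (by fun_prop)]

/-- A series of functions whose `L¹` norms are summable converges almost everywhere. -/
theorem ae_summable_of_summable_integral_norm {F : ℕ → Ω → ℝ} (hF : ∀ l, Integrable (F l) P)
    (hs : Summable fun l => ∫ w, ‖F l w‖ ∂P) : ∀ᵐ w ∂P, Summable fun l => F l w := by
  have h1 : ∫⁻ w, ∑' l, ‖F l w‖ₑ ∂P ≠ ⊤ := by
    rw [lintegral_tsum fun l => (hF l).1.enorm]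
    simp only [← ofReal_integral_norm_eq_lintegral_enorm (hF _)]
    exact hs.tsum_ofReal_ne_top
  filter_upwards [ae_lt_top' (AEMeasurable.tsum fun l => (hF l).1.enorm) h1] with w hw
  exact Summable.of_norm (NNReal.summable_coe.2 (ENNReal.tsum_coe_ne_top_iff_summable.1 hw.ne))

variable {s : ℤ} {γ : ℕ → ℤ → Ω → ℂ}

theorem IsComplexGaussianFamily.hasLaw (hγ : IsComplexGaussianFamily P s γ) {l : ℕ} {m : ℤ}
    (hl : s.natAbs ≤ l) (hm : m ∈ Finset.Icc (-(l : ℤ)) l) : HasLaw (γ l m) complexGaussian P :=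
  hγ.1 ⟨(l, m), hl, abs_le.2 (Finset.mem_Icc.1 hm)⟩

/-- The indices `(l, m)` of the Gaussian variables with `l < N`. -/
def spinIndexFinset (s : ℤ) (N : ℕ) : Finset (SpinIndex s) :=
  (Finset.range N ×ˢ Finset.Icc (-(N : ℤ)) N).subtype fun i : ℕ × ℤ =>
    s.natAbs ≤ i.1 ∧ |i.2| ≤ i.1

theorem sum_spinIndexFinset {E : Type*} [AddCommMonoid E] (F : ℕ → ℤ → E) (N : ℕ) :
    ∑ i ∈ spinIndexFinset s N, F i.1.1 i.1.2 =
      ∑ l ∈ Finset.range N,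
        if s.natAbs ≤ l then ∑ m ∈ Finset.Icc (-(l : ℤ)) l, F l m else 0 := by
  rw [spinIndexFinset, Finset.sum_subtype_eq_sum_filter (f := fun i : ℕ × ℤ => F i.1 i.2),
    Finset.sum_filter, Finset.sum_product]
  refine Finset.sum_congr rfl fun l hl => ?_
  have hl' := Finset.mem_range.1 hl
  split_ifs with h
  · rw [← Finset.sum_filter]
    refine Finset.sum_congr ?_ fun _ _ => rfl
    ext m
    simp only [Finset.mem_filter, Finset.mem_Icc, abs_le]
    constructor
    · exact fun h => h.2.2
    · exact fun h' => ⟨⟨by omega, by omega⟩, h, h'⟩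
  · exact Finset.sum_eq_zero fun m _ => if_neg fun h' => h h'.1

/-- Finite sums of independent centred Gaussian variables are centred Gaussian. -/
theorem IsComplexGaussianFamily.hasLaw_sum [IsProbabilityMeasure P]
    (hγ : IsComplexGaussianFamily P s γ)
    (z : ℕ → ℤ → ℂ) (S : Finset (SpinIndex s)) :
    HasLaw (∑ i ∈ S, fun w => (γ i.1.1 i.1.2 w * z i.1.1 i.1.2).re)
      (gaussianReal 0 (∑ i ∈ S, ‖z i.1.1 i.1.2‖ ^ 2 / 2).toNNReal) P := by
  classical
  have hm : ∀ i : SpinIndex s, HasLaw (fun w => (γ i.1.1 i.1.2 w * z i.1.1 i.1.2).re) _ P :=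
    fun i => hasLaw_re_mul (hγ.1 i) _
  have hind : iIndepFun (fun (i : SpinIndex s) w => (γ i.1.1 i.1.2 w * z i.1.1 i.1.2).re) P :=
    hγ.2.comp (fun i g => (g * z i.1.1 i.1.2).re) fun i => by fun_prop
  induction S using Finset.induction_on with
  | empty =>
    simp only [Finset.sum_empty, Real.toNNReal_zero, gaussianReal_zero_var]
    refine ⟨aemeasurable_const, ?_⟩
    change P.map (fun _ => (0 : ℝ)) = _
    simp
  | insert i S hi ih =>
    refine ⟨Finset.aemeasurable_sum _ fun i _ => (hm i).aemeasurable, ?_⟩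
    have h := gaussianReal_add_gaussianReal_of_indepFun
      (hind.indepFun_finsetSum_of_notMem₀ (fun i => (hm i).aemeasurable) hi) ih.map_eq
      (hm i).map_eq
    rw [Finset.sum_insert hi, add_comm, h, Finset.sum_insert hi, add_comm (‖_‖ ^ 2 / 2),
      Real.toNNReal_add (Finset.sum_nonneg fun _ _ => by positivity) (by positivity), add_zero]

/-- An almost surely convergent series of independent centred Gaussian variables is a centred
Gaussian variable, and its variance is the sum of the variances. -/
theorem IsComplexGaussianFamily.hasLaw_of_hasSum [IsProbabilityMeasure P]
    (hγ : IsComplexGaussianFamily P s γ)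
    {z : ℕ → ℤ → ℂ} {X : Ω → ℝ} {v : ℝ}
    (hv : HasSum (fun l : ℕ => if s.natAbs ≤ l then
      ∑ m ∈ Finset.Icc (-(l : ℤ)) l, ‖z l m‖ ^ 2 / 2 else 0) v)
    (hX : ∀ᵐ w ∂P, HasSum (fun l : ℕ => if s.natAbs ≤ l then
      ∑ m ∈ Finset.Icc (-(l : ℤ)) l, (γ l m w * z l m).re else 0) (X w)) :
    HasLaw X (gaussianReal 0 v.toNNReal) P := by
  set T : ℕ → Ω → ℝ := fun N w => ∑ l ∈ Finset.range N, if s.natAbs ≤ l then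
    ∑ m ∈ Finset.Icc (-(l : ℤ)) l, (γ l m w * z l m).re else 0 with hT
  set V : ℕ → ℝ := fun N => ∑ l ∈ Finset.range N, if s.natAbs ≤ l then
    ∑ m ∈ Finset.Icc (-(l : ℤ)) l, ‖z l m‖ ^ 2 / 2 else 0 with hV
  have hV0 : ∀ N, 0 ≤ V N := fun N => Finset.sum_nonneg fun l _ => by
    split_ifs
    · positivity
    · exact le_rfl
  have hv0 : 0 ≤ v := ge_of_tendsto' hv.tendsto_sum_nat hV0
  have hlaw : ∀ N, HasLaw (T N) (gaussianReal 0 (V N).toNNReal) P := by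
    intro N
    have h := hγ.hasLaw_sum z (spinIndexFinset s N)
    rw [sum_spinIndexFinset (fun l m => ‖z l m‖ ^ 2 / 2)] at h
    have e : (∑ i ∈ spinIndexFinset s N, fun w => (γ i.1.1 i.1.2 w * z i.1.1 i.1.2).re) = T N := by
      ext w
      rw [Finset.sum_apply]
      exact sum_spinIndexFinset (fun l m => (γ l m w * z l m).re) N
    rwa [e] at h
  have hlim : ∀ᵐ w ∂P, Filter.Tendsto (fun N => T N w) Filter.atTop (𝓝 (X w)) := by
    filter_upwards [hX] with w hw using hw.tendsto_sum_nat
  have hXm : AEMeasurable X P :=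
    aemeasurable_of_tendsto_metrizable_ae _ (fun N => (hlaw N).aemeasurable) hlim
  refine ⟨hXm, ?_⟩
  have := Measure.isProbabilityMeasure_map hXm
  refine Measure.ext_of_charFun ?_
  ext t
  have h1 : ∀ N, ∫ w, Complex.exp (t * T N w * Complex.I) ∂P =
      Complex.exp (-(V N) * t ^ 2 / 2) := by
    intro N
    have h := charFun_gaussianReal (μ := 0) (v := (V N).toNNReal) t
    rw [← (hlaw N).map_eq, charFun_apply_real,
      integral_map (hlaw N).aemeasurable (by fun_prop)] at h
    rw [h, Real.coe_toNNReal _ (hV0 N)]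
    congr 1
    simp
    ring
  have h2 : Filter.Tendsto (fun N => ∫ w, Complex.exp (t * T N w * Complex.I) ∂P) Filter.atTop
      (𝓝 (∫ w, Complex.exp (t * X w * Complex.I) ∂P)) := by
    refine tendsto_integral_of_dominated_convergence (fun _ => 1) (fun N => ?_)
      (integrable_const _) (fun N => Filter.Eventually.of_forall fun w => ?_) ?_
    · have := (hlaw N).aemeasurable
      exact AEMeasurable.aestronglyMeasurable (by fun_prop)
    · rw [← Complex.ofReal_mul, Complex.norm_exp_ofReal_mul_I]
    · filter_upwards [hlim] with w hw
      have hc : Continuous fun x : ℝ => Complex.exp (t * x * Complex.I) := by fun_prop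
      exact (hc.tendsto _).comp hw
  have h3 : Filter.Tendsto (fun N => Complex.exp (-(V N) * t ^ 2 / 2)) Filter.atTop
      (𝓝 (Complex.exp (-v * t ^ 2 / 2))) := by
    have hc : Continuous fun x : ℝ => Complex.exp (-x * t ^ 2 / 2) := by fun_prop
    exact (hc.tendsto _).comp hv.tendsto_sum_nat
  rw [charFun_apply_real, integral_map hXm (by fun_prop), charFun_gaussianReal,
    Real.coe_toNNReal _ hv0, tendsto_nhds_unique h2 (by simpa only [h1] using h3)]
  congr 1
  simp
  ring

/-- If the coefficients decay rapidly, then so do their products with Gaussian variables. -/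
theorem IsComplexGaussianFamily.ae_summable (hγ : IsComplexGaussianFamily P s γ) {a : ℕ → ℝ}
    (ha : ∀ n : ℕ, Summable fun l : ℕ => if s.natAbs ≤ l then a l ^ 2 * (l : ℝ) ^ n else 0) :
    ∀ᵐ w ∂P, ∀ n : ℕ, Summable fun l : ℕ => if s.natAbs ≤ l then (2 * l + 1 : ℝ) ^ n *
      (|a l| * ∑ m ∈ Finset.Icc (-(l : ℤ)) l, ‖γ l m w‖) else 0 := by
  rw [ae_all_iff]
  intro n
  have hcard : ∀ l : ℕ, ((Finset.Icc (-(l : ℤ)) l).card : ℝ) = 2 * l + 1 := fun l => by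
    rw [Int.card_Icc, show ((l : ℤ) + 1 - -(l : ℤ)).toNat = 2 * l + 1 by omega]
    push_cast
    rfl
  refine ae_summable_of_summable_integral_norm (fun l => ?_) ?_
  · split_ifs with h
    · exact ((integrable_finsetSum _ fun m hm =>
        integrable_norm_of_hasLaw_complexGaussian (hγ.hasLaw h hm)).const_mul _).const_mul _
    · exact integrable_zero _ _ _
  · have hE : ∀ l : ℕ, ∫ w, ‖if s.natAbs ≤ l then (2 * l + 1 : ℝ) ^ n *
        (|a l| * ∑ m ∈ Finset.Icc (-(l : ℤ)) l, ‖γ l m w‖) else 0‖ ∂P =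
        complexGaussianMean * if s.natAbs ≤ l then |a l| * (2 * l + 1 : ℝ) ^ (n + 1) else 0 := by
      intro l
      split_ifs with h
      · have h0 : ∀ w, ‖(2 * l + 1 : ℝ) ^ n *
            (|a l| * ∑ m ∈ Finset.Icc (-(l : ℤ)) l, ‖γ l m w‖)‖ = (2 * l + 1 : ℝ) ^ n *
            (|a l| * ∑ m ∈ Finset.Icc (-(l : ℤ)) l, ‖γ l m w‖) := fun w =>
          Real.norm_of_nonneg (by positivity)
        simp only [h0]
        rw [integral_const_mul, integral_const_mul, integral_finsetSum _ fun m hm =>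
          integrable_norm_of_hasLaw_complexGaussian (hγ.hasLaw h hm),
          Finset.sum_congr rfl fun m hm =>
            integral_norm_of_hasLaw_complexGaussian (hγ.hasLaw h hm),
          Finset.sum_const, nsmul_eq_mul, hcard]
        ring
      · simp
    simp only [hE]
    refine Summable.mul_left _ ?_
    -- `|a| x^(n+1) ≤ a² x^(2n+4) + x⁻²`, with `x = 2l + 1 ≤ 3l` for `l ≥ 1`
    have hs1 := (ha (2 * n + 4)).mul_left ((3 : ℝ) ^ (2 * n + 4))
    have hs2 : Summable fun l : ℕ => ((l : ℝ) ^ 2)⁻¹ :=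
      Real.summable_nat_pow_inv.2 one_lt_two
    refine (summable_nat_add_iff 1).1 ?_
    refine Summable.of_nonneg_of_le (fun l => ?_) (fun l => ?_)
      ((summable_nat_add_iff 1).2 (hs1.add hs2))
    · split_ifs <;> positivity
    · have hl : (0 : ℝ) ≤ l := Nat.cast_nonneg l
      simp only [Nat.cast_add, Nat.cast_one]
      split_ifs with h
      · set x : ℝ := 2 * ((l : ℝ) + 1) + 1 with hx
        have hx0 : 0 < x := by positivity
        have hx1 : x ≤ 3 * ((l : ℝ) + 1) := by rw [hx]; linarith
        have hx2 : (l : ℝ) + 1 ≤ x := by rw [hx]; linarith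
        have hxi : (x⁻¹) ^ 2 ≤ (((l : ℝ) + 1) ^ 2)⁻¹ := by
          rw [inv_pow]
          gcongr
        have hxp : x ^ (2 * n + 4) ≤ 3 ^ (2 * n + 4) * ((l : ℝ) + 1) ^ (2 * n + 4) := by
          rw [← mul_pow]
          gcongr
        have hxx : x ^ (n + 2) * x⁻¹ = x ^ (n + 1) := by
          rw [pow_succ x (n + 1), mul_assoc, mul_inv_cancel₀ hx0.ne', mul_one]
        calc |a (l + 1)| * x ^ (n + 1) = (|a (l + 1)| * x ^ (n + 2)) * x⁻¹ := by
              rw [mul_assoc, hxx]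
          _ ≤ (|a (l + 1)| * x ^ (n + 2)) ^ 2 + (x⁻¹) ^ 2 := by
              nlinarith [sq_nonneg (|a (l + 1)| * x ^ (n + 2) - x⁻¹),
                sq_nonneg (|a (l + 1)| * x ^ (n + 2)), sq_nonneg (x⁻¹)]
          _ = a (l + 1) ^ 2 * x ^ (2 * n + 4) + (x⁻¹) ^ 2 := by
              rw [mul_pow, sq_abs, ← pow_mul]
              ring_nf
          _ ≤ a (l + 1) ^ 2 * (3 ^ (2 * n + 4) * ((l : ℝ) + 1) ^ (2 * n + 4)) +
                (((l : ℝ) + 1) ^ 2)⁻¹ := by gcongr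
          _ = _ := by ring
      · positivity

end GaussianSeries

/-! ### The law of the spin field and of its differential -/

section SpinFieldLaw

variable {Ω : Type*} {s : ℤ} {c : ℕ → ℝ} {γ : ℕ → ℤ → Ω → ℂ}

/-- The random functional `b ↦ c_l ∑_m γ^l_{m,s} b_m` on the space of the representation of
dimension `2l + 1`. The `l`-th term of the spin field at `p` is its value at the image of the
weight vector `e_s` under `p`. -/
def randomCoeff (s : ℤ) (c : ℕ → ℝ) (γ : ℕ → ℤ → Ω → ℂ) (w : Ω) (l : ℕ) : RepSpace l →L[ℂ] ℂ :=
  if s.natAbs ≤ l then (c l : ℂ) • ∑ m ∈ Finset.Icc (-(l : ℤ)) l,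
    γ l m w • (EuclideanSpace.proj (weightIndex l m) : RepSpace l →L[ℂ] ℂ)
  else 0

theorem randomCoeff_apply (w : Ω) (l : ℕ) (b : RepSpace l) :
    randomCoeff s c γ w l b = if s.natAbs ≤ l then
      (c l : ℂ) * ∑ m ∈ Finset.Icc (-(l : ℤ)) l, γ l m w * b (weightIndex l m) else 0 := by
  rw [randomCoeff]
  split_ifs
  · simp [_root_.sum_apply]
  · rfl

theorem spinTerm_eq (w : Ω) (p : SO3) (l : ℕ) :
    spinTerm s c γ w p l = randomCoeff s c γ w l (rep l p (weightVec l s)) := by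
  rw [spinTerm, randomCoeff_apply]
  split_ifs with h
  · congr 1
    refine Finset.sum_congr rfl fun m hm => ?_
    rw [wignerD_eq (abs_le.2 (Finset.mem_Icc.1 hm)) (abs_le_of_natAbs_le h)]
  · rfl

theorem spinField_eq (w : Ω) (p : SO3) : spinField s c γ p w =
    (∑' l, randomCoeff s c γ w l (rep l p (weightVec l s))).re := by
  simp only [spinField, spinTerm_eq]

theorem re_randomCoeff_apply (w : Ω) (l : ℕ) (b : RepSpace l) :
    (randomCoeff s c γ w l b).re = if s.natAbs ≤ l then
      ∑ m ∈ Finset.Icc (-(l : ℤ)) l, (γ l m w * (c l * b (weightIndex l m))).re else 0 := by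
  rw [randomCoeff_apply]
  split_ifs
  · rw [Finset.mul_sum, Complex.re_sum]
    refine Finset.sum_congr rfl fun m _ => ?_
    congr 1
    ring
  · rfl

theorem norm_randomCoeff_le (w : Ω) (l : ℕ) : ‖randomCoeff s c γ w l‖ ≤
    if s.natAbs ≤ l then |c l| * ∑ m ∈ Finset.Icc (-(l : ℤ)) l, ‖γ l m w‖ else 0 := by
  rw [randomCoeff]
  split_ifs
  · rw [norm_smul, Complex.norm_real, Real.norm_eq_abs]
    refine mul_le_mul_of_nonneg_left ((norm_sum_le _ _).trans ?_) (abs_nonneg _)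
    refine Finset.sum_le_sum fun m _ => ?_
    rw [norm_smul]
    refine mul_le_of_le_one_right (norm_nonneg _) ?_
    refine ContinuousLinearMap.opNorm_le_bound _ zero_le_one fun b => ?_
    rw [one_mul]
    exact PiLp.norm_apply_le b _
  · simp

variable [MeasurableSpace Ω] {P : Measure Ω}

/-- Almost surely, the coefficients of the spin field decay rapidly. -/
theorem ae_summable_randomCoeff (hγ : IsComplexGaussianFamily P s γ)
    (hk : SmoothlyConvergent s c) : ∀ᵐ w ∂P, ∀ n : ℕ,
      Summable fun l : ℕ => (2 * l + 1 : ℝ) ^ n * ‖randomCoeff s c γ w l‖ := by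
  filter_upwards [hγ.ae_summable hk.summable] with w hw n
  refine Summable.of_nonneg_of_le (fun l => by positivity) (fun l => ?_) (hw n)
  have h := mul_le_mul_of_nonneg_left (norm_randomCoeff_le (s := s) (c := c) (γ := γ) w l)
    (by positivity : (0 : ℝ) ≤ (2 * l + 1 : ℝ) ^ n)
  rwa [mul_ite, mul_zero] at h

theorem ae_hasSum_spinField (hγ : IsComplexGaussianFamily P s γ) (hk : SmoothlyConvergent s c) :
    ∀ᵐ w ∂P, ∀ p, HasSum (fun l => (randomCoeff s c γ w l (rep l p (weightVec l s))).re)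
      (spinField s c γ p w) := by
  filter_upwards [ae_summable_randomCoeff hγ hk] with w hw p
  have hw0 : Summable fun l => ‖randomCoeff s c γ w l‖ := by simpa using hw 0
  rw [spinField_eq]
  exact (summable_coeff (fun l => (norm_weightVec l s).le) hw0 p).hasSum.mapL Complex.reCLM

theorem integral_sq_of_hasLaw_gaussianReal {X : Ω → ℝ} {v : ℝ} (hv : 0 ≤ v)
    (hX : HasLaw X (gaussianReal 0 v.toNNReal) P) : ∫ w, X w ^ 2 ∂P = v := by
  have h0 : ∫ w, X w ∂P = 0 := by
    rw [hX.integral_eq, integral_id_gaussianReal]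
  have h1 := variance_of_integral_eq_zero hX.aemeasurable h0
  rw [hX.variance_eq, variance_id_gaussianReal, Real.coe_toNNReal _ hv] at h1
  exact h1.symm

variable [IsProbabilityMeasure P]

/-- The evaluation of the random coefficients at vectors `b_l` of the representations is a centred
Gaussian variable of variance `∑ c_l² ‖b_l‖² / 2`. -/
theorem hasLaw_of_hasSum_randomCoeff (hγ : IsComplexGaussianFamily P s γ)
    {b : ∀ l, RepSpace l} {v : ℝ} {X : Ω → ℝ}
    (hv : HasSum (fun l : ℕ => if s.natAbs ≤ l then c l ^ 2 / 2 * ‖b l‖ ^ 2 else 0) v)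
    (hX : ∀ᵐ w ∂P, HasSum (fun l => (randomCoeff s c γ w l (b l)).re) (X w)) :
    HasLaw X (gaussianReal 0 v.toNNReal) P := by
  refine hγ.hasLaw_of_hasSum (z := fun l m => c l * b l (weightIndex l m)) ?_ ?_
  · have e : (fun l : ℕ => if s.natAbs ≤ l then ∑ m ∈ Finset.Icc (-(l : ℤ)) l,
        ‖(c l : ℂ) * b l (weightIndex l m)‖ ^ 2 / 2 else 0) =
        fun l : ℕ => if s.natAbs ≤ l then c l ^ 2 / 2 * ‖b l‖ ^ 2 else 0 := by
      ext1 l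
      rw [sum_weights l fun j => ‖(c l : ℂ) * b l j‖ ^ 2 / 2, EuclideanSpace.norm_sq_eq,
        Finset.mul_sum]
      congr 1
      refine Finset.sum_congr rfl fun j _ => ?_
      rw [norm_mul, Complex.norm_real, mul_pow, Real.norm_eq_abs, sq_abs]
      ring
    rwa [e]
  · filter_upwards [hX] with w hw
    simpa only [re_randomCoeff_apply] using hw

theorem hasLaw_spinField (hγ : IsComplexGaussianFamily P s γ) (hk : SmoothlyConvergent s c)
    (hvar : HasSum (fun l : ℕ => if s.natAbs ≤ l then c l ^ 2 / 2 else 0) 1) (p : SO3) :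
    HasLaw (spinField s c γ p) (gaussianReal 0 1) P := by
  have h := hasLaw_of_hasSum_randomCoeff hγ (b := fun l => rep l p (weightVec l s))
    (X := spinField s c γ p) (v := 1) (by simpa [norm_rep_apply, norm_weightVec] using hvar) (by
      filter_upwards [ae_hasSum_spinField hγ hk] with w hw using hw p)
  rwa [Real.toNNReal_one] at h

/-- The linear combinations of the values of the spin field are the evaluations of the random
coefficients at the linear combinations of the translates of the weight vectors. -/
theorem isGaussianProcess_spinField (hγ : IsComplexGaussianFamily P s γ)
    (hk : SmoothlyConvergent s c)
    (hvar : HasSum (fun l : ℕ => if s.natAbs ≤ l then c l ^ 2 / 2 else 0) 1) :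
    IsGaussianProcess (spinField s c γ) P := by
  refine ⟨fun I => ⟨?_⟩⟩
  have hm : AEMeasurable (fun w => I.restrict fun p => spinField s c γ p w) P :=
    aemeasurable_pi_lambda _ fun p => (hasLaw_spinField hγ hk hvar p).aemeasurable
  refine isGaussian_of_map_eq_gaussianReal fun L => ?_
  set a : I → ℝ := fun i => L (Pi.single i 1) with ha
  have hL : ∀ x : I → ℝ, L x = ∑ i, a i * x i := fun x => by
    conv_lhs => rw [pi_eq_sum_univ' x, map_sum]
    refine Finset.sum_congr rfl fun i _ => ?_
    rw [map_smul, smul_eq_mul, mul_comm]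
  set b : ∀ l, RepSpace l := fun l => ∑ i : I, (a i : ℂ) • rep l i.1 (weightVec l s) with hb
  have hbn : ∀ l, ‖b l‖ ≤ ∑ i, |a i| := fun l => by
    refine (norm_sum_le _ _).trans (Finset.sum_le_sum fun i _ => ?_)
    rw [norm_smul, norm_rep_apply, norm_weightVec, mul_one, Complex.norm_real, Real.norm_eq_abs]
  have hsum : Summable fun l : ℕ =>
      if s.natAbs ≤ l then c l ^ 2 / 2 * ‖b l‖ ^ 2 else 0 := by
    refine Summable.of_nonneg_of_le (fun l => ?_) (fun l => ?_)
      (hvar.summable.mul_right ((∑ i, |a i|) ^ 2))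
    · split_ifs <;> positivity
    · rw [ite_mul, zero_mul]
      split_ifs
      · have := hbn l
        gcongr
      · exact le_rfl
  have hlaw := hasLaw_of_hasSum_randomCoeff hγ hsum.hasSum
    (X := fun w => L (I.restrict fun p => spinField s c γ p w)) (by
      filter_upwards [ae_hasSum_spinField hγ hk] with w hw
      have h := hasSum_sum (s := Finset.univ) fun (i : I) _ => (hw i.1).mul_left (a i)
      rw [hL]
      have e : (fun l => (randomCoeff s c γ w l (b l)).re) = fun l =>
          ∑ i : I, a i * (randomCoeff s c γ w l (rep l i.1 (weightVec l s))).re := by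
        ext1 l
        simp [hb, map_sum, Complex.re_sum]
      rw [e]
      exact h)
  exact ⟨0, _, (AEMeasurable.map_map_of_aemeasurable (by fun_prop) hm).trans hlaw.map_eq⟩

/-- The variance of the differential of the spin field in the direction `u`. It does not depend on
`p`, because `rep l p` is unitary. -/
theorem hasSum_variance_differential {ξ : ℝ}
    (hvar : HasSum (fun l : ℕ => if s.natAbs ≤ l then c l ^ 2 / 2 else 0) 1)
    (hξ : HasSum (fun l : ℕ => if s.natAbs ≤ l then c l ^ 2 / 2 * secondMoment s l else 0)
      (ξ ^ 2)) (p : SO3) (u : R3) :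
    HasSum (fun l : ℕ => if s.natAbs ≤ l then
        c l ^ 2 / 2 * ‖rep l p (repLie l u (weightVec l s))‖ ^ 2 else 0)
      (frameForm (ξ ^ 2) ((s : ℝ) ^ 2) u u) := by
  have h := (hξ.mul_left (u 0 ^ 2 + u 1 ^ 2)).add (hvar.mul_left (u 2 ^ 2 * (s : ℝ) ^ 2))
  have e : (fun l : ℕ => if s.natAbs ≤ l then
      c l ^ 2 / 2 * ‖rep l p (repLie l u (weightVec l s))‖ ^ 2 else 0) = fun l : ℕ =>
      (u 0 ^ 2 + u 1 ^ 2) * (if s.natAbs ≤ l then c l ^ 2 / 2 * secondMoment s l else 0) +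
        u 2 ^ 2 * (s : ℝ) ^ 2 * (if s.natAbs ≤ l then c l ^ 2 / 2 else 0) := by
    ext1 l
    split_ifs with hl
    · rw [norm_rep_apply, norm_repLie_weightVec_sq (abs_le_of_natAbs_le hl), secondMoment]
      ring
    · ring
  rw [e, frameForm_apply]
  have e2 : ξ ^ 2 * (u 0 * u 0 + u 1 * u 1) + (s : ℝ) ^ 2 * (u 2 * u 2) =
      (u 0 ^ 2 + u 1 ^ 2) * ξ ^ 2 + u 2 ^ 2 * (s : ℝ) ^ 2 * 1 := by ring
  rw [e2]
  exact h

/-- The differential of the spin field in a direction `u` is a centred Gaussian variable, whose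
variance is the sum of the `c_l² ‖π_l(u) e_s‖² / 2`. -/
theorem hasLaw_tangentDiff_spinField {ξ : ℝ} (hγ : IsComplexGaussianFamily P s γ)
    (hk : SmoothlyConvergent s c)
    (hvar : HasSum (fun l : ℕ => if s.natAbs ≤ l then c l ^ 2 / 2 else 0) 1)
    (hξ : HasSum (fun l : ℕ => if s.natAbs ≤ l then c l ^ 2 / 2 * secondMoment s l else 0)
      (ξ ^ 2)) (p : SO3) (u : R3) :
    HasLaw (fun w => tangentDiff (fun q => spinField s c γ q w) p u)
      (gaussianReal 0 (frameForm (ξ ^ 2) ((s : ℝ) ^ 2) u u).toNNReal) P := by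
  refine hasLaw_of_hasSum_randomCoeff hγ (hasSum_variance_differential hvar hξ p u) ?_
  filter_upwards [ae_summable_randomCoeff hγ hk] with w hw
  simp only [spinField_eq]
  exact hasSum_tangentDiff_coeff (fun l => (norm_weightVec l s).le) hw p u

theorem frameForm_self_nonneg {a b : ℝ} (ha : 0 ≤ a) (hb : 0 ≤ b) (u : R3) :
    0 ≤ frameForm a b u u := by
  rw [frameForm_apply]
  exact add_nonneg (mul_nonneg ha (add_nonneg (mul_self_nonneg _) (mul_self_nonneg _)))
    (mul_nonneg hb (mul_self_nonneg _))

theorem tangentDiff_add (h : SO3 → ℝ) (p : SO3) (u v : R3) :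
    tangentDiff h p (u + v : R3) = tangentDiff h p u + tangentDiff h p v :=
  map_add (mfderiv (𝓡 3) 𝓘(ℝ, ℝ) h p) u v

theorem integrable_tangentDiff_mul {ξ : ℝ} (hγ : IsComplexGaussianFamily P s γ)
    (hk : SmoothlyConvergent s c)
    (hvar : HasSum (fun l : ℕ => if s.natAbs ≤ l then c l ^ 2 / 2 else 0) 1)
    (hξ : HasSum (fun l : ℕ => if s.natAbs ≤ l then c l ^ 2 / 2 * secondMoment s l else 0)
      (ξ ^ 2)) (p : SO3) (u v : R3) :
    Integrable (fun w => tangentDiff (fun q => spinField s c γ q w) p u *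
      tangentDiff (fun q => spinField s c γ q w) p v) P :=
  (hasLaw_tangentDiff_spinField hγ hk hvar hξ p u).hasGaussianLaw.memLp_two.integrable_mul
    (hasLaw_tangentDiff_spinField hγ hk hvar hξ p v).hasGaussianLaw.memLp_two

/-- In the left-invariant frame the Adler-Taylor metric of the spin field is
`diag(ξ², ξ², s²)`. -/
theorem adlerTaylor_spinField {ξ : ℝ} (hγ : IsComplexGaussianFamily P s γ)
    (hk : SmoothlyConvergent s c)
    (hvar : HasSum (fun l : ℕ => if s.natAbs ≤ l then c l ^ 2 / 2 else 0) 1)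
    (hξ : HasSum (fun l : ℕ => if s.natAbs ≤ l then c l ^ 2 / 2 * secondMoment s l else 0)
      (ξ ^ 2)) (p : SO3) (u v : R3) :
    adlerTaylor P (spinField s c γ) p u v = frameForm (ξ ^ 2) ((s : ℝ) ^ 2) u v := by
  set d : R3 → Ω → ℝ := fun u w => tangentDiff (fun q => spinField s c γ q w) p u with hd
  have hlaw : ∀ u, HasLaw (d u)
      (gaussianReal 0 (frameForm (ξ ^ 2) ((s : ℝ) ^ 2) u u).toNNReal) P :=
    hasLaw_tangentDiff_spinField hγ hk hvar hξ p
  have hsq : ∀ u, ∫ w, d u w ^ 2 ∂P = frameForm (ξ ^ 2) ((s : ℝ) ^ 2) u u := fun u =>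
    integral_sq_of_hasLaw_gaussianReal (frameForm_self_nonneg (sq_nonneg _) (sq_nonneg _) u)
      (hlaw u)
  have hi : ∀ u, Integrable (fun w => d u w ^ 2) P := fun u =>
    (hlaw u).hasGaussianLaw.memLp_two.integrable_sq
  have hadd : ∀ w, d (u + v) w = d u w + d v w := fun w => tangentDiff_add _ p u v
  have h1 : ∀ w, d u w * d v w = 2⁻¹ * (d (u + v) w ^ 2 - (d u w ^ 2 + d v w ^ 2)) := fun w => by
    rw [hadd]
    ring
  change ∫ w, d u w * d v w ∂P = _
  simp only [h1]
  rw [integral_const_mul, integral_sub (hi _) (by exact (hi u).add (hi v)),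
    integral_add (hi _) (hi _), hsq, hsq, hsq]
  simp only [frameForm_apply, PiLp.add_apply]
  ring

/-- For `s ≠ 0` only terms with `l ≥ 1` occur, and then the weights in `ξ²` are at least `1/2`. -/
theorem half_le_sq_of_hasSum {ξ : ℝ} (hs : s ≠ 0)
    (hvar : HasSum (fun l : ℕ => if s.natAbs ≤ l then c l ^ 2 / 2 else 0) 1)
    (hξ : HasSum (fun l : ℕ => if s.natAbs ≤ l then c l ^ 2 / 2 * secondMoment s l else 0)
      (ξ ^ 2)) : 1 / 2 ≤ ξ ^ 2 := by
  have h := hasSum_le (fun l => ?_) (hvar.mul_right (1 / 2)) hξ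
  · simpa using h
  · rw [ite_mul, zero_mul]
    split_ifs with hl
    · refine mul_le_mul_of_nonneg_left ?_ (by positivity)
      have h1 : 1 ≤ l := (Int.natAbs_pos.2 hs).trans_le hl
      have h2 : (1 : ℝ) ≤ l := by exact_mod_cast h1
      linarith [half_le_secondMoment hl]
    · exact le_rfl

theorem scalarCurvature_frameForm {a b : ℝ} (ha : a ≠ 0) (hb : b ≠ 0) (p : SO3) :
    scalarCurvature (fun (_ : SO3) (u v : R3) => frameForm a b u v) p =
      2 / a - b / (2 * a ^ 2) := by
  rw [← coordScalarCurvature_coordGram ha hb, ← gramMatrix_cayleyChart_symm a b p,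
    ← cayleyChart_self p]
  rfl

end SpinFieldLaw

end SpinField

end

theorem theorem1p3 {Ω : Type*} [MeasurableSpace Ω] (P : Measure Ω) [IsProbabilityMeasure P]
    (s : ℤ) (c : ℕ → ℝ) (γ : ℕ → ℤ → Ω → ℂ) (ξ : ℝ)
    (hc : ∀ l : ℕ, s.natAbs ≤ l → 0 ≤ c l)
    (hγ : SpinField.IsComplexGaussianFamily P s γ)
    (hk : SpinField.SmoothlyConvergent s c)
    (hvar : HasSum (fun l : ℕ => if s.natAbs ≤ l then c l ^ 2 / 2 else 0) 1)
    (hξ : HasSum (fun l : ℕ => if s.natAbs ≤ l then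
      c l ^ 2 / 2 * (((l : ℝ) * (l + 1) - (s : ℝ) ^ 2) / 2) else 0) (ξ ^ 2)) :
    -- the series converges, and `f` is a smooth Gaussian field, centred and of unit variance
    (∀ᵐ w ∂P, ∀ p : SpinField.SO3, Summable (SpinField.spinTerm s c γ w p)) ∧
    IsGaussianProcess (SpinField.spinField s c γ) P ∧
    (∀ p : SpinField.SO3, HasLaw (SpinField.spinField s c γ p) (gaussianReal 0 1) P) ∧
    (∀ᵐ w ∂P, ContMDiff (𝓡 3) 𝓘(ℝ, ℝ) ∞
      (fun p : SpinField.SO3 => SpinField.spinField s c γ p w)) ∧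
    -- `ξ` is given by the circular covariance
    ξ ^ 2 = -iteratedDeriv 2 (SpinField.circularCov s c) 0 / 2 ∧
    -- the expectations that define the form `g^f` exist
    (∀ (p : SpinField.SO3) (u v : TangentSpace (𝓡 3) p),
      Integrable (fun w => SpinField.tangentDiff (fun q => SpinField.spinField s c γ q w) p u *
        SpinField.tangentDiff (fun q => SpinField.spinField s c γ q w) p v) P) ∧
    -- the Gram matrices of `g^f` and of the standard metric in Euler angles
    (∀ x : SpinField.R3,
      SpinField.gramMatrix (SpinField.adlerTaylor P (SpinField.spinField s c γ))
        SpinField.euler x = SpinField.sigmaMatrix ξ s x) ∧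
    (∀ x : SpinField.R3,
      SpinField.gramMatrix SpinField.standardMetric SpinField.euler x =
        SpinField.sigmaMatrix 1 1 x) ∧
    -- the eigenvalues of `g^f` with respect to the standard metric
    (∀ p : SpinField.SO3,
      SpinField.HasRelativeEigenvalues
        (SpinField.adlerTaylor P (SpinField.spinField s c γ) p)
        (SpinField.standardMetric p) {ξ ^ 2, ξ ^ 2, (s : ℝ) ^ 2}) ∧
    -- if `s ≠ 0`, then `g^f` is a smooth Riemannian metric with constant scalar curvature
    (s ≠ 0 → ∃ g : Bundle.ContMDiffRiemannianMetric (𝓡 3) ∞ SpinField.R3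
        (fun p : SpinField.SO3 => TangentSpace (𝓡 3) p),
      (∀ (p : SpinField.SO3) (u v : TangentSpace (𝓡 3) p),
        g.inner p u v = SpinField.adlerTaylor P (SpinField.spinField s c γ) p u v) ∧
      ∀ p : SpinField.SO3,
        SpinField.scalarCurvature (fun q u v => g.inner q u v) p =
          2 / ξ ^ 2 - (s : ℝ) ^ 2 / (2 * ξ ^ 4)) := by
  have hξ' : HasSum (fun l : ℕ => if s.natAbs ≤ l then
      c l ^ 2 / 2 * SpinField.secondMoment s l else 0) (ξ ^ 2) := hξ
  have hAT : ∀ (p : SpinField.SO3) (u v : SpinField.R3),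
      SpinField.adlerTaylor P (SpinField.spinField s c γ) p u v =
        SpinField.frameForm (ξ ^ 2) ((s : ℝ) ^ 2) u v :=
    SpinField.adlerTaylor_spinField hγ hk hvar hξ'
  refine ⟨?_, SpinField.isGaussianProcess_spinField hγ hk hvar,
    SpinField.hasLaw_spinField hγ hk hvar, ?_, hξ'.unique hk.hasSum_secondMoment,
    SpinField.integrable_tangentDiff_mul hγ hk hvar hξ', SpinField.gramMatrix_euler hAT,
    SpinField.gramMatrix_euler fun p u v => ?_, fun p => ?_, fun hs => ?_⟩
  · filter_upwards [SpinField.ae_summable_randomCoeff hγ hk] with w hw p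
    have hw0 : Summable fun l => ‖SpinField.randomCoeff s c γ w l‖ := by simpa using hw 0
    rw [show SpinField.spinTerm s c γ w p = _ from funext (SpinField.spinTerm_eq w p)]
    exact SpinField.summable_coeff (fun l => (SpinField.norm_weightVec l s).le) hw0 p
  · filter_upwards [SpinField.ae_summable_randomCoeff hγ hk] with w hw
    simp only [SpinField.spinField_eq]
    exact SpinField.contMDiff_tsum_coeff (fun l => (SpinField.norm_weightVec l s).le) hw
  · rw [one_pow]
    exact SpinField.standardMetric_eq p u v
  · have e1 : SpinField.adlerTaylor P (SpinField.spinField s c γ) p =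
        fun u v : SpinField.R3 => SpinField.frameForm (ξ ^ 2) ((s : ℝ) ^ 2) u v :=
      funext fun u => funext fun v => hAT p u v
    have e2 : SpinField.standardMetric p =
        fun u v : SpinField.R3 => SpinField.frameForm 1 1 u v :=
      funext fun u => funext fun v => SpinField.standardMetric_eq p u v
    rw [e1, e2]
    exact SpinField.hasRelativeEigenvalues_frameForm _ _
  · have hξ0 : 0 < ξ ^ 2 := by linarith [SpinField.half_le_sq_of_hasSum hs hvar hξ']
    have hs0 : 0 < (s : ℝ) ^ 2 := by positivity
    refine ⟨SpinField.frameMetric hξ0 hs0, fun p u v => (hAT p u v).symm, fun p => ?_⟩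
    refine (SpinField.scalarCurvature_frameForm hξ0.ne' hs0.ne' p).trans ?_
    rw [← pow_mul]
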